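/- **Notation.** For $0<q\le\infty$ put $\|g\|_{q,A}=(\int_A|g|^q)^{1/q}$ ($q<\infty$), $\|g\|_{\infty,A}=\operatorname{ess\,sup}_A|g|$, and $\|f\|_{q,v,A}=\|fv\|_{q,A}$. For $0<q,r\le\infty$ define $q\to r$ by $\frac1{q\to r}=\frac1r-\frac1q$ if $r<q$ and $q\to r=\infty$ if $r\ge q$. Put $0\cdot\infty=0$ and $1/\infty=0$. A weight on $\mathbb R^n$ ($n\ge1$) is a measurable function that is positive and finite a.e.; $B(0,t)$ is the open ball and ${}^cB(0,t)$ its complement. For measurable $\omega:(0,\infty)\to[0,\infty]$ write $\omega\in\Omega_\theta$ if $0<\|\omega\|_{\theta,(t,\infty)}<\infty$ for all $t>0$, and $\omega\in{}^c\Omega_\theta$ if $0<\|\omega\|_{\theta,(0,t)}<\infty$ for all $t>0$. $LM_{p\theta,\omega}(\mathbb R^n,v)$ is the set of $f\in L^{\rm loc}_{p,v}(\mathbb R^n)$ (that is, measurable $f$ with $\|f\|_{p,v,K}<\infty$ for all compact $K$) with $\big\|\|f\|_{p,v,B(0,\cdot)}\big\|_{\theta,\omega,(0,\infty)}<\infty$,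 and ${}^cLM_{p\theta,\omega}(\mathbb R^n,v)$ is the set of measurable $f$ with $\|f\|_{p,v,{}^cB(0,t)}<\infty$ for all $t>0$ and $\big\|\|f\|_{p,v,{}^cB(0,\cdot)}\big\|_{\theta,\omega,(0,\infty)}<\infty$; these expressions are their quasi-norms. $\|\mathrm{Id}\|_{X\to Y}$ is the least $c$ with $X\subset Y$ and $\|f\|_Y\le c\|f\|_X$ for all $f\in X$ ($\infty$ if there is none). $a\approx b$ means $c\,b\le a\le C\,b$ (in $[0,\infty]$). **Theorem.** Let $0<\theta_1,\theta_2<\infty$ and $0<p<\min\{\theta_1,\theta_2\}$. There are constants $0<c,C<\infty$, depending only on $p,\theta_1,\theta_2$, such that the equivalences below hold with these constants for all $n\ge1$, all weights $v_1,v_2$ on $\mathbb R^n$ such that $v_1^{-1}v_2$ is (a.e. equal to) a continuous real function on $\mathbb R^n$, all $\omega_1\in{}^c\Omega_{\theta_1}$ and all $\omega_2\in\Omega_{\theta_2}$. Put $\widetilde V(x)=\|v_1^{-1}v_2\|_{\infty,B(0,x)}$, let $d\mu(t)=d\big(-\|\omega_1\|_{\theta_1,(0,t)}^{-(\theta_1\to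 p)}\big)$ (Lebesgue–Stieltjes measure on $(0,\infty)$), and $\|\mathrm{Id}\|=\|\mathrm{Id}\|_{{}^cLM_{p\theta_1,\omega_1}(\mathbb R^n,v_1)\to LM_{p\theta_2,\omega_2}(\mathbb R^n,v_2)}$. (i) If $\theta_1\le\theta_2$, then $$\|\mathrm{Id}\|\approx\sup_{x>0}\Big(\widetilde V(x)^{\theta_1\to p}\int_x^\infty d\mu+\int_0^x\widetilde V(t)^{\theta_1\to p}d\mu(t)\Big)^{\frac1{\theta_1\to p}}\|\omega_2\|_{\theta_2,(x,\infty)}+\|\omega_1\|_{\theta_1,(0,\infty)}^{-1}\sup_{t>0}\widetilde V(t)\|\omega_2\|_{\theta_2,(t,\infty)}.$$ (ii) If $\theta_2<\theta_1$, then $$\|\mathrm{Id}\|\approx\Big(\int_0^\infty\Big(\int_x^\infty d\mu\Big)^{\frac{\theta_1\to\theta_2}{\theta_2\to p}}\Big(\sup_{0<\tau\le x}\widetilde V(\tau)\|\omega_2\|_{\theta_2,(\tau,\infty)}\Big)^{\theta_1\to\theta_2}d\mu(x)\Big)^{\frac1{\theta_1\to\theta_2}}$$ $$+\Big(\int_0^\infty\Big(\int_0^x\widetilde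 V(t)^{\theta_1\to p}d\mu(t)\Big)^{\frac{\theta_1\to\theta_2}{\theta_2\to p}}\widetilde V(x)^{\theta_1\to p}\|\omega_2\|_{\theta_2,(x,\infty)}^{\theta_1\to\theta_2}\,d\mu(x)\Big)^{\frac1{\theta_1\to\theta_2}}+\|\omega_1\|_{\theta_1,(0,\infty)}^{-1}\sup_{t>0}\widetilde V(t)\|\omega_2\|_{\theta_2,(t,\infty)}.$$ -/

import Mathlib

open MeasureTheory Set Filter Topology
open scoped ENNReal NNReal

noncomputable section

namespace Morrey

/-- The space `ℝⁿ` with its Euclidean norm. -/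
abbrev E (n : ℕ) : Type := EuclideanSpace ℝ (Fin n)

/-- The functional `‖g‖_{p,A}`, for `p ∈ (0,∞]`, of a function with values in `[0,∞]`: it is
`(∫_A g ^ p) ^ (1/p)` if `p < ∞` and `ess sup_A g` if `p = ∞`. -/
def nrm {α : Type*} [MeasureSpace α] (p : ℝ≥0∞) (A : Set α) (g : α → ℝ≥0∞) : ℝ≥0∞ :=
  eLpNorm g p (volume.restrict A)

/-- The weighted functional `‖f‖_{p,v,A} = ‖f v‖_{p,A}`. -/
def wnrm {n : ℕ} (p : ℝ≥0∞) (v : E n → ℝ≥0∞) (A : Set (E n)) (f : E n → ℝ) : ℝ≥0∞ :=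
  nrm p A (fun x => ‖f x‖ₑ * v x)

/-- Weights on `ℝⁿ`: (Lebesgue) measurable functions, positive and finite almost everywhere. -/
structure IsWeight {n : ℕ} (v : E n → ℝ≥0∞) : Prop where
  aemeasurable : AEMeasurable v volume
  pos : ∀ᵐ x, 0 < v x
  finite : ∀ᵐ x, v x < ∞

/-- The quasi-norm of the weighted local Morrey-type space `LM_{pθ,ω}(ℝⁿ,v)`. -/
def localNorm {n : ℕ} (p θ : ℝ≥0∞) (ω : ℝ → ℝ≥0∞) (v : E n → ℝ≥0∞) (f : E n → ℝ) : ℝ≥0∞ :=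
  nrm θ (Ioi 0) (fun t : ℝ => wnrm p v (Metric.ball 0 t) f * ω t)

/-- The weighted local Morrey-type space `LM_{pθ,ω}(ℝⁿ,v)`. -/
def localSpace {n : ℕ} (p θ : ℝ≥0∞) (ω : ℝ → ℝ≥0∞) (v : E n → ℝ≥0∞) : Set (E n → ℝ) :=
  {f | AEMeasurable f volume ∧ (∀ K : Set (E n), IsCompact K → wnrm p v K f < ∞) ∧
    localNorm p θ ω v f < ∞}

/-- The quasi-norm of the weighted complementary local Morrey-type space. -/
def complNorm {n : ℕ} (p θ : ℝ≥0∞) (ω : ℝ → ℝ≥0∞) (v : E n → ℝ≥0∞) (f : E n → ℝ) : ℝ≥0∞ :=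
  nrm θ (Ioi 0) (fun t : ℝ => wnrm p v (Metric.ball 0 t)ᶜ f * ω t)

/-- The weighted complementary local Morrey-type space `ᶜLM_{pθ,ω}(ℝⁿ,v)`. -/
def complSpace {n : ℕ} (p θ : ℝ≥0∞) (ω : ℝ → ℝ≥0∞) (v : E n → ℝ≥0∞) : Set (E n → ℝ) :=
  {f | AEMeasurable f volume ∧ (∀ t : ℝ, 0 < t → wnrm p v (Metric.ball 0 t)ᶜ f < ∞) ∧
    complNorm p θ ω v f < ∞}

/-- The best constant `‖Id‖_{X → Y}` of the embedding of `X` (with quasi-norm `nX`) into `Y`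
(with quasi-norm `nY`). It is `∞` if there is no continuous embedding. -/
def embeddingNorm {F : Type*} (X Y : Set F) (nX nY : F → ℝ≥0∞) : ℝ≥0∞ :=
  sInf {c : ℝ≥0∞ | c < ∞ ∧ X ⊆ Y ∧ ∀ f ∈ X, nY f ≤ c * nX f}

/-- The class `Ω_θ` of functions `ω ≥ 0` on `(0,∞)` with `0 < ‖ω‖_{θ,(t,∞)} < ∞` for all `t`. -/
structure MemOmega (θ : ℝ≥0∞) (ω : ℝ → ℝ≥0∞) : Prop where
  aemeasurable : AEMeasurable ω (volume.restrict (Ioi 0))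
  pos : ∀ t : ℝ, 0 < t → 0 < nrm θ (Ioi t) ω
  finite : ∀ t : ℝ, 0 < t → nrm θ (Ioi t) ω < ∞

/-- The class `ᶜΩ_θ` of functions `ω ≥ 0` on `(0,∞)` with `0 < ‖ω‖_{θ,(0,t)} < ∞` for all `t`. -/
structure MemComplOmega (θ : ℝ≥0∞) (ω : ℝ → ℝ≥0∞) : Prop where
  aemeasurable : AEMeasurable ω (volume.restrict (Ioi 0))
  pos : ∀ t : ℝ, 0 < t → 0 < nrm θ (Ioo 0 t) ω
  finite : ∀ t : ℝ, 0 < t → nrm θ (Ioo 0 t) ω < ∞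

open Classical in
/-- The exponent `p → q`: `1 / (p → q) = 1/q - 1/p` if `q < p`, and `p → q = ∞` if `q ≥ p`. -/
def arrow (p q : ℝ≥0∞) : ℝ≥0∞ :=
  if q < p then (1 / q - 1 / p)⁻¹ else ∞

/-- The function `Ṽ(x) = ‖v₁⁻¹ v₂‖_{p₁ → p₂, B(0,x)}`. -/
def tildeV {n : ℕ} (p₁ p₂ : ℝ≥0∞) (v₁ v₂ : E n → ℝ≥0∞) (x : ℝ) : ℝ≥0∞ :=
  nrm (arrow p₁ p₂) (Metric.ball 0 x) (fun y => (v₁ y)⁻¹ * v₂ y)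

open Classical in
/-- The Lebesgue-Stieltjes measure `dF` on `(0,∞)` of a function `F` that is nondecreasing and
finite on `(0,∞)` (possibly unbounded near `0`). The half-line is parametrized by the real line
through the exponential: `dF` is the image under `exp` of the Stieltjes measure of `F ∘ exp`. -/
def stieltjes (F : ℝ → ℝ) : Measure ℝ :=
  if h : Monotone (fun s : ℝ => F (Real.exp s)) then
    (h.stieltjesFunction.measure).map Real.exp
  else 0

/-- For a continuous nondecreasing `F` on `(0,∞)`, the measure `dF` gives `(a,b]` the mass
`F b - F a`. -/
theorem stieltjes_Ioc {F : ℝ → ℝ} (hF : MonotoneOn F (Ioi 0)) (hc : ContinuousOn F (Ioi 0))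
    {a b : ℝ} (ha : 0 < a) (hab : a ≤ b) :
    stieltjes F (Ioc a b) = ENNReal.ofReal (F b - F a) := by
  have h : Monotone (fun s : ℝ => F (Real.exp s)) := fun x y hxy =>
    hF (Real.exp_pos x) (Real.exp_pos y) (Real.exp_le_exp.2 hxy)
  have hb : 0 < b := ha.trans_le hab
  have hcont : Continuous (fun s : ℝ => F (Real.exp s)) :=
    hc.comp_continuous Real.continuous_exp Real.exp_pos
  have hval : ∀ s, h.stieltjesFunction s = F (Real.exp s) := fun s => by
    rw [h.stieltjesFunction_eq]
    exact hcont.continuousAt.continuousWithinAt.rightLim_eq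
  have hpre : Real.exp ⁻¹' Ioc a b = Ioc (Real.log a) (Real.log b) := by
    ext s
    simp only [mem_preimage, mem_Ioc]
    rw [Real.log_lt_iff_lt_exp ha, Real.le_log_iff_exp_le hb]
  rw [stieltjes, dif_pos h, Measure.map_apply Real.measurable_exp measurableSet_Ioc, hpre,
    StieltjesFunction.measure_Ioc, hval, hval, Real.exp_log ha, Real.exp_log hb]

/-- The measure `d(-‖ω‖_{θ,(0,t)}^{-(θ → p)})` on `(0,∞)`. -/
def dNeg (θ p : ℝ≥0∞) (ω : ℝ → ℝ≥0∞) : Measure ℝ :=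
  stieltjes (fun t => -((nrm θ (Ioo 0 t) ω) ^ (-(arrow θ p).toReal)).toReal)

section Terms

variable {n : ℕ} (p θ₁ θ₂ : ℝ≥0∞) (v₁ v₂ : E n → ℝ≥0∞) (ω₁ ω₂ : ℝ → ℝ≥0∞)

/-- `‖ω₁‖_{θ₁,(0,∞)}⁻¹ · sup_{t > 0} Ṽ(t) ‖ω₂‖_{θ₂,(t,∞)}`, with `1/∞ = 0` and `0 · ∞ = 0`. -/
def endTerm : ℝ≥0∞ :=
  (nrm θ₁ (Ioi 0) ω₁)⁻¹ * ⨆ t ∈ Ioi (0 : ℝ), tildeV p p v₁ v₂ t * nrm θ₂ (Ioi t) ω₂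

/-- With `μ = d(-‖ω₁‖_{θ₁,(0,t)}^{-(θ₁ → p)})`, the expression
`sup_{x > 0} (Ṽ(x)^{θ₁ → p} ∫_x^∞ dμ + ∫_0^x Ṽ^{θ₁ → p} dμ)^{1/(θ₁ → p)} ‖ω₂‖_{θ₂,(x,∞)}`. -/
def supTerm : ℝ≥0∞ :=
  ⨆ x ∈ Ioi (0 : ℝ),
    (tildeV p p v₁ v₂ x ^ (arrow θ₁ p).toReal * dNeg θ₁ p ω₁ (Ioi x)
        + ∫⁻ t in Ioo 0 x, tildeV p p v₁ v₂ t ^ (arrow θ₁ p).toReal ∂(dNeg θ₁ p ω₁))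
      ^ (1 / (arrow θ₁ p).toReal) * nrm θ₂ (Ioi x) ω₂

/-- With `μ` as above, the expression `(∫_0^∞ (∫_x^∞ dμ)^{(θ₁ → θ₂)/(θ₂ → p)}
(sup_{0 < τ ≤ x} Ṽ(τ) ‖ω₂‖_{θ₂,(τ,∞)})^{θ₁ → θ₂} dμ(x))^{1/(θ₁ → θ₂)}`. -/
def intTerm₁ : ℝ≥0∞ :=
  (∫⁻ x in Ioi 0,
    dNeg θ₁ p ω₁ (Ioi x) ^ ((arrow θ₁ θ₂).toReal / (arrow θ₂ p).toReal)
      * (⨆ τ ∈ Ioc 0 x, tildeV p p v₁ v₂ τ * nrm θ₂ (Ioi τ) ω₂) ^ (arrow θ₁ θ₂).toReal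
    ∂(dNeg θ₁ p ω₁)) ^ (1 / (arrow θ₁ θ₂).toReal)

/-- With `μ` as above, the expression
`(∫_0^∞ (∫_0^x Ṽ^{θ₁ → p} dμ)^{(θ₁ → θ₂)/(θ₂ → p)} Ṽ(x)^{θ₁ → p} ‖ω₂‖_{θ₂,(x,∞)}^{θ₁ → θ₂}
dμ(x))^{1/(θ₁ → θ₂)}`. -/
def intTerm₂ : ℝ≥0∞ :=
  (∫⁻ x in Ioi 0,
    (∫⁻ t in Ioo 0 x, tildeV p p v₁ v₂ t ^ (arrow θ₁ p).toReal ∂(dNeg θ₁ p ω₁))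
        ^ ((arrow θ₁ θ₂).toReal / (arrow θ₂ p).toReal)
      * tildeV p p v₁ v₂ x ^ (arrow θ₁ p).toReal
      * nrm θ₂ (Ioi x) ω₂ ^ (arrow θ₁ θ₂).toReal
    ∂(dNeg θ₁ p ω₁)) ^ (1 / (arrow θ₁ θ₂).toReal)

end Terms

/-- The norm `‖Id‖` of the embedding `ᶜLM_{p₁θ₁,ω₁}(ℝⁿ,v₁) ↪ LM_{p₂θ₂,ω₂}(ℝⁿ,v₂)`. -/
def morreyEmbeddingNorm {n : ℕ} (p₁ θ₁ p₂ θ₂ : ℝ≥0∞) (v₁ v₂ : E n → ℝ≥0∞)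
    (ω₁ ω₂ : ℝ → ℝ≥0∞) : ℝ≥0∞ :=
  embeddingNorm (complSpace p₁ θ₁ ω₁ v₁) (localSpace p₂ θ₂ ω₂ v₂)
    (complNorm p₁ θ₁ ω₁ v₁) (localNorm p₂ θ₂ ω₂ v₂)

/-- `a` and `b` are equivalent with constants `c` and `C`. -/
def EquivWith (c C : ℝ≥0) (a b : ℝ≥0∞) : Prop :=
  c * b ≤ a ∧ a ≤ C * b

end Morrey

end

/-!
The embedding is a one-dimensional inequality in disguise. Let `a = θ₁ / p`, `β = θ₂ / p`, let
`m = ω₁ ^ θ₁ dt` and `q = ω₂ ^ θ₂ dt` on `(0,∞)`, and `V = Ṽ ^ p`. If `h` is the radial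
distribution of `(|f| v₁) ^ p`, then the `p`-th power of the norm of `f` in the complementary space is
`(∫ h(t,∞) ^ a dm) ^ (1/a)`, and that of its norm in the local space is at most
`(∫ (∫_{(0,t)} V dh) ^ β dq) ^ (1/β)` (`morreyEmbeddingNorm_le`). Conversely every measure `h` arises
up to a constant: spread its mass at `s` over the points of the ball `B(0,s)` where `v₁⁻¹ v₂` is at
least half of its supremum (`exists_density_of_measure`, `operatorBound_of_embedding`). So `‖Id‖ ^ p`
is comparable to the best constant `K` in `(∫ (∫_{(0,t)} V dh) ^ β dq) ^ (1/β)
≤ K (∫ h(t,∞) ^ a dm) ^ (1/a)`. Let `W(t) = m(0,t)`, `U(t) = q(t,∞)`, let `b` be the exponent conjugate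
to `a`; the measure `μ` of the theorem is `d(-W ^ (1 - b))`, called `dualMeasure` below
(`dNeg_eq_dualMeasure`).

For the upper estimate, write `1 = W(s) (∫_s^t W ^ (-2) dW + 1 / W(t))` for `s < t`. This bounds
`∫_{(0,t)} V dh` by two terms (`lintegral_Iio_le_add`). The first is a Hardy operator for the measure
`ν = V ^ b dμ`, applied to a function controlled by the averages `W(x)⁻¹ ∫_{(0,x)} h(y,∞) dm(y)`
(`exists_density`); these averages are bounded by Hardy's inequality, and the Hardy operator by the
weighted Hardy inequality of Muckenhoupt and Maz'ya (`weighted_hardy_of_le`, `weighted_hardy_of_lt`).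
The second is the local part `W(t)⁻¹ ∫_{(0,t)} V W dh`, which depends on `V` only through a majorant
of `V U ^ (1/β)` (`lintegral_local_part_le`). The results are `operator_upper_of_le` and
`operator_upper_of_lt`.

For the lower estimate the operator is tested on point masses (`OperatorBound.mul_rpow_le`), on
the density `V ^ (b - 1) dμ` (`OperatorBound.measure_rpow_le`), on the extremal density of the weighted
Hardy inequality (`OperatorBound.lintegral_measure_rpow_le`), and, for the condition with the running
supremum, on a sum of point masses placed where this supremum crosses the levels `2 ^ k`
(`OperatorBound.lintegral_finsetSup_le`).

All the measures on the half-line that enter the estimates are atomless, and this replaces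
regularity: the distribution function of an atomless measure transports it to Lebesgue measure
(`map_measure_Iio`), so powers of distribution functions are integrated as powers of the variable.
-/


noncomputable section

namespace Morrey

/-! ### Atomless measures on the line and their distribution functions -/

/-- The distribution function `s ↦ l (Iio s)` of an atomless measure takes values at most `c`
only on a set of measure at most `c`. -/
theorem measure_setOf_measure_Iio_le (l : Measure ℝ) [NullSingletonClass l] (c : ℝ≥0∞) :
    l {s | l (Iio s) ≤ c} ≤ c := by
  set A : Set ℝ := {s | l (Iio s) ≤ c} with hA
  rcases A.eq_empty_or_nonempty with h0 | hne
  · simp [h0]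
  have key : ∀ z : ℝ, (∀ y < z, y ∈ A) → l (Iio z) ≤ c := by
    intro z hz
    obtain ⟨u, hu, hlt, hlim⟩ := exists_seq_strictMono_tendsto z
    have hU : Iio z = ⋃ n, Iio (u n) := by
      ext y
      simp only [mem_Iio, mem_iUnion]
      constructor
      · intro hy
        exact ((tendsto_order.1 hlim).1 y hy).exists
      · rintro ⟨n, hn⟩
        exact hn.trans (hlt n)
    have hmono : Monotone fun n => Iio (u n) := fun i j hij => Iio_subset_Iio (hu.monotone hij)
    rw [hU, hmono.measure_iUnion]
    exact iSup_le fun n => hz _ (hlt n)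
  have hlow : ∀ x ∈ A, ∀ y < x, y ∈ A := fun x hx y hy =>
    (measure_mono (Iio_subset_Iio hy.le)).trans hx
  by_cases hb : BddAbove A
  · have h1 : A ⊆ Iic (sSup A) := fun x hx => le_csSup hb hx
    refine (measure_mono h1).trans ?_
    rw [← measure_congr Iio_ae_eq_Iic]
    refine key _ fun y hy => ?_
    obtain ⟨x, hx, hyx⟩ := exists_lt_of_lt_csSup hne hy
    exact hlow x hx y hyx
  · have hall : ∀ y : ℝ, y ∈ A := fun y => by
      obtain ⟨x, hx, hyx⟩ := not_bddAbove_iff.1 hb y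
      exact hlow x hx y hyx
    have hU : A = ⋃ n : ℕ, Iio (n : ℝ) := by
      ext y
      simp only [hall y, mem_iUnion, mem_Iio, true_iff]
      exact exists_nat_gt y
    have hmono : Monotone fun n : ℕ => Iio (n : ℝ) :=
      fun i j hij => Iio_subset_Iio (by exact_mod_cast hij)
    rw [hU, hmono.measure_iUnion]
    exact iSup_le fun n => hall _

theorem measure_setOf_measure_Ioi_le (l : Measure ℝ) [NullSingletonClass l] (c : ℝ≥0∞) :
    l {s | l (Ioi s) ≤ c} ≤ c := by
  have hneg : MeasurableEmbedding (fun x : ℝ => -x) := (MeasurableEquiv.neg ℝ).measurableEmbedding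
  have : NullSingletonClass (l.map fun x : ℝ => -x) := ⟨fun x => by
    rw [hneg.map_apply]
    exact (Set.Subsingleton.preimage subsingleton_singleton neg_injective).measure_zero _⟩
  have h := measure_setOf_measure_Iio_le (l.map fun x : ℝ => -x) c
  rw [hneg.map_apply] at h
  simpa [hneg.map_apply] using h

theorem measurable_measure_Iio (l : Measure ℝ) : Measurable fun s : ℝ => l (Iio s) :=
  (show Monotone fun s : ℝ => l (Iio s) from
    fun _ _ h => measure_mono (Iio_subset_Iio h)).measurable

theorem measurable_measure_Ioi (l : Measure ℝ) : Measurable fun s : ℝ => l (Ioi s) :=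
  (show Antitone fun s : ℝ => l (Ioi s) from
    fun _ _ h => measure_mono (Ioi_subset_Ioi h)).measurable

/-- The half of the chain rule `d (L ^ (1 + γ)) = (1 + γ) L ^ γ dL` that is needed below, for the
distribution function `L` of an atomless measure; no finiteness is assumed. -/
theorem measure_Iio_rpow_le (l : Measure ℝ) [NullSingletonClass l] {γ : ℝ} (hγ : 0 ≤ γ) (t : ℝ) :
    l (Iio t) ^ (1 + γ) ≤ 2 ^ (1 + γ) * ∫⁻ s in Iio t, l (Iio s) ^ γ ∂l := by
  have hpos : 0 < 1 + γ := by linarith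
  have hm := measurable_measure_Iio l
  set L := l (Iio t) with hL
  -- the part of `Iio t` on which the distribution function exceeds `c` has mass at least `L - c`
  have key : ∀ c : ℝ≥0∞, c ≠ ∞ → c ^ γ * (L - c) ≤ ∫⁻ s in Iio t, l (Iio s) ^ γ ∂l := by
    intro c hc
    have hms : MeasurableSet {s : ℝ | l (Iio s) ≤ c} := measurableSet_le hm measurable_const
    have h1 : L - c ≤ l (Iio t \ {s | l (Iio s) ≤ c}) :=
      (tsub_le_tsub_left (measure_setOf_measure_Iio_le l c) _).trans le_measure_sdiff
    calc c ^ γ * (L - c) ≤ c ^ γ * l (Iio t \ {s | l (Iio s) ≤ c}) := by gcongr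
      _ = ∫⁻ s in Iio t \ {s | l (Iio s) ≤ c}, c ^ γ ∂l := by simp
      _ ≤ ∫⁻ s in Iio t \ {s | l (Iio s) ≤ c}, l (Iio s) ^ γ ∂l := by
          refine setLIntegral_mono' (measurableSet_Iio.diff hms) fun s hs => ?_
          have : c ≤ l (Iio s) := (not_le.1 hs.2).le
          gcongr
      _ ≤ _ := lintegral_mono_set sdiff_subset
  rcases eq_or_ne L ∞ with hT | hT
  · have := key 1 ENNReal.one_ne_top
    rw [hT, ENNReal.top_sub ENNReal.one_ne_top, ENNReal.one_rpow, one_mul, top_le_iff] at this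
    rw [this, ENNReal.mul_top (by simp [hpos])]
    exact le_top
  · have h2 := key (L / 2) (ENNReal.div_ne_top hT (by simp))
    rw [ENNReal.sub_half hT] at h2
    calc L ^ (1 + γ) = 2 ^ (1 + γ) * (L / 2) ^ (1 + γ) := by
          rw [← ENNReal.mul_rpow_of_nonneg _ _ hpos.le, ENNReal.mul_div_cancel (by simp) (by simp)]
      _ = 2 ^ (1 + γ) * ((L / 2) ^ γ * (L / 2)) := by
          rw [ENNReal.rpow_add_of_nonneg (x := L / 2) _ _ zero_le_one hγ, ENNReal.rpow_one,
            mul_comm (L / 2)]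
      _ ≤ _ := by gcongr

theorem measure_Ioi_rpow_le (l : Measure ℝ) [NullSingletonClass l] {γ : ℝ} (hγ : 0 ≤ γ) (t : ℝ) :
    l (Ioi t) ^ (1 + γ) ≤ 2 ^ (1 + γ) * ∫⁻ s in Ioi t, l (Ioi s) ^ γ ∂l := by
  have hneg : MeasurableEmbedding (fun x : ℝ => -x) := (MeasurableEquiv.neg ℝ).measurableEmbedding
  have : NullSingletonClass (l.map fun x : ℝ => -x) := ⟨fun x => by
    rw [hneg.map_apply]
    exact (Set.Subsingleton.preimage subsingleton_singleton neg_injective).measure_zero _⟩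
  have h := measure_Iio_rpow_le (l.map fun x : ℝ => -x) hγ (-t)
  rw [hneg.restrict_map, hneg.lintegral_map] at h
  simpa [hneg.map_apply] using h

/-- The distribution function of a finite atomless measure transports it to Lebesgue measure. -/
theorem map_measure_Iio (l : Measure ℝ) [NullSingletonClass l] [IsFiniteMeasure l] :
    l.map (fun s => (l (Iio s)).toReal) = volume.restrict (Icc 0 (l univ).toReal) := by
  have hm : Measurable fun s : ℝ => (l (Iio s)).toReal := (measurable_measure_Iio l).ennreal_toReal
  have : IsFiniteMeasure (l.map fun s => (l (Iio s)).toReal) := by infer_instance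
  refine Measure.ext_of_Iic _ _ fun c => ?_
  rw [Measure.map_apply hm measurableSet_Iic, Measure.restrict_apply measurableSet_Iic]
  have hpre : (fun s => (l (Iio s)).toReal) ⁻¹' Iic c = {s | (l (Iio s)).toReal ≤ c} := rfl
  rw [hpre]
  set L := (l univ).toReal with hL
  have hLe : l univ = ENNReal.ofReal L := (ENNReal.ofReal_toReal (measure_ne_top l _)).symm
  rcases lt_or_ge c 0 with hc | hc
  · have h1 : {s | (l (Iio s)).toReal ≤ c} = ∅ := by
      ext s
      simpa using hc.trans_le ENNReal.toReal_nonneg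
    have h2 : Iic c ∩ Icc 0 L = ∅ := by
      ext y
      simp only [mem_inter_iff, mem_Iic, mem_Icc, mem_empty_iff_false, iff_false]
      rintro ⟨h, h', -⟩
      linarith
    simp [h1, h2]
  have hset : {s | (l (Iio s)).toReal ≤ c} = {s | l (Iio s) ≤ ENNReal.ofReal c} := by
    ext s
    simp only [mem_ofPred_eq]
    rw [ENNReal.le_ofReal_iff_toReal_le (measure_ne_top l _) hc]
  have hI : Iic c ∩ Icc 0 L = Icc 0 (min c L) := by
    ext y
    simp only [mem_inter_iff, mem_Iic, mem_Icc, le_min_iff]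
    tauto
  rw [hset, hI, Real.volume_Icc, sub_zero]
  rcases le_or_gt L c with hLc | hLc
  · rw [min_eq_right hLc]
    have : {s | l (Iio s) ≤ ENNReal.ofReal c} = univ := by
      ext s
      simp only [mem_ofPred_eq, mem_univ, iff_true]
      exact (measure_mono (subset_univ _)).trans (hLe.le.trans (ENNReal.ofReal_le_ofReal hLc))
    rw [this, hLe]
  · rw [min_eq_left hLc.le]
    refine le_antisymm (measure_setOf_measure_Iio_le l _) ?_
    have hms : MeasurableSet {s | l (Iio s) ≤ ENNReal.ofReal c} :=
      measurableSet_le (measurable_measure_Iio l) measurable_const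
    have h1 : l {s | l (Iio s) ≤ ENNReal.ofReal c}ᶜ ≤ ENNReal.ofReal (L - c) := by
      refine (measure_mono ?_).trans (measure_setOf_measure_Ioi_le l _)
      intro s hs
      simp only [mem_compl_iff, mem_ofPred_eq, not_le] at hs ⊢
      have h2 : l (Ioi s) = l univ - l (Iio s) := by
        rw [measure_congr Ioi_ae_eq_Ici, ← compl_Iio,
          measure_compl measurableSet_Iio (measure_ne_top l _)]
      rw [h2, hLe, ENNReal.ofReal_sub _ hc]
      exact tsub_le_tsub_left hs.le _
    have h3 := measure_add_measure_compl (μ := l) hms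
    rw [hLe] at h3
    have h4 : ENNReal.ofReal L = ENNReal.ofReal c + ENNReal.ofReal (L - c) := by
      rw [← ENNReal.ofReal_add hc (by linarith)]
      congr 1
      ring
    have h5 : ENNReal.ofReal c + ENNReal.ofReal (L - c)
        ≤ l {s | l (Iio s) ≤ ENNReal.ofReal c} + ENNReal.ofReal (L - c) := by
      rw [← h4, ← h3]
      gcongr
    exact (ENNReal.add_le_add_iff_right ENNReal.ofReal_ne_top).1 h5

theorem restrict_Iio_apply_Iio (m : Measure ℝ) {s x : ℝ} (h : s ≤ x) :
    m.restrict (Iio x) (Iio s) = m (Iio s) := by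
  rw [Measure.restrict_apply measurableSet_Iio, inter_eq_left.2 (Iio_subset_Iio h)]

/-- The integral `∫_{(-∞,x)} L ^ e dL = L(x) ^ (e + 1) / (e + 1)` for the distribution function `L`
of an atomless measure. -/
theorem lintegral_Iio_measure_rpow (m : Measure ℝ) [NullSingletonClass m] {x : ℝ}
    (hx : m (Iio x) ≠ ∞) {e : ℝ} (he : -1 < e) :
    ∫⁻ s in Iio x, m (Iio s) ^ e ∂m = ENNReal.ofReal (e + 1)⁻¹ * m (Iio x) ^ (e + 1) := by
  have he1 : 0 < e + 1 := by linarith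
  set l := m.restrict (Iio x) with hl
  have hfin : IsFiniteMeasure l := ⟨by rw [hl, Measure.restrict_apply_univ]; exact hx.lt_top⟩
  set L := (m (Iio x)).toReal with hL
  have hLu : (l univ).toReal = L := by rw [hl, Measure.restrict_apply_univ]
  have hG : Measurable fun y : ℝ => ENNReal.ofReal y ^ e := by fun_prop
  have h1 : ∫⁻ s in Iio x, m (Iio s) ^ e ∂m
      = ∫⁻ s, (fun y : ℝ => ENNReal.ofReal y ^ e) (l (Iio s)).toReal ∂l := by
    refine setLIntegral_congr_fun measurableSet_Iio fun s hs => ?_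
    simp only [ENNReal.ofReal_toReal (measure_ne_top l _)]
    rw [hl, restrict_Iio_apply_Iio m (le_of_lt hs)]
  have hL0 : 0 ≤ L := ENNReal.toReal_nonneg
  rw [h1, ← lintegral_map hG (measurable_measure_Iio l).ennreal_toReal, map_measure_Iio, hLu,
    ← restrict_Ioc_eq_restrict_Icc]
  have h2 : ∫⁻ y in Ioc 0 L, ENNReal.ofReal y ^ e = ∫⁻ y in Ioc 0 L, ENNReal.ofReal (y ^ e) :=
    setLIntegral_congr_fun measurableSet_Ioc fun y hy => ENNReal.ofReal_rpow_of_pos hy.1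
  rw [h2, ← ofReal_integral_eq_lintegral_ofReal, ← intervalIntegral.integral_of_le hL0,
    integral_rpow (Or.inl he), Real.zero_rpow he1.ne', sub_zero, div_eq_inv_mul,
    ENNReal.ofReal_mul (by positivity), ← ENNReal.ofReal_rpow_of_nonneg hL0 he1.le,
    ENNReal.ofReal_toReal hx]
  · exact (intervalIntegrable_iff_integrableOn_Ioc_of_le hL0).1
      (intervalIntegral.intervalIntegrable_rpow' he)
  · filter_upwards [ae_restrict_mem measurableSet_Ioc] with y hy
    exact Real.rpow_nonneg hy.1.le _

/-- The identity `γ ∫_{[a,b)} L ^ (-1 - γ) dL = L(a) ^ (-γ) - L(b) ^ (-γ)` for the distribution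
function `L` of an atomless measure, written without subtraction. -/
theorem lintegral_Ico_measure_rpow (m : Measure ℝ) [NullSingletonClass m] {a b : ℝ} (hab : a ≤ b)
    (ha : m (Iio a) ≠ 0) (hb : m (Iio b) ≠ ∞) {γ : ℝ} (hγ : 0 < γ) :
    ENNReal.ofReal γ * ∫⁻ s in Ico a b, m (Iio s) ^ (-1 - γ) ∂m + m (Iio b) ^ (-γ)
      = m (Iio a) ^ (-γ) := by
  set l := m.restrict (Ico a b) with hl
  have hadd : ∀ s, a ≤ s → m (Iio s) = m (Iio a) + m (Ico a s) := fun s hs => by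
    rw [← Iio_union_Ico_eq_Iio hs, measure_union _ measurableSet_Ico]
    exact Set.disjoint_left.2 fun y hy hy' => not_lt.2 hy'.1 hy
  have hat : m (Iio a) ≠ ∞ := ne_top_of_le_ne_top hb (measure_mono (Iio_subset_Iio hab))
  have hIt : m (Ico a b) ≠ ∞ := ne_top_of_le_ne_top hb (measure_mono fun y hy => hy.2)
  have hfin : IsFiniteMeasure l := ⟨by rw [hl, Measure.restrict_apply_univ]; exact hIt.lt_top⟩
  set L := (m (Ico a b)).toReal with hL
  set A := (m (Iio a)).toReal with hA
  have hA0 : 0 < A := ENNReal.toReal_pos ha hat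
  have hL0 : 0 ≤ L := ENNReal.toReal_nonneg
  have hLu : (l univ).toReal = L := by rw [hl, Measure.restrict_apply_univ]
  have hAe : ENNReal.ofReal A = m (Iio a) := ENNReal.ofReal_toReal hat
  have hBe : m (Iio b) = ENNReal.ofReal (A + L) := by
    rw [hadd b hab, ENNReal.ofReal_add hA0.le hL0, hAe, ENNReal.ofReal_toReal hIt]
  have hG : Measurable fun y : ℝ => ENNReal.ofReal (A + y) ^ (-1 - γ) := by fun_prop
  have h1 : ∫⁻ s in Ico a b, m (Iio s) ^ (-1 - γ) ∂m
      = ∫⁻ s, (fun y : ℝ => ENNReal.ofReal (A + y) ^ (-1 - γ)) (l (Iio s)).toReal ∂l := by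
    refine setLIntegral_congr_fun measurableSet_Ico fun s hs => ?_
    have : l (Iio s) = m (Ico a s) := by
      rw [hl, Measure.restrict_apply measurableSet_Iio]
      congr 1
      ext y
      simp only [mem_inter_iff, mem_Iio, mem_Ico]
      exact ⟨fun h => ⟨h.2.1, h.1⟩, fun h => ⟨h.2, h.1, h.2.trans hs.2⟩⟩
    simp only
    rw [ENNReal.ofReal_add hA0.le ENNReal.toReal_nonneg, hAe,
      ENNReal.ofReal_toReal (measure_ne_top l _), this, hadd s hs.1]
  rw [h1, ← lintegral_map hG (measurable_measure_Iio l).ennreal_toReal, map_measure_Iio, hLu,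
    ← restrict_Ioc_eq_restrict_Icc]
  have h2 : ∫⁻ y in Ioc 0 L, ENNReal.ofReal (A + y) ^ (-1 - γ)
      = ∫⁻ y in Ioc 0 L, ENNReal.ofReal ((A + y) ^ (-1 - γ)) :=
    setLIntegral_congr_fun measurableSet_Ioc fun y hy =>
      ENNReal.ofReal_rpow_of_pos (by linarith [hy.1])
  have hint : ∫ y in (0 : ℝ)..L, (A + y) ^ (-1 - γ) = (A ^ (-γ) - (A + L) ^ (-γ)) / γ := by
    rw [intervalIntegral.integral_comp_add_left (fun y => y ^ (-1 - γ)), add_zero,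
      integral_rpow (Or.inr ⟨by linarith, ?_⟩)]
    · rw [show -1 - γ + 1 = -γ by ring]
      field_simp
      ring
    · rw [uIcc_of_le (by linarith)]
      exact fun h => not_lt.2 h.1 hA0
  have hcont : IntervalIntegrable (fun y : ℝ => (A + y) ^ (-1 - γ)) volume 0 L := by
    refine ContinuousOn.intervalIntegrable fun y hy => ?_
    rw [uIcc_of_le hL0] at hy
    have : A + y ≠ 0 := by linarith [hy.1]
    exact ((continuousAt_const.add continuousAt_id).rpow_const (Or.inl this)).continuousWithinAt
  have hanti : (A + L) ^ (-γ) ≤ A ^ (-γ) :=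
    Real.rpow_le_rpow_of_nonpos hA0 (by linarith) (by linarith)
  rw [h2, ← ofReal_integral_eq_lintegral_ofReal, ← intervalIntegral.integral_of_le hL0, hint, hBe,
    ← hAe, ENNReal.ofReal_rpow_of_pos hA0, ENNReal.ofReal_rpow_of_pos (by linarith),
    ← ENNReal.ofReal_mul hγ.le, ← ENNReal.ofReal_add]
  · congr 1
    field_simp
    ring
  · have := sub_nonneg.2 hanti
    positivity
  · positivity
  · exact (intervalIntegrable_iff_integrableOn_Ioc_of_le hL0).1 hcont
  · filter_upwards [ae_restrict_mem measurableSet_Ioc] with y hy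
    exact Real.rpow_nonneg (by linarith [hy.1]) _

/-- The passage to `b = ∞` in `lintegral_Ico_measure_rpow`; the last term vanishes if the total
mass is infinite. -/
theorem lintegral_Ici_measure_rpow (m : Measure ℝ) [NullSingletonClass m] {a : ℝ}
    (ha : m (Iio a) ≠ 0) (hfin : ∀ b, m (Iio b) ≠ ∞) {γ : ℝ} (hγ : 0 < γ) :
    ENNReal.ofReal γ * ∫⁻ s in Ici a, m (Iio s) ^ (-1 - γ) ∂m + m univ ^ (-γ)
      = m (Iio a) ^ (-γ) := by
  have hU : Ici a = ⋃ n : ℕ, Ico a (a + n) := by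
    ext y
    simp only [mem_Ici, mem_iUnion, mem_Ico]
    refine ⟨fun h => ?_, fun ⟨n, hn⟩ => hn.1⟩
    obtain ⟨n, hn⟩ := exists_nat_gt (y - a)
    exact ⟨n, h, by linarith⟩
  have hV : (univ : Set ℝ) = ⋃ n : ℕ, Iio (a + n) := by
    ext y
    simp only [mem_univ, mem_iUnion, mem_Iio, true_iff]
    obtain ⟨n, hn⟩ := exists_nat_gt (y - a)
    exact ⟨n, by linarith⟩
  have hcast : ∀ i j : ℕ, i ≤ j → a + (i : ℝ) ≤ a + j := fun i j h => by gcongr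
  have hmI : Monotone fun n : ℕ => Ico a (a + (n : ℝ)) :=
    fun i j h => Ico_subset_Ico_right (hcast i j h)
  have hmV : Monotone fun n : ℕ => Iio (a + (n : ℝ)) :=
    fun i j h => Iio_subset_Iio (hcast i j h)
  have t1 : Tendsto (fun n : ℕ => ∫⁻ s in Ico a (a + n), m (Iio s) ^ (-1 - γ) ∂m) atTop
      (𝓝 (∫⁻ s in Ici a, m (Iio s) ^ (-1 - γ) ∂m)) := by
    have h := tendsto_measure_iUnion_atTop
      (μ := m.withDensity fun s => m (Iio s) ^ (-1 - γ)) hmI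
    rw [← hU, withDensity_apply _ measurableSet_Ici] at h
    refine h.congr fun n => ?_
    simp only [Function.comp]
    rw [withDensity_apply _ measurableSet_Ico]
  have t2 : Tendsto (fun n : ℕ => m (Iio (a + n)) ^ (-γ)) atTop (𝓝 (m univ ^ (-γ))) := by
    have h := tendsto_measure_iUnion_atTop (μ := m) hmV
    rw [← hV] at h
    exact (ENNReal.continuous_rpow_const.tendsto _).comp h
  have t3 := (ENNReal.Tendsto.const_mul t1 (Or.inr (ENNReal.ofReal_ne_top (r := γ)))).add t2
  refine tendsto_nhds_unique t3 (tendsto_const_nhds.congr fun n => ?_)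
  exact (lintegral_Ico_measure_rpow m (by simp) ha (hfin _) hγ).symm

theorem ae_measure_Iio_ne_zero (l : Measure ℝ) [NullSingletonClass l] :
    ∀ᵐ s ∂l, l (Iio s) ≠ 0 := by
  have h := measure_setOf_measure_Iio_le l 0
  simpa [ae_iff] using h

/-! ### Hardy's inequality and its dual -/

/-- Tonelli's theorem on the triangle `{y < x}`. -/
theorem lintegral_mul_lintegral_Iio (μ ν : Measure ℝ) [SFinite μ] [SFinite ν]
    {F G : ℝ → ℝ≥0∞} (hF : Measurable F) (hG : Measurable G) :
    ∫⁻ x, F x * ∫⁻ y in Iio x, G y ∂ν ∂μ = ∫⁻ y, G y * ∫⁻ x in Ioi y, F x ∂μ ∂ν := by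
  have hT : MeasurableSet {z : ℝ × ℝ | z.2 < z.1} := measurableSet_lt measurable_snd measurable_fst
  have hm : Measurable fun z : ℝ × ℝ =>
      ({z : ℝ × ℝ | z.2 < z.1}.indicator (fun z => F z.1 * G z.2) z : ℝ≥0∞) :=
    Measurable.indicator (by fun_prop) hT
  have h1 : ∀ x, F x * ∫⁻ y in Iio x, G y ∂ν
      = ∫⁻ y, {z : ℝ × ℝ | z.2 < z.1}.indicator (fun z => F z.1 * G z.2) (x, y) ∂ν := fun x => by
    rw [← lintegral_const_mul _ hG, ← lintegral_indicator measurableSet_Iio]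
    exact lintegral_congr fun y => rfl
  have h2 : ∀ y, G y * ∫⁻ x in Ioi y, F x ∂μ
      = ∫⁻ x, {z : ℝ × ℝ | z.2 < z.1}.indicator (fun z => F z.1 * G z.2) (x, y) ∂μ := fun y => by
    rw [← lintegral_const_mul _ hF, ← lintegral_indicator measurableSet_Ioi]
    refine lintegral_congr fun x => ?_
    simp only [indicator, mem_Ioi, mem_ofPred_eq, mul_comm (G y)]
  simp_rw [h1, h2]
  exact lintegral_lintegral_swap hm.aemeasurable

theorem measurable_lintegral_Iio (ν : Measure ℝ) (G : ℝ → ℝ≥0∞) :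
    Measurable fun x : ℝ => ∫⁻ y in Iio x, G y ∂ν :=
  (show Monotone fun x : ℝ => ∫⁻ y in Iio x, G y ∂ν from
    fun _ _ h => lintegral_mono_set (Iio_subset_Iio h)).measurable

theorem measurable_lintegral_Ioi (ν : Measure ℝ) (G : ℝ → ℝ≥0∞) :
    Measurable fun x : ℝ => ∫⁻ y in Ioi x, G y ∂ν :=
  (show Antitone fun x : ℝ => ∫⁻ y in Ioi x, G y ∂ν from
    fun _ _ h => lintegral_mono_set (Ioi_subset_Ioi h)).measurable

/-- Hölder's inequality, raised to the power `a`. -/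
theorem lintegral_mul_rpow_le {α : Type*} [MeasurableSpace α] (μ : Measure α) {a b : ℝ}
    (hab : a.HolderConjugate b) {f g : α → ℝ≥0∞} (hf : Measurable f) (hg : Measurable g) :
    (∫⁻ x, f x * g x ∂μ) ^ a ≤ (∫⁻ x, f x ^ a ∂μ) * (∫⁻ x, g x ^ b ∂μ) ^ (a - 1) := by
  have h := ENNReal.lintegral_mul_le_Lp_mul_Lq μ hab hf.aemeasurable hg.aemeasurable
  have ha := hab.pos
  calc (∫⁻ x, f x * g x ∂μ) ^ a
      ≤ ((∫⁻ x, f x ^ a ∂μ) ^ (1 / a) * (∫⁻ x, g x ^ b ∂μ) ^ (1 / b)) ^ a := by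
        gcongr
        exact h
    _ = _ := by
        rw [ENNReal.mul_rpow_of_nonneg _ _ ha.le, ← ENNReal.rpow_mul, ← ENNReal.rpow_mul,
          one_div_mul_cancel ha.ne', ENNReal.rpow_one]
        congr 2
        rw [one_div, inv_mul_eq_div, hab.div_conj_eq_sub_one]

theorem rpow_mul_rpow_cancel {x : ℝ≥0∞} (h0 : x ≠ 0) (ht : x ≠ ∞) {e f : ℝ} (h : e + f = 0) :
    x ^ e * x ^ f = 1 := by
  rw [← ENNReal.rpow_add _ _ h0 ht, h, ENNReal.rpow_zero]

/-- Hardy's inequality for averages over `Iio x` with respect to an atomless measure, by Schur's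
test with the weight `ν (Iio x) ^ (1 / (a b))`. -/
theorem hardy (ν : Measure ℝ) [NullSingletonClass ν] [SFinite ν] (hfin : ∀ x, ν (Iio x) ≠ ∞)
    {a b : ℝ} (hab : a.HolderConjugate b) {χ : ℝ → ℝ≥0∞} (hχ : Measurable χ) :
    ∫⁻ x, ((ν (Iio x))⁻¹ * ∫⁻ y in Iio x, χ y ∂ν) ^ a ∂ν
      ≤ ENNReal.ofReal b ^ a * ∫⁻ x, χ x ^ a ∂ν := by
  have ha := hab.pos
  have hb := hab.symm.pos
  have ha1 : 0 < a - 1 := hab.sub_one_pos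
  have hinv : b⁻¹ = 1 - a⁻¹ := hab.one_sub_inv.symm
  set N : ℝ → ℝ≥0∞ := fun x => ν (Iio x) with hN
  have hNm : Measurable N := measurable_measure_Iio ν
  have hN0 : ∀ᵐ x ∂ν, N x ≠ 0 := ae_measure_Iio_ne_zero ν
  have step : ∀ x, (∫⁻ y in Iio x, χ y ∂ν) ^ a
      ≤ (∫⁻ y in Iio x, χ y ^ a * N y ^ b⁻¹ ∂ν) * (ENNReal.ofReal b * N x ^ b⁻¹) ^ (a - 1) := by
    intro x
    have h1 : ∫⁻ y in Iio x, χ y ∂ν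
        = ∫⁻ y in Iio x, (χ y * N y ^ (a⁻¹ * b⁻¹)) * N y ^ (-(a⁻¹ * b⁻¹)) ∂ν := by
      refine lintegral_congr_ae (ae_restrict_of_ae ?_)
      filter_upwards [hN0] with y hy
      rw [mul_assoc, rpow_mul_rpow_cancel hy (hfin y) (by ring), mul_one]
    rw [h1]
    refine (lintegral_mul_rpow_le _ hab (by fun_prop) (by fun_prop)).trans (le_of_eq ?_)
    have h2 : ∫⁻ y in Iio x, (N y ^ (-(a⁻¹ * b⁻¹))) ^ b ∂ν = ENNReal.ofReal b * N x ^ b⁻¹ := by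
      have := lintegral_Iio_measure_rpow ν (hfin x) (e := -a⁻¹)
        (by have := inv_lt_one_of_one_lt₀ hab.lt; linarith)
      rw [show -a⁻¹ + 1 = b⁻¹ by rw [hinv]; ring, inv_inv] at this
      rw [← this]
      refine lintegral_congr fun y => ?_
      rw [← ENNReal.rpow_mul]
      congr 1
      field_simp
    rw [h2]
    congr 1
    refine lintegral_congr fun y => ?_
    rw [ENNReal.mul_rpow_of_nonneg _ _ ha.le, ← ENNReal.rpow_mul]
    congr 2
    field_simp
  have tail : ∀ y, N y ≠ 0 → ∫⁻ x in Ioi y, N x ^ (-1 - b⁻¹) ∂ν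
      ≤ ENNReal.ofReal b * N y ^ (-b⁻¹) := by
    intro y hy
    have h := lintegral_Ici_measure_rpow ν hy hfin (inv_pos.2 hb)
    calc ∫⁻ x in Ioi y, N x ^ (-1 - b⁻¹) ∂ν ≤ ∫⁻ x in Ici y, N x ^ (-1 - b⁻¹) ∂ν :=
          lintegral_mono_set Ioi_subset_Ici_self
      _ = ENNReal.ofReal b * (ENNReal.ofReal b⁻¹ * ∫⁻ x in Ici y, N x ^ (-1 - b⁻¹) ∂ν) := by
          rw [← mul_assoc, ← ENNReal.ofReal_mul hb.le, mul_inv_cancel₀ hb.ne', ENNReal.ofReal_one,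
            one_mul]
      _ ≤ _ := by
          gcongr
          exact le_self_add.trans h.le
  calc ∫⁻ x, ((N x)⁻¹ * ∫⁻ y in Iio x, χ y ∂ν) ^ a ∂ν
      ≤ ∫⁻ x, ENNReal.ofReal b ^ (a - 1) * (N x ^ (-1 - b⁻¹)
          * ∫⁻ y in Iio x, χ y ^ a * N y ^ b⁻¹ ∂ν) ∂ν := by
        refine lintegral_mono_ae ?_
        filter_upwards [hN0] with x hx
        rw [ENNReal.mul_rpow_of_nonneg _ _ ha.le, ENNReal.inv_rpow, ← ENNReal.rpow_neg]
        refine (mul_le_mul_right (step x) _).trans (le_of_eq ?_)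
        rw [ENNReal.mul_rpow_of_nonneg _ _ ha1.le, ← ENNReal.rpow_mul]
        have : N x ^ (-1 - b⁻¹) = N x ^ (-a) * N x ^ (b⁻¹ * (a - 1)) := by
          rw [← ENNReal.rpow_add _ _ hx (hfin x)]
          congr 1
          rw [hinv]
          field_simp
          ring
        rw [this]
        ring
    _ = ENNReal.ofReal b ^ (a - 1) * ∫⁻ y, χ y ^ a * N y ^ b⁻¹
          * ∫⁻ x in Ioi y, N x ^ (-1 - b⁻¹) ∂ν ∂ν := by
        rw [lintegral_const_mul _ (by
          have := measurable_lintegral_Iio ν (fun y => χ y ^ a * N y ^ b⁻¹)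
          fun_prop), lintegral_mul_lintegral_Iio _ _ (by fun_prop) (by fun_prop)]
    _ ≤ ENNReal.ofReal b ^ (a - 1) * ∫⁻ y, ENNReal.ofReal b * χ y ^ a ∂ν := by
        gcongr 1
        refine lintegral_mono_ae ?_
        filter_upwards [hN0] with y hy
        refine (mul_le_mul_right (tail y hy) _).trans (le_of_eq ?_)
        have := rpow_mul_rpow_cancel hy (hfin y) (e := b⁻¹) (f := -b⁻¹) (by ring)
        calc χ y ^ a * N y ^ b⁻¹ * (ENNReal.ofReal b * N y ^ (-b⁻¹))
            = ENNReal.ofReal b * χ y ^ a * (N y ^ b⁻¹ * N y ^ (-b⁻¹)) := by ring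
          _ = _ := by rw [this, mul_one]
    _ = _ := by
        rw [lintegral_const_mul _ (by fun_prop), ← mul_assoc]
        congr 1
        conv_rhs => rw [show a = (a - 1) + 1 by ring]
        rw [ENNReal.rpow_add_of_nonneg _ _ ha1.le zero_le_one, ENNReal.rpow_one]

/-- The dual Hardy inequality, for tail integrals, by Schur's test. -/
theorem hardy_dual (ν : Measure ℝ) [NullSingletonClass ν] [SFinite ν] (hfin : ∀ x, ν (Iio x) ≠ ∞)
    {a b : ℝ} (hab : a.HolderConjugate b) {ξ : ℝ → ℝ≥0∞} (hξ : Measurable ξ) :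
    ∫⁻ x, (∫⁻ y in Ioi x, ξ y ∂ν) ^ a ∂ν
      ≤ ENNReal.ofReal a ^ a * ∫⁻ x, (ξ x * ν (Iio x)) ^ a ∂ν := by
  have ha := hab.pos
  have hb := hab.symm.pos
  have ha1 : 0 < a - 1 := hab.sub_one_pos
  have hinv : b⁻¹ = 1 - a⁻¹ := hab.one_sub_inv.symm
  set N : ℝ → ℝ≥0∞ := fun x => ν (Iio x) with hN
  have hNm : Measurable N := measurable_measure_Iio ν
  have hN0 : ∀ᵐ x ∂ν, N x ≠ 0 := ae_measure_Iio_ne_zero ν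
  set s : ℝ := (1 + a⁻¹) * b⁻¹ with hs
  have tail : ∀ y, N y ≠ 0 → ∫⁻ x in Ioi y, N x ^ (-1 - a⁻¹) ∂ν
      ≤ ENNReal.ofReal a * N y ^ (-a⁻¹) := by
    intro y hy
    have h := lintegral_Ici_measure_rpow ν hy hfin (inv_pos.2 ha)
    calc ∫⁻ x in Ioi y, N x ^ (-1 - a⁻¹) ∂ν ≤ ∫⁻ x in Ici y, N x ^ (-1 - a⁻¹) ∂ν :=
          lintegral_mono_set Ioi_subset_Ici_self
      _ = ENNReal.ofReal a * (ENNReal.ofReal a⁻¹ * ∫⁻ x in Ici y, N x ^ (-1 - a⁻¹) ∂ν) := by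
          rw [← mul_assoc, ← ENNReal.ofReal_mul ha.le, mul_inv_cancel₀ ha.ne', ENNReal.ofReal_one,
            one_mul]
      _ ≤ _ := by
          gcongr
          exact le_self_add.trans h.le
  have step : ∀ x, N x ≠ 0 → (∫⁻ y in Ioi x, ξ y ∂ν) ^ a
      ≤ (∫⁻ y in Ioi x, (ξ y * N y ^ s) ^ a ∂ν) * (ENNReal.ofReal a * N x ^ (-a⁻¹)) ^ (a - 1) := by
    intro x hx
    have h1 : ∫⁻ y in Ioi x, ξ y ∂ν = ∫⁻ y in Ioi x, (ξ y * N y ^ s) * N y ^ (-s) ∂ν := by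
      refine lintegral_congr_ae (ae_restrict_of_ae ?_)
      filter_upwards [hN0] with y hy
      rw [mul_assoc, rpow_mul_rpow_cancel hy (hfin y) (by ring), mul_one]
    rw [h1]
    refine (lintegral_mul_rpow_le _ hab (by fun_prop) (by fun_prop)).trans ?_
    gcongr
    refine le_trans (le_of_eq ?_) (tail x hx)
    refine lintegral_congr fun y => ?_
    rw [← ENNReal.rpow_mul]
    congr 1
    rw [hs]
    field_simp
    ring
  calc ∫⁻ x, (∫⁻ y in Ioi x, ξ y ∂ν) ^ a ∂ν
      ≤ ∫⁻ x, ENNReal.ofReal a ^ (a - 1) * (N x ^ (-b⁻¹)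
          * ∫⁻ y in Ioi x, (ξ y * N y ^ s) ^ a ∂ν) ∂ν := by
        refine lintegral_mono_ae ?_
        filter_upwards [hN0] with x hx
        refine (step x hx).trans (le_of_eq ?_)
        rw [ENNReal.mul_rpow_of_nonneg _ _ ha1.le, ← ENNReal.rpow_mul,
          show -a⁻¹ * (a - 1) = -b⁻¹ by rw [hinv]; field_simp]
        ring
    _ = ENNReal.ofReal a ^ (a - 1) * ∫⁻ y, (ξ y * N y ^ s) ^ a
          * ∫⁻ x in Iio y, N x ^ (-b⁻¹) ∂ν ∂ν := by
        rw [lintegral_const_mul _ (by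
          have := measurable_lintegral_Ioi ν (fun y => (ξ y * N y ^ s) ^ a)
          fun_prop), ← lintegral_mul_lintegral_Iio _ _ (by fun_prop) (by fun_prop)]
    _ = ENNReal.ofReal a ^ (a - 1) * ∫⁻ y, ENNReal.ofReal a * (ξ y * N y) ^ a ∂ν := by
        congr 1
        refine lintegral_congr_ae ?_
        filter_upwards [hN0] with y hy
        rw [lintegral_Iio_measure_rpow ν (hfin y) (e := -b⁻¹)
          (by have := inv_lt_one_of_one_lt₀ hab.symm.lt; linarith),
          show -b⁻¹ + 1 = a⁻¹ by rw [hinv]; ring, inv_inv, ENNReal.mul_rpow_of_nonneg _ _ ha.le,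
          ENNReal.mul_rpow_of_nonneg _ _ ha.le, ← ENNReal.rpow_mul]
        have : N y ^ a = N y ^ (s * a) * N y ^ a⁻¹ := by
          rw [← ENNReal.rpow_add _ _ hy (hfin y)]
          congr 1
          rw [hs, hinv]
          field_simp
          ring
        rw [this]
        ring
    _ = _ := by
        have hsplit : ENNReal.ofReal a ^ a = ENNReal.ofReal a ^ (a - 1) * ENNReal.ofReal a := by
          nth_rw 2 [show a = (a - 1) + 1 by ring]
          rw [ENNReal.rpow_add_of_nonneg _ _ ha1.le zero_le_one, ENNReal.rpow_one]
        rw [lintegral_const_mul _ (by fun_prop), ← mul_assoc, hsplit]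

/-! ### Weighted Hardy inequalities -/

/-- Hölder's inequality for three functions. -/
theorem lintegral_mul_mul_rpow_le {α : Type*} [MeasurableSpace α] (μ : Measure α)
    {f g h : α → ℝ≥0∞} (hf : Measurable f) (hg : Measurable g) (hh : Measurable h) {p q r : ℝ}
    (hp : 0 ≤ p) (hq : 0 ≤ q) (hr : 0 ≤ r) (hpqr : p + q + r = 1) :
    ∫⁻ x, f x ^ p * g x ^ q * h x ^ r ∂μ
      ≤ (∫⁻ x, f x ∂μ) ^ p * (∫⁻ x, g x ∂μ) ^ q * (∫⁻ x, h x ∂μ) ^ r := by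
  have := ENNReal.lintegral_prod_norm_pow_le (μ := μ) Finset.univ (f := ![f, g, h])
    (by simp [Fin.forall_fin_succ, hf.aemeasurable, hg.aemeasurable, hh.aemeasurable])
    (p := ![p, q, r]) (by simpa [Fin.sum_univ_three] using hpqr)
    (by simp [Fin.forall_fin_succ, hp, hq, hr])
  simpa [Fin.prod_univ_three] using this

/-- Integration by parts: `∫ l(0,t) ^ β dq(t)` is at most a multiple of
`∫ l(0,s) ^ (β - 1) q(s,∞) dl(s)`. -/
theorem lintegral_measure_Iio_rpow_le (l q : Measure ℝ) [NullSingletonClass l] [SFinite l]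
    [SFinite q] {β : ℝ} (hβ : 1 ≤ β) :
    ∫⁻ t, l (Iio t) ^ β ∂q ≤ 2 ^ β * ∫⁻ s, l (Iio s) ^ (β - 1) * q (Ioi s) ∂l := by
  have hm := measurable_measure_Iio l
  calc ∫⁻ t, l (Iio t) ^ β ∂q
      ≤ ∫⁻ t, 2 ^ β * (1 * ∫⁻ s in Iio t, l (Iio s) ^ (β - 1) ∂l) ∂q := by
        refine lintegral_mono fun t => ?_
        have := measure_Iio_rpow_le l (γ := β - 1) (by linarith) t
        rwa [show 1 + (β - 1) = β by ring, ← one_mul (∫⁻ s in Iio t, _ ∂l)] at this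
    _ = _ := by
        rw [lintegral_const_mul _ (by
          have := measurable_lintegral_Iio l (fun s => l (Iio s) ^ (β - 1))
          fun_prop), lintegral_mul_lintegral_Iio _ _ measurable_const (hm.pow_const _)]
        simp

/-- `lintegral_measure_Iio_rpow_le` for the measure `χ dν`. -/
theorem lintegral_primitive_rpow_le (ν q : Measure ℝ) [NullSingletonClass ν] [SFinite ν]
    [SFinite q] {β : ℝ} (hβ : 1 ≤ β) {χ : ℝ → ℝ≥0∞} (hχ : Measurable χ) :
    ∫⁻ t, (∫⁻ y in Iio t, χ y ∂ν) ^ β ∂q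
      ≤ 2 ^ β * ∫⁻ s, (∫⁻ y in Iio s, χ y ∂ν) ^ (β - 1) * χ s * q (Ioi s) ∂ν := by
  have h := lintegral_measure_Iio_rpow_le (ν.withDensity χ) q hβ
  simp_rw [withDensity_apply χ measurableSet_Iio] at h
  refine h.trans (le_of_eq ?_)
  have h1 := measurable_lintegral_Iio ν χ
  have h2 := measurable_measure_Ioi q
  rw [lintegral_withDensity_eq_lintegral_mul _ hχ
    (show Measurable fun s => (∫⁻ y in Iio s, χ y ∂ν) ^ (β - 1) * q (Ioi s) from
      (h1.pow_const _).mul h2)]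
  congr 1
  refine lintegral_congr fun s => ?_
  simp only [Pi.mul_apply]
  ring

/-- The weighted Hardy inequality in the range `a ≤ β`. -/
theorem weighted_hardy_of_le (ν q : Measure ℝ) [NullSingletonClass ν] [SFinite ν] [SFinite q]
    (hfin : ∀ x, ν (Iio x) ≠ ∞) {a b β : ℝ} (hab : a.HolderConjugate b) (haβ : a ≤ β)
    {A : ℝ≥0∞} (hA : ∀ x, ν (Iio x) ^ b⁻¹ * q (Ioi x) ^ β⁻¹ ≤ A)
    {χ : ℝ → ℝ≥0∞} (hχ : Measurable χ) :
    ∫⁻ t, (∫⁻ y in Iio t, χ y ∂ν) ^ β ∂q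
      ≤ 2 ^ β * ENNReal.ofReal b ^ (a - 1) * A ^ β * (∫⁻ x, χ x ^ a ∂ν) ^ (β / a) := by
  have ha := hab.pos
  have hb := hab.symm.pos
  have ha1 : 0 < a - 1 := hab.sub_one_pos
  have hβ : 0 < β := ha.trans_le haβ
  have hinv : b⁻¹ = 1 - a⁻¹ := hab.one_sub_inv.symm
  set N : ℝ → ℝ≥0∞ := fun x => ν (Iio x) with hN
  have hNm : Measurable N := measurable_measure_Iio ν
  have hN0 : ∀ᵐ x ∂ν, N x ≠ 0 := ae_measure_Iio_ne_zero ν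
  set T : ℝ → ℝ≥0∞ := fun x => ∫⁻ y in Iio x, χ y ∂ν with hT
  have hTm : Measurable T := measurable_lintegral_Iio ν χ
  set X := ∫⁻ x, χ x ^ a ∂ν with hX
  have hTX : ∀ x, T x ≤ X ^ a⁻¹ * N x ^ b⁻¹ := fun x => by
    have h := ENNReal.lintegral_mul_le_Lp_mul_Lq (ν.restrict (Iio x)) hab hχ.aemeasurable
      (aemeasurable_const (b := (1 : ℝ≥0∞)))
    simp only [Pi.mul_apply, mul_one, ENNReal.one_rpow, lintegral_const, one_mul,
      Measure.restrict_apply_univ, one_div] at h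
    refine h.trans ?_
    gcongr
    exact setLIntegral_le_lintegral _ _
  have hpt : ∀ᵐ s ∂ν, T s ^ (β - 1) * χ s * q (Ioi s)
      ≤ A ^ β * X ^ (a⁻¹ * (β - a)) * (((N s)⁻¹ * T s) ^ (a - 1) * χ s) := by
    filter_upwards [hN0] with s hs
    have hU : q (Ioi s) ≤ A ^ β * N s ^ (-(b⁻¹ * β)) := by
      calc q (Ioi s) = (N s ^ b⁻¹ * q (Ioi s) ^ β⁻¹) ^ β * N s ^ (-(b⁻¹ * β)) := by
            rw [ENNReal.mul_rpow_of_nonneg _ _ hβ.le, ← ENNReal.rpow_mul, ← ENNReal.rpow_mul,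
              inv_mul_cancel₀ hβ.ne', ENNReal.rpow_one, mul_right_comm,
              rpow_mul_rpow_cancel hs (hfin s) (by ring), one_mul]
        _ ≤ _ := by
            gcongr
            exact hA s
    calc T s ^ (β - 1) * χ s * q (Ioi s)
        = T s ^ (a - 1) * T s ^ (β - a) * χ s * q (Ioi s) := by
          rw [← ENNReal.rpow_add_of_nonneg _ _ ha1.le (by linarith)]
          congr 3
          ring
      _ ≤ T s ^ (a - 1) * (X ^ a⁻¹ * N s ^ b⁻¹) ^ (β - a) * χ s
            * (A ^ β * N s ^ (-(b⁻¹ * β))) := by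
          have : 0 ≤ β - a := by linarith
          gcongr
          exact hTX s
      _ = A ^ β * X ^ (a⁻¹ * (β - a)) * ((N s ^ (b⁻¹ * (β - a)) * N s ^ (-(b⁻¹ * β)))
            * T s ^ (a - 1) * χ s) := by
          rw [ENNReal.mul_rpow_of_nonneg _ _ (by linarith), ← ENNReal.rpow_mul,
            ← ENNReal.rpow_mul]
          ring
      _ = _ := by
          rw [← ENNReal.rpow_add _ _ hs (hfin s), ENNReal.mul_rpow_of_nonneg _ _ ha1.le,
            ENNReal.inv_rpow, ← ENNReal.rpow_neg]
          congr 4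
          rw [hinv]
          field_simp
          ring
  have hmain : ∫⁻ s, ((N s)⁻¹ * T s) ^ (a - 1) * χ s ∂ν ≤ ENNReal.ofReal b ^ (a - 1) * X := by
    have h := ENNReal.lintegral_mul_norm_pow_le (μ := ν) (f := fun s => ((N s)⁻¹ * T s) ^ a)
      (g := fun s => χ s ^ a) (by fun_prop) (by fun_prop) (p := b⁻¹) (q := a⁻¹) (by positivity)
      (by positivity) (by rw [hinv]; ring)
    calc ∫⁻ s, ((N s)⁻¹ * T s) ^ (a - 1) * χ s ∂ν
        = ∫⁻ s, (((N s)⁻¹ * T s) ^ a) ^ b⁻¹ * (χ s ^ a) ^ a⁻¹ ∂ν := by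
          refine lintegral_congr fun s => ?_
          rw [← ENNReal.rpow_mul, ← ENNReal.rpow_mul, mul_inv_cancel₀ ha.ne', ENNReal.rpow_one]
          congr 2
          rw [hinv]
          field_simp
      _ ≤ (∫⁻ s, ((N s)⁻¹ * T s) ^ a ∂ν) ^ b⁻¹ * X ^ a⁻¹ := h
      _ ≤ (ENNReal.ofReal b ^ a * X) ^ b⁻¹ * X ^ a⁻¹ := by
          gcongr
          exact hardy ν hfin hab hχ
      _ = _ := by
          rw [ENNReal.mul_rpow_of_nonneg _ _ (by positivity), ← ENNReal.rpow_mul, mul_assoc,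
            ← ENNReal.rpow_add_of_nonneg _ _ (by positivity) (by positivity),
            show b⁻¹ + a⁻¹ = 1 by rw [hinv]; ring, ENNReal.rpow_one]
          congr 2
          rw [hinv]
          field_simp
  calc ∫⁻ t, T t ^ β ∂q
      ≤ 2 ^ β * ∫⁻ s, T s ^ (β - 1) * χ s * q (Ioi s) ∂ν :=
        lintegral_primitive_rpow_le ν q (hab.lt.le.trans haβ) hχ
    _ ≤ 2 ^ β * ∫⁻ s, A ^ β * X ^ (a⁻¹ * (β - a)) * (((N s)⁻¹ * T s) ^ (a - 1) * χ s) ∂ν := by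
        gcongr 1
        exact lintegral_mono_ae hpt
    _ ≤ 2 ^ β * (A ^ β * X ^ (a⁻¹ * (β - a)) * (ENNReal.ofReal b ^ (a - 1) * X)) := by
        rw [lintegral_const_mul _ (by fun_prop)]
        gcongr
    _ = 2 ^ β * ENNReal.ofReal b ^ (a - 1) * A ^ β * (X ^ (a⁻¹ * (β - a)) * X ^ (1 : ℝ)) := by
        rw [ENNReal.rpow_one]
        ring
    _ = _ := by
        have : 0 ≤ β - a := by linarith
        rw [← ENNReal.rpow_add_of_nonneg _ _ (by positivity) zero_le_one]
        congr 2
        field_simp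
        ring

/-- The weighted Hardy inequality in the range `β < a` (Maz'ya). -/
theorem weighted_hardy_of_lt (ν q : Measure ℝ) [NullSingletonClass ν] [SFinite ν] [SFinite q]
    (hfin : ∀ x, ν (Iio x) ≠ ∞) {a b β ρ : ℝ} (hab : a.HolderConjugate b) (hβ : 1 < β)
    (hρ : 0 < ρ) (hρβ : ρ⁻¹ = β⁻¹ - a⁻¹) {χ : ℝ → ℝ≥0∞} (hχ : Measurable χ) :
    ∫⁻ t, (∫⁻ y in Iio t, χ y ∂ν) ^ β ∂q
      ≤ 2 ^ β * ENNReal.ofReal b ^ (β - 1)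
        * (∫⁻ x, ν (Iio x) ^ (ρ * (β - 1) / β) * q (Ioi x) ^ (ρ / β) ∂ν) ^ (β / ρ)
        * (∫⁻ x, χ x ^ a ∂ν) ^ (β / a) := by
  have ha := hab.pos
  have hb := hab.symm.pos
  have hβ0 : 0 < β := by linarith
  have hβ1 : 0 < β - 1 := by linarith
  set N : ℝ → ℝ≥0∞ := fun x => ν (Iio x) with hN
  have hNm : Measurable N := measurable_measure_Iio ν
  have hN0 : ∀ᵐ x ∂ν, N x ≠ 0 := ae_measure_Iio_ne_zero ν
  set T : ℝ → ℝ≥0∞ := fun x => ∫⁻ y in Iio x, χ y ∂ν with hT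
  have hTm : Measurable T := measurable_lintegral_Iio ν χ
  have hUm : Measurable fun x => q (Ioi x) := measurable_measure_Ioi q
  set X := ∫⁻ x, χ x ^ a ∂ν with hX
  set Y := ∫⁻ x, N x ^ (ρ * (β - 1) / β) * q (Ioi x) ^ (ρ / β) ∂ν with hY
  have hsum : (β - 1) / a + 1 / a + β / ρ = 1 := by
    rw [div_eq_mul_inv β ρ, hρβ]
    field_simp
    ring
  have h3 := lintegral_mul_mul_rpow_le ν (f := fun s => ((N s)⁻¹ * T s) ^ a)
    (g := fun s => χ s ^ a) (h := fun s => N s ^ (ρ * (β - 1) / β) * q (Ioi s) ^ (ρ / β))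
    (by fun_prop) (by fun_prop) ((hNm.pow_const _).mul (hUm.pow_const _))
    (p := (β - 1) / a) (q := 1 / a) (r := β / ρ) (by positivity) (by positivity) (by positivity)
    hsum
  calc ∫⁻ t, T t ^ β ∂q
      ≤ 2 ^ β * ∫⁻ s, T s ^ (β - 1) * χ s * q (Ioi s) ∂ν :=
        lintegral_primitive_rpow_le ν q hβ.le hχ
    _ = 2 ^ β * ∫⁻ s, (((N s)⁻¹ * T s) ^ a) ^ ((β - 1) / a) * (χ s ^ a) ^ (1 / a)
          * (N s ^ (ρ * (β - 1) / β) * q (Ioi s) ^ (ρ / β)) ^ (β / ρ) ∂ν := by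
        congr 1
        refine lintegral_congr_ae ?_
        filter_upwards [hN0] with s hs
        rw [ENNReal.mul_rpow_of_nonneg (N s ^ _) _ (by positivity), ← ENNReal.rpow_mul,
          ← ENNReal.rpow_mul, ← ENNReal.rpow_mul, ← ENNReal.rpow_mul,
          show a * ((β - 1) / a) = β - 1 by field_simp, mul_one_div_cancel ha.ne',
          show ρ * (β - 1) / β * (β / ρ) = β - 1 by field_simp,
          show ρ / β * (β / ρ) = 1 by field_simp, ENNReal.rpow_one, ENNReal.rpow_one,
          ENNReal.mul_rpow_of_nonneg _ _ hβ1.le, ENNReal.inv_rpow, ← ENNReal.rpow_neg]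
        have := rpow_mul_rpow_cancel hs (hfin s) (e := -(β - 1)) (f := β - 1) (by ring)
        calc T s ^ (β - 1) * χ s * q (Ioi s)
            = (N s ^ (-(β - 1)) * N s ^ (β - 1)) * (T s ^ (β - 1) * χ s * q (Ioi s)) := by
              rw [this, one_mul]
          _ = _ := by ring
    _ ≤ 2 ^ β * ((∫⁻ s, ((N s)⁻¹ * T s) ^ a ∂ν) ^ ((β - 1) / a) * X ^ (1 / a) * Y ^ (β / ρ)) := by
        gcongr 1
    _ ≤ 2 ^ β * ((ENNReal.ofReal b ^ a * X) ^ ((β - 1) / a) * X ^ (1 / a) * Y ^ (β / ρ)) := by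
        gcongr
        exact hardy ν hfin hab hχ
    _ = _ := by
        rw [ENNReal.mul_rpow_of_nonneg _ _ (by positivity), ← ENNReal.rpow_mul,
          show a * ((β - 1) / a) = β - 1 by field_simp,
          show β / a = (β - 1) / a + 1 / a by ring,
          ENNReal.rpow_add_of_nonneg _ _ (by positivity) (by positivity)]
        ring

/-! ### The dual measure -/

/-- Atomless measures on `(0,∞)`, regarded as measures on the line, whose distribution function
`W x = m (0,x)` is positive and finite for `x > 0`. The total mass may be infinite. -/
structure IsHalfLine (m : Measure ℝ) : Prop where
  null : NullSingletonClass m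
  sfinite : SFinite m
  Iic_zero : m (Iic 0) = 0
  pos : ∀ x, 0 < x → m (Iio x) ≠ 0
  fin : ∀ x, m (Iio x) ≠ ∞

/-- The measure `d(-W ^ (1 - b)) = (b - 1) W ^ (-b) dW`, where `W x = m (Iio x)`. -/
def dualMeasure (m : Measure ℝ) (b : ℝ) : Measure ℝ :=
  m.withDensity fun x => ENNReal.ofReal (b - 1) * m (Iio x) ^ (-b)

theorem measurable_dualDensity (m : Measure ℝ) (b : ℝ) :
    Measurable fun x => ENNReal.ofReal (b - 1) * m (Iio x) ^ (-b) :=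
  ((measurable_measure_Iio m).pow_const _).const_mul _

theorem lintegral_dualMeasure (m : Measure ℝ) (b : ℝ) {f : ℝ → ℝ≥0∞} (hf : Measurable f) :
    ∫⁻ x, f x ∂(dualMeasure m b)
      = ∫⁻ x, ENNReal.ofReal (b - 1) * m (Iio x) ^ (-b) * f x ∂m :=
  lintegral_withDensity_eq_lintegral_mul _ (measurable_dualDensity m b) hf

theorem dualMeasure_Ioi_add {m : Measure ℝ} (hm : IsHalfLine m) {b : ℝ} (hb : 1 < b) {x : ℝ}
    (hx : 0 < x) :
    dualMeasure m b (Ioi x) + m univ ^ (1 - b) = m (Iio x) ^ (1 - b) := by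
  have := hm.null
  have h := lintegral_Ici_measure_rpow m (hm.pos x hx) hm.fin (γ := b - 1) (by linarith)
  rw [show -(b - 1) = 1 - b by ring, show -1 - (b - 1) = -b by ring] at h
  rw [← h, dualMeasure, withDensity_apply _ measurableSet_Ioi,
    lintegral_const_mul _ ((measurable_measure_Iio m).pow_const _), restrict_Ioi_eq_restrict_Ici]

theorem dualMeasure_Ioi_le {m : Measure ℝ} (hm : IsHalfLine m) {b : ℝ} (hb : 1 < b) {x : ℝ}
    (hx : 0 < x) : dualMeasure m b (Ioi x) ≤ m (Iio x) ^ (1 - b) :=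
  le_self_add.trans (dualMeasure_Ioi_add hm hb hx).le

theorem dualMeasure_Ioi_ne_top {m : Measure ℝ} (hm : IsHalfLine m) {b : ℝ} (hb : 1 < b) {x : ℝ}
    (hx : 0 < x) : dualMeasure m b (Ioi x) ≠ ∞ :=
  ne_top_of_le_ne_top (ENNReal.rpow_ne_top_of_ne_zero (hm.pos x hx) (hm.fin x))
    (dualMeasure_Ioi_le hm hb hx)

/-- The dual Hardy inequality between the dual measure and `m`. -/
theorem hardy_dual_dualMeasure {m : Measure ℝ} (hm : IsHalfLine m) {a b : ℝ}
    (hab : a.HolderConjugate b) {η : ℝ → ℝ≥0∞} (hη : Measurable η) :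
    ∫⁻ t, (∫⁻ y in Ioi t, η y ∂(dualMeasure m b)) ^ a ∂m
      ≤ ENNReal.ofReal a ^ a * ENNReal.ofReal (b - 1) ^ (a - 1)
        * ∫⁻ x, η x ^ a ∂(dualMeasure m b) := by
  have := hm.null
  have := hm.sfinite
  have ha := hab.pos
  have ha1 : 0 < a - 1 := hab.sub_one_pos
  have hb1 : 0 < b - 1 := hab.symm.sub_one_pos
  have hd := measurable_dualDensity m b
  have hW := measurable_measure_Iio m
  have h := hardy_dual m hm.fin hab (hd.mul hη)
  have h1 : ∀ t, ∫⁻ y in Ioi t, η y ∂(dualMeasure m b) = ∫⁻ y in Ioi t,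
      ((fun x => ENNReal.ofReal (b - 1) * m (Iio x) ^ (-b)) * η) y ∂m := fun t =>
    setLIntegral_withDensity_eq_setLIntegral_mul m hd hη measurableSet_Ioi
  simp_rw [h1]
  refine h.trans (le_of_eq ?_)
  rw [lintegral_dualMeasure m b (hη.pow_const a), mul_assoc]
  congr 1
  rw [← lintegral_const_mul _ (show Measurable fun x => ENNReal.ofReal (b - 1) * m (Iio x) ^ (-b)
    * η x ^ a from hd.mul (hη.pow_const a))]
  refine lintegral_congr_ae ?_
  filter_upwards [ae_measure_Iio_ne_zero m] with x hx
  simp only [Pi.mul_apply]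
  have hsplit : ENNReal.ofReal (b - 1) ^ a
      = ENNReal.ofReal (b - 1) ^ (a - 1) * ENNReal.ofReal (b - 1) := by
    nth_rw 1 [show a = (a - 1) + 1 by ring]
    rw [ENNReal.rpow_add_of_nonneg _ _ ha1.le zero_le_one, ENNReal.rpow_one]
  rw [ENNReal.mul_rpow_of_nonneg _ _ ha.le, ENNReal.mul_rpow_of_nonneg _ _ ha.le,
    ENNReal.mul_rpow_of_nonneg _ _ ha.le, ← ENNReal.rpow_mul, hsplit]
  have : m (Iio x) ^ (-b) = m (Iio x) ^ (-b * a) * m (Iio x) ^ a := by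
    rw [← ENNReal.rpow_add _ _ hx (hm.fin x)]
    congr 1
    have := hab.mul_eq_add
    linarith
  rw [this]
  ring

/-! ### Upper estimates for the integral operator -/

theorem ae_pos_of_Iic_zero {h : Measure ℝ} (h0 : h (Iic 0) = 0) : ∀ᵐ s ∂h, 0 < s := by
  rw [ae_iff]
  simp only [not_lt]
  exact h0

theorem setLIntegral_measure_Iio_le (m h : Measure ℝ) [SFinite m] [SFinite h] (x : ℝ) :
    ∫⁻ s in Iio x, m (Iio s) ∂h ≤ ∫⁻ t in Iio x, h (Ioi t) ∂m := by
  have h1 := lintegral_mul_lintegral_Iio (h.restrict (Iio x)) m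
    (measurable_const (a := (1 : ℝ≥0∞))) (measurable_const (a := (1 : ℝ≥0∞)))
  simp only [one_mul, lintegral_const, Measure.restrict_apply_univ] at h1
  rw [h1, ← lintegral_indicator measurableSet_Iio]
  refine lintegral_mono fun t => ?_
  by_cases ht : t < x
  · rw [indicator_of_mem (mem_Iio.2 ht)]
    exact Measure.restrict_apply_le _ _
  · rw [Measure.restrict_apply measurableSet_Ioi]
    have : Ioi t ∩ Iio x = ∅ := by
      ext y
      simp only [mem_inter_iff, mem_Ioi, mem_Iio, mem_empty_iff_false, iff_false]
      intro hy
      exact ht (hy.1.trans hy.2)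
    simp [this]

theorem lintegral_measure_Iio_le (m h : Measure ℝ) [SFinite m] [SFinite h] :
    ∫⁻ s, m (Iio s) ∂h ≤ ∫⁻ t, h (Ioi t) ∂m := by
  have h1 := lintegral_mul_lintegral_Iio h m
    (measurable_const (a := (1 : ℝ≥0∞))) (measurable_const (a := (1 : ℝ≥0∞)))
  simp only [one_mul, lintegral_const, Measure.restrict_apply_univ] at h1
  exact h1.le

/-- Splitting `1 = W(s) (∫_s^t W ^ (-2) dW + 1 / W(t))` bounds the operator
`h ↦ ∫_{(0,t)} V dh` by a Hardy operator acting on the averages of the tail of `h`, and by a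
term that only sees mass at comparable values of `W`. -/
theorem lintegral_Iio_le_add {m h : Measure ℝ} (hm : IsHalfLine m) [NullSingletonClass h]
    [SFinite h] (h0 : h (Iic 0) = 0) {V : ℝ → ℝ≥0∞} (hV : Monotone V) (t : ℝ) :
    ∫⁻ s in Iio t, V s ∂h
      ≤ ∫⁻ x in Iio t, m (Iio x) ^ (-2 : ℝ) * (V x * ∫⁻ y in Iio x, h (Ioi y) ∂m) ∂m
        + (m (Iio t))⁻¹ * ∫⁻ s in Iio t, V s * m (Iio s) ∂h := by
  have := hm.null
  have := hm.sfinite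
  have hVm := hV.measurable
  have hW := measurable_measure_Iio m
  have hG : Measurable fun s => V s * m (Iio s) := hVm.mul hW
  have hF : Measurable fun s => m (Iio s) ^ (-2 : ℝ) := hW.pow_const _
  have h1 : ∫⁻ s in Iio t, V s ∂h = ∫⁻ s in Iio t, (V s * m (Iio s)
      * ∫⁻ x in Ioi s, m (Iio x) ^ (-2 : ℝ) ∂(m.restrict (Iio t))
      + (m (Iio t))⁻¹ * (V s * m (Iio s))) ∂h := by
    refine setLIntegral_congr_fun_ae measurableSet_Iio ?_
    filter_upwards [ae_pos_of_Iic_zero h0] with s hs hst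
    have h2 := lintegral_Ico_measure_rpow m (le_of_lt hst) (hm.pos s hs) (hm.fin t) one_pos
    rw [ENNReal.ofReal_one, one_mul, ENNReal.rpow_neg_one, ENNReal.rpow_neg_one,
      show (-1 - 1 : ℝ) = -2 by norm_num] at h2
    have h3 : ∫⁻ x in Ioi s, m (Iio x) ^ (-2 : ℝ) ∂(m.restrict (Iio t))
        = ∫⁻ x in Ico s t, m (Iio x) ^ (-2 : ℝ) ∂m := by
      rw [Measure.restrict_restrict measurableSet_Ioi, Ioi_inter_Iio, restrict_Ioo_eq_restrict_Ico]
    rw [h3, mul_comm (m (Iio t))⁻¹, ← mul_add, h2, mul_assoc,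
      ENNReal.mul_inv_cancel (hm.pos s hs) (hm.fin s), mul_one]
  rw [h1, lintegral_add_right _ (hG.const_mul _), lintegral_const_mul _ hG]
  gcongr 1
  rw [← lintegral_mul_lintegral_Iio _ _ hF hG]
  refine setLIntegral_mono' measurableSet_Iio fun x hx => ?_
  gcongr
  calc ∫⁻ y in Iio x, V y * m (Iio y) ∂(h.restrict (Iio t))
      ≤ ∫⁻ y in Iio x, V y * m (Iio y) ∂h :=
        lintegral_mono' (Measure.restrict_mono_measure Measure.restrict_le_self _) le_rfl
    _ ≤ ∫⁻ y in Iio x, V x * m (Iio y) ∂h := by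
        refine setLIntegral_mono' measurableSet_Iio fun y hy => ?_
        gcongr
        exact hV (le_of_lt hy)
    _ ≤ _ := by
        rw [lintegral_const_mul _ hW]
        exact mul_le_mul_right (setLIntegral_measure_Iio_le m h x) _

/-- A form of Minkowski's inequality, `‖∫ 1_{s < t} dl(s)‖_{β,q} ≤ C ∫ ‖1_{s < t}‖_{β,q} dl(s)`. -/
theorem lintegral_measure_Iio_rpow_le_rpow (l q : Measure ℝ) [NullSingletonClass l] [SFinite l]
    [SFinite q] {β : ℝ} (hβ : 1 ≤ β) :
    ∫⁻ t, l (Iio t) ^ β ∂q ≤ 2 ^ β * (∫⁻ s, q (Ioi s) ^ β⁻¹ ∂l) ^ β := by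
  have hβ0 : 0 < β := by linarith
  have hβ1 : 0 ≤ β - 1 := by linarith
  refine (lintegral_measure_Iio_rpow_le l q hβ).trans ?_
  gcongr
  set L := ∫⁻ s, q (Ioi s) ^ β⁻¹ ∂l with hL
  have hUm := measurable_measure_Ioi q
  calc ∫⁻ s, l (Iio s) ^ (β - 1) * q (Ioi s) ∂l
      ≤ ∫⁻ s, L ^ (β - 1) * q (Ioi s) ^ β⁻¹ ∂l := by
        refine lintegral_mono fun s => ?_
        have h1 : l (Iio s) * q (Ioi s) ^ β⁻¹ ≤ L := by
          calc l (Iio s) * q (Ioi s) ^ β⁻¹ = ∫⁻ _ in Iio s, q (Ioi s) ^ β⁻¹ ∂l := by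
                rw [setLIntegral_const, mul_comm]
            _ ≤ ∫⁻ y in Iio s, q (Ioi y) ^ β⁻¹ ∂l := by
                refine setLIntegral_mono' measurableSet_Iio fun y hy => ?_
                have : q (Ioi s) ≤ q (Ioi y) := measure_mono (Ioi_subset_Ioi (le_of_lt hy))
                gcongr
            _ ≤ L := setLIntegral_le_lintegral _ _
        have h2 : q (Ioi s) = (q (Ioi s) ^ β⁻¹) ^ (β - 1) * q (Ioi s) ^ β⁻¹ := by
          rw [← ENNReal.rpow_mul, ← ENNReal.rpow_add_of_nonneg _ _ (by positivity) (by positivity)]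
          rw [show β⁻¹ * (β - 1) + β⁻¹ = 1 by field_simp; ring, ENNReal.rpow_one]
        calc l (Iio s) ^ (β - 1) * q (Ioi s)
            = (l (Iio s) * q (Ioi s) ^ β⁻¹) ^ (β - 1) * q (Ioi s) ^ β⁻¹ := by
              rw [ENNReal.mul_rpow_of_nonneg _ _ hβ1, mul_assoc, ← h2]
          _ ≤ _ := by gcongr
    _ = L ^ (β - 1) * L ^ (1 : ℝ) := by
        rw [lintegral_const_mul _ (hUm.pow_const _), ENNReal.rpow_one]
    _ = L ^ β := by
        rw [← ENNReal.rpow_add_of_nonneg _ _ hβ1 zero_le_one, sub_add_cancel]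

/-- The local part of the operator, `W(t)⁻¹ ∫_{(0,t)} V W dh`, is controlled by any majorant `P` of
`V U ^ (1/β)`, where `U s = q (Ioi s)`. -/
theorem lintegral_local_part_le {m h q : Measure ℝ} (hm : IsHalfLine m) [NullSingletonClass h]
    [SFinite h] (h0 : h (Iic 0) = 0) [SFinite q] (q0 : q (Iic 0) = 0) {β : ℝ} (hβ : 1 ≤ β)
    {V : ℝ → ℝ≥0∞} (hV : Measurable V) {P : ℝ → ℝ≥0∞} {Q : ℝ≥0∞}
    (hP : ∀ s x, 0 < s → s < x → V s * q (Ioi s) ^ β⁻¹ ≤ P x)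
    (hQ : ∀ s, 0 < s → V s * q (Ioi s) ^ β⁻¹ ≤ Q) :
    ∫⁻ t, ((m (Iio t))⁻¹ * ∫⁻ s in Iio t, V s * m (Iio s) ∂h) ^ β ∂q
      ≤ 2 ^ β * (ENNReal.ofReal β * ∫⁻ x, m (Iio x) ^ (-1 - β)
            * (P x * ∫⁻ y in Iio x, h (Ioi y) ∂m) ^ β ∂m
          + m univ ^ (-β) * (Q * ∫⁻ y, h (Ioi y) ∂m) ^ β) := by
  have := hm.null
  have := hm.sfinite
  have hβ0 : 0 < β := by linarith
  have hW := measurable_measure_Iio m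
  have hUm := measurable_measure_Ioi q
  have hG : Measurable fun s => V s * m (Iio s) := hV.mul hW
  set k : ℝ → ℝ≥0∞ := fun t => ∫⁻ s in Iio t, V s * m (Iio s) ∂h with hk
  have hkm : Measurable k := measurable_lintegral_Iio h _
  have hF : Measurable fun x => m (Iio x) ^ (-1 - β) := hW.pow_const _
  -- the estimate for the part of `h` carried by a set `S`
  have key : ∀ (S : Set ℝ) (R Z : ℝ≥0∞), MeasurableSet S →
      (∀ s ∈ S, 0 < s → V s * q (Ioi s) ^ β⁻¹ ≤ R) → (∫⁻ s in S, m (Iio s) ∂h ≤ Z) →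
      ∫⁻ t, (∫⁻ s in Iio t, V s * m (Iio s) ∂(h.restrict S)) ^ β ∂q ≤ 2 ^ β * (R * Z) ^ β := by
    intro S R Z hS hR hZ
    have h1 := lintegral_measure_Iio_rpow_le_rpow
      ((h.restrict S).withDensity fun s => V s * m (Iio s)) q hβ
    simp_rw [withDensity_apply _ measurableSet_Iio] at h1
    refine h1.trans ?_
    gcongr
    rw [lintegral_withDensity_eq_lintegral_mul _ hG (hUm.pow_const _)]
    calc ∫⁻ s in S, ((fun s => V s * m (Iio s)) * fun s => q (Ioi s) ^ β⁻¹) s ∂h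
        ≤ ∫⁻ s in S, R * m (Iio s) ∂h := by
          refine lintegral_mono_ae ?_
          filter_upwards [ae_restrict_mem hS, ae_restrict_of_ae (ae_pos_of_Iic_zero h0)]
            with s hs hs0
          simp only [Pi.mul_apply]
          rw [mul_right_comm]
          gcongr
          exact hR s hs hs0
      _ ≤ R * Z := by
          rw [lintegral_const_mul _ hW]
          gcongr
  have hx : ∀ x, ∫⁻ t in Iio x, k t ^ β ∂q
      ≤ 2 ^ β * (P x * ∫⁻ y in Iio x, h (Ioi y) ∂m) ^ β := fun x => by
    refine le_trans ?_ (key (Iio x) (P x) _ measurableSet_Iio (fun s hs hs0 => hP s x hs0 hs)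
      (setLIntegral_measure_Iio_le m h x))
    rw [← lintegral_indicator measurableSet_Iio]
    refine lintegral_mono fun t => ?_
    by_cases ht : t < x
    · rw [indicator_of_mem (mem_Iio.2 ht), Measure.restrict_restrict measurableSet_Iio,
        inter_eq_left.2 (Iio_subset_Iio ht.le)]
    · simp [ht]
  have htop : ∫⁻ t, k t ^ β ∂q ≤ 2 ^ β * (Q * ∫⁻ y, h (Ioi y) ∂m) ^ β := by
    have := key univ Q (∫⁻ y, h (Ioi y) ∂m) MeasurableSet.univ (fun s _ hs0 => hQ s hs0)
      (by rw [Measure.restrict_univ]; exact lintegral_measure_Iio_le m h)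
    simpa only [Measure.restrict_univ] using this
  calc ∫⁻ t, ((m (Iio t))⁻¹ * k t) ^ β ∂q
      = ∫⁻ t, (ENNReal.ofReal β * (k t ^ β * ∫⁻ x in Ioi t, m (Iio x) ^ (-1 - β) ∂m)
          + m univ ^ (-β) * k t ^ β) ∂q := by
        refine lintegral_congr_ae ?_
        filter_upwards [ae_pos_of_Iic_zero q0] with t ht
        have h2 := lintegral_Ici_measure_rpow m (hm.pos t ht) hm.fin hβ0
        rw [ENNReal.mul_rpow_of_nonneg _ _ hβ0.le, ENNReal.inv_rpow, ← ENNReal.rpow_neg, ← h2,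
          restrict_Ioi_eq_restrict_Ici]
        ring
    _ = ENNReal.ofReal β * ∫⁻ x, m (Iio x) ^ (-1 - β) * ∫⁻ t in Iio x, k t ^ β ∂q ∂m
          + m univ ^ (-β) * ∫⁻ t, k t ^ β ∂q := by
        rw [lintegral_add_right _ ((hkm.pow_const _).const_mul _),
          lintegral_const_mul _ (hkm.pow_const _), lintegral_const_mul _ (show Measurable fun t =>
            k t ^ β * ∫⁻ x in Ioi t, m (Iio x) ^ (-1 - β) ∂m from
              (hkm.pow_const _).mul (measurable_lintegral_Ioi m _)),
          lintegral_mul_lintegral_Iio m q hF (hkm.pow_const _)]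
    _ ≤ ENNReal.ofReal β * ∫⁻ x, 2 ^ β * (m (Iio x) ^ (-1 - β)
            * (P x * ∫⁻ y in Iio x, h (Ioi y) ∂m) ^ β) ∂m
          + m univ ^ (-β) * (2 ^ β * (Q * ∫⁻ y, h (Ioi y) ∂m) ^ β) := by
        refine add_le_add (mul_le_mul_right (lintegral_mono fun x => ?_) _)
          (mul_le_mul_right htop _)
        rw [mul_left_comm]
        exact mul_le_mul_right (hx x) _
    _ = _ := by
        rw [lintegral_const_mul' _ _ (ENNReal.rpow_ne_top_of_nonneg hβ0.le (by simp))]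
        ring

/-- The primitive `∫_{(0,t)} V J W ^ (-2) dW` as a Hardy operator `∫_{(0,t)} χ dν` for
`ν = V ^ b dμ`, with `χ` controlled by the averages `J / W`. -/
theorem exists_density {m : Measure ℝ} (hm : IsHalfLine m) {a b : ℝ}
    (hab : a.HolderConjugate b) {V J : ℝ → ℝ≥0∞} (hV : Measurable V) (hVt : ∀ x, V x ≠ ∞)
    (hJ : Measurable J) :
    ∃ χ : ℝ → ℝ≥0∞, Measurable χ ∧
      (∀ t, ∫⁻ x in Iio t, m (Iio x) ^ (-2 : ℝ) * (V x * J x) ∂m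
        ≤ ∫⁻ x in Iio t, χ x ∂((dualMeasure m b).withDensity fun x => V x ^ b)) ∧
      ∫⁻ x, χ x ^ a ∂((dualMeasure m b).withDensity fun x => V x ^ b)
        ≤ ENNReal.ofReal (b - 1) ^ (1 - a) * ∫⁻ x, ((m (Iio x))⁻¹ * J x) ^ a ∂m := by
  have := hm.null
  have ha := hab.pos
  have hb := hab.symm.pos
  have hb1 : 0 < b - 1 := hab.symm.sub_one_pos
  set B := ENNReal.ofReal (b - 1) with hB
  have hB0 : B ≠ 0 := by simpa [hB] using hb1
  have hBt : B ≠ ∞ := ENNReal.ofReal_ne_top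
  have hd := measurable_dualDensity m b
  have hW := measurable_measure_Iio m
  have hW2 : ∀ e : ℝ, Measurable fun x => m (Iio x) ^ e := fun e => hW.pow_const e
  have hχ : Measurable fun x => B⁻¹ * m (Iio x) ^ (b - 2) * V x ^ (1 - b) * J x :=
    (((hW2 _).const_mul _).mul (hV.pow_const _)).mul hJ
  have hint : ∀ (f : ℝ → ℝ≥0∞), Measurable f →
      ∫⁻ x, f x ∂((dualMeasure m b).withDensity fun x => V x ^ b)
        = ∫⁻ x, B * m (Iio x) ^ (-b) * (V x ^ b * f x) ∂m := fun f hf => by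
    rw [lintegral_withDensity_eq_lintegral_mul _ (hV.pow_const b) hf]
    exact lintegral_dualMeasure m b ((hV.pow_const b).mul hf)
  refine ⟨_, hχ, fun t => ?_, ?_⟩
  · rw [← lintegral_indicator measurableSet_Iio, ← lintegral_indicator measurableSet_Iio,
      hint _ (hχ.indicator measurableSet_Iio)]
    refine lintegral_mono_ae ?_
    filter_upwards [ae_measure_Iio_ne_zero m] with x hx
    by_cases ht : x < t
    · rw [indicator_of_mem (mem_Iio.2 ht), indicator_of_mem (mem_Iio.2 ht)]
      rcases eq_or_ne (V x) 0 with h0 | h0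
      · simp [h0]
      refine le_of_eq ?_
      have h1 : m (Iio x) ^ (-2 : ℝ) = m (Iio x) ^ (-b) * m (Iio x) ^ (b - 2) := by
        rw [← ENNReal.rpow_add _ _ hx (hm.fin x)]
        congr 1
        ring
      have h2 : V x ^ b * V x ^ (1 - b) = V x := by
        rw [← ENNReal.rpow_add _ _ h0 (hVt x), show b + (1 - b) = 1 by ring, ENNReal.rpow_one]
      calc m (Iio x) ^ (-2 : ℝ) * (V x * J x)
          = (B * B⁻¹) * ((m (Iio x) ^ (-b) * m (Iio x) ^ (b - 2))
              * ((V x ^ b * V x ^ (1 - b)) * J x)) := by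
            rw [ENNReal.mul_inv_cancel hB0 hBt, one_mul, ← h1, h2]
        _ = _ := by ring
    · rw [indicator_of_notMem (by simpa using ht)]
      exact zero_le
  · rw [hint _ (hχ.pow_const a), ← lintegral_const_mul' _ _
      (ENNReal.rpow_ne_top_of_ne_zero hB0 hBt)]
    refine lintegral_mono_ae ?_
    filter_upwards [ae_measure_Iio_ne_zero m] with x hx
    rcases eq_or_ne (V x) 0 with h0 | h0
    · simp [h0, hb]
    refine le_of_eq ?_
    have hmul := hab.mul_eq_add
    rw [ENNReal.mul_rpow_of_nonneg _ _ ha.le, ENNReal.mul_rpow_of_nonneg _ _ ha.le,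
      ENNReal.mul_rpow_of_nonneg _ _ ha.le, ENNReal.mul_rpow_of_nonneg _ _ ha.le,
      ← ENNReal.rpow_mul, ← ENNReal.rpow_mul, ENNReal.inv_rpow, ENNReal.inv_rpow,
      ← ENNReal.rpow_neg, ← ENNReal.rpow_neg]
    have h1 : m (Iio x) ^ (-a) = m (Iio x) ^ (-b) * m (Iio x) ^ ((b - 2) * a) := by
      rw [← ENNReal.rpow_add _ _ hx (hm.fin x)]
      congr 1
      linarith
    have h2 : V x ^ b * V x ^ ((1 - b) * a) = 1 :=
      rpow_mul_rpow_cancel h0 (hVt x) (by linarith)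
    have h3 : B ^ (1 - a) = B * B ^ (-a) := by
      rw [show 1 - a = 1 + -a by ring, ENNReal.rpow_add _ _ hB0 hBt, ENNReal.rpow_one]
    rw [h3, h1]
    calc B * m (Iio x) ^ (-b) * (V x ^ b * (B ^ (-a) * m (Iio x) ^ ((b - 2) * a)
          * V x ^ ((1 - b) * a) * J x ^ a))
        = B * m (Iio x) ^ (-b) * (B ^ (-a) * m (Iio x) ^ ((b - 2) * a) * J x ^ a)
            * (V x ^ b * V x ^ ((1 - b) * a)) := by ring
      _ = _ := by
        rw [h2]
        ring

/-- Hölder's inequality against the constant function `1`. -/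
theorem setLIntegral_le_rpow_mul_rpow (m : Measure ℝ) {a b : ℝ} (hab : a.HolderConjugate b)
    {f : ℝ → ℝ≥0∞} (hf : Measurable f) (S : Set ℝ) :
    ∫⁻ y in S, f y ∂m ≤ (∫⁻ y, f y ^ a ∂m) ^ a⁻¹ * m S ^ b⁻¹ := by
  have h := ENNReal.lintegral_mul_le_Lp_mul_Lq (m.restrict S) hab hf.aemeasurable
    (aemeasurable_const (b := (1 : ℝ≥0∞)))
  simp only [Pi.mul_apply, mul_one, ENNReal.one_rpow, lintegral_const, one_mul,
    Measure.restrict_apply_univ, one_div] at h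
  refine h.trans ?_
  have := hab.pos
  exact mul_le_mul_left (ENNReal.rpow_le_rpow (setLIntegral_le_lintegral _ _) (by positivity)) _

/-- The contribution of the total mass to the local part of the operator. -/
theorem univ_term_le {m : Measure ℝ} (hm : IsHalfLine m) {a b β : ℝ} (hab : a.HolderConjugate b)
    (hβ : 0 < β) {H : ℝ → ℝ≥0∞} (hH : Measurable H) {Q A : ℝ≥0∞}
    (hQ : m univ ^ (-a⁻¹) * Q ≤ A) :
    m univ ^ (-β) * (Q * ∫⁻ y, H y ∂m) ^ β ≤ A ^ β * (∫⁻ y, H y ^ a ∂m) ^ (β / a) := by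
  have ha := hab.pos
  have hinv : b⁻¹ = 1 - a⁻¹ := hab.one_sub_inv.symm
  rcases eq_or_ne (m univ) ∞ with hT | hT
  · rw [hT, ENNReal.top_rpow_of_neg (by linarith), zero_mul]
    exact zero_le
  have h0 : m univ ≠ 0 := fun h => hm.pos 1 one_pos (measure_mono_null (subset_univ _) h)
  have h := setLIntegral_le_rpow_mul_rpow m hab hH univ
  rw [Measure.restrict_univ] at h
  set X := ∫⁻ y, H y ^ a ∂m with hX
  calc m univ ^ (-β) * (Q * ∫⁻ y, H y ∂m) ^ β
      ≤ m univ ^ (-β) * (Q * (X ^ a⁻¹ * m univ ^ b⁻¹)) ^ β := by gcongr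
    _ = (m univ ^ (-a⁻¹) * Q) ^ β * X ^ (β / a) := by
        have h1 : m univ ^ (-a⁻¹ * β) = m univ ^ (-β) * m univ ^ (b⁻¹ * β) := by
          rw [← ENNReal.rpow_add _ _ h0 hT]
          congr 1
          rw [hinv]
          ring
        rw [ENNReal.mul_rpow_of_nonneg _ _ hβ.le, ENNReal.mul_rpow_of_nonneg _ _ hβ.le,
          ENNReal.mul_rpow_of_nonneg _ _ hβ.le, ← ENNReal.rpow_mul, ← ENNReal.rpow_mul,
          ← ENNReal.rpow_mul, h1, show β / a = a⁻¹ * β by ring]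
        ring
    _ ≤ _ := by gcongr

/-- The upper estimate for the operator `h ↦ ∫_{(0,t)} V dh` in the range `a ≤ β`. -/
theorem operator_upper_of_le {a b β : ℝ} (hab : a.HolderConjugate b) (haβ : a ≤ β) :
    ∃ C : ℝ≥0, ∀ (m q h : Measure ℝ) (V : ℝ → ℝ≥0∞) (A : ℝ≥0∞), IsHalfLine m → SFinite q →
      q (Iic 0) = 0 → NullSingletonClass h → SFinite h → h (Iic 0) = 0 → Monotone V →
      (∀ x, V x ≠ ∞) →
      (∀ x, ((dualMeasure m b).withDensity fun x => V x ^ b) (Iio x) ≠ ∞) →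
      (∀ x, ((dualMeasure m b).withDensity fun x => V x ^ b) (Iio x) ^ b⁻¹
        * q (Ioi x) ^ β⁻¹ ≤ A) →
      (∀ x, 0 < x → V x * q (Ioi x) ^ β⁻¹ ≤ A * m (Iio x) ^ a⁻¹) →
      ∫⁻ t, (∫⁻ s in Iio t, V s ∂h) ^ β ∂q
        ≤ C * A ^ β * (∫⁻ t, h (Ioi t) ^ a ∂m) ^ (β / a) := by
  have ha := hab.pos
  have hb := hab.symm.pos
  have ha1 : 0 < a - 1 := hab.sub_one_pos
  have hb1 : 0 < b - 1 := hab.symm.sub_one_pos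
  have hβ : 0 < β := ha.trans_le haβ
  have hβ1 : 1 ≤ β := hab.lt.le.trans haβ
  have hinv : b⁻¹ = 1 - a⁻¹ := hab.one_sub_inv.symm
  -- the constants of the two parts of the operator
  set C₁ : ℝ≥0∞ := 2 ^ β * ENNReal.ofReal b ^ (a - 1)
    * (ENNReal.ofReal (b - 1) ^ (1 - a) * ENNReal.ofReal b ^ a) ^ (β / a) with hC₁
  set C₂ : ℝ≥0∞ := 2 ^ β * (ENNReal.ofReal β * ENNReal.ofReal b ^ a + 1) with hC₂
  have h2t : (2 : ℝ≥0∞) ^ β ≠ ∞ := ENNReal.rpow_ne_top_of_nonneg hβ.le (by simp)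
  have hbt : ∀ e : ℝ, 0 ≤ e → ENNReal.ofReal b ^ e ≠ ∞ := fun e he =>
    ENNReal.rpow_ne_top_of_nonneg he ENNReal.ofReal_ne_top
  have hC₁t : C₁ ≠ ∞ := by
    refine ENNReal.mul_ne_top (ENNReal.mul_ne_top h2t (hbt _ ha1.le))
      (ENNReal.rpow_ne_top_of_nonneg (by positivity) (ENNReal.mul_ne_top ?_ (hbt _ ha.le)))
    exact ENNReal.rpow_ne_top_of_ne_zero (by simpa using hb1) ENNReal.ofReal_ne_top
  have hC₂t : C₂ ≠ ∞ := ENNReal.mul_ne_top h2t (ENNReal.add_ne_top.2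
    ⟨ENNReal.mul_ne_top ENNReal.ofReal_ne_top (hbt _ ha.le), ENNReal.one_ne_top⟩)
  have h2b : (2 : ℝ≥0∞) ^ (β - 1) ≠ ∞ := ENNReal.rpow_ne_top_of_nonneg (by linarith) (by simp)
  refine ⟨(2 ^ (β - 1) * (C₁ + C₂)).toNNReal, ?_⟩
  rw [ENNReal.coe_toNNReal (ENNReal.mul_ne_top h2b (ENNReal.add_ne_top.2 ⟨hC₁t, hC₂t⟩))]
  intro m q h V A hm _ q0 _ _ h0 hV hVt hfin hA₁ hA₂
  have := hm.null
  have := hm.sfinite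
  have hW := measurable_measure_Iio m
  have hH := measurable_measure_Ioi h
  set X := ∫⁻ t, h (Ioi t) ^ a ∂m with hX
  set J : ℝ → ℝ≥0∞ := fun x => ∫⁻ y in Iio x, h (Ioi y) ∂m with hJ
  have hJm : Measurable J := measurable_lintegral_Iio m _
  have hardyJ : ∫⁻ x, ((m (Iio x))⁻¹ * J x) ^ a ∂m ≤ ENNReal.ofReal b ^ a * X :=
    hardy m hm.fin hab hH
  obtain ⟨χ, hχ, hχ₁, hχ₂⟩ := exists_density hm hab hV.measurable hVt hJm
  set ν := (dualMeasure m b).withDensity fun x => V x ^ b with hν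
  have hνn : NullSingletonClass ν := by rw [hν, dualMeasure]; infer_instance
  have hνs : SFinite ν := by rw [hν, dualMeasure]; infer_instance
  have hT₁ : ∫⁻ t, (∫⁻ x in Iio t, m (Iio x) ^ (-2 : ℝ) * (V x * J x) ∂m) ^ β ∂q
      ≤ C₁ * A ^ β * X ^ (β / a) := by
    calc ∫⁻ t, (∫⁻ x in Iio t, m (Iio x) ^ (-2 : ℝ) * (V x * J x) ∂m) ^ β ∂q
        ≤ ∫⁻ t, (∫⁻ x in Iio t, χ x ∂ν) ^ β ∂q := by
          exact lintegral_mono fun t => ENNReal.rpow_le_rpow (hχ₁ t) hβ.le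
      _ ≤ 2 ^ β * ENNReal.ofReal b ^ (a - 1) * A ^ β * (∫⁻ x, χ x ^ a ∂ν) ^ (β / a) :=
          weighted_hardy_of_le ν q hfin hab haβ hA₁ hχ
      _ ≤ 2 ^ β * ENNReal.ofReal b ^ (a - 1) * A ^ β
            * (ENNReal.ofReal (b - 1) ^ (1 - a) * (ENNReal.ofReal b ^ a * X)) ^ (β / a) := by
          gcongr
          exact hχ₂.trans (mul_le_mul_right hardyJ _)
      _ = _ := by
          rw [← mul_assoc (ENNReal.ofReal (b - 1) ^ (1 - a)),
            ENNReal.mul_rpow_of_nonneg _ X (by positivity), hC₁]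
          ring
  have hT₂ : ∫⁻ t, ((m (Iio t))⁻¹ * ∫⁻ s in Iio t, V s * m (Iio s) ∂h) ^ β ∂q
      ≤ C₂ * A ^ β * X ^ (β / a) := by
    have hmono : ∀ s x : ℝ, 0 < s → s < x → V s * q (Ioi s) ^ β⁻¹ ≤ A * m (Iio x) ^ a⁻¹ :=
      fun s x hs hsx => (hA₂ s hs).trans (by gcongr)
    have huniv : ∀ s : ℝ, 0 < s → V s * q (Ioi s) ^ β⁻¹ ≤ A * m univ ^ a⁻¹ :=
      fun s hs => (hA₂ s hs).trans (by gcongr; exact subset_univ _)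
    have hloc := lintegral_local_part_le hm h0 q0 hβ1 hV.measurable hmono huniv
    have hend : m univ ^ (-β) * (A * m univ ^ a⁻¹ * ∫⁻ y, h (Ioi y) ∂m) ^ β
        ≤ A ^ β * X ^ (β / a) := by
      rcases eq_or_ne (m univ) ∞ with hT | hT
      · rw [hT, ENNReal.top_rpow_of_neg (by linarith), zero_mul]
        exact zero_le
      have hu0 : m univ ≠ 0 := fun h => hm.pos 1 one_pos (measure_mono_null (subset_univ _) h)
      refine univ_term_le hm hab hβ hH (le_of_eq ?_)
      rw [mul_left_comm, rpow_mul_rpow_cancel hu0 hT (by ring), mul_one]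
    have hmain : ∫⁻ x, m (Iio x) ^ (-1 - β) * (A * m (Iio x) ^ a⁻¹ * J x) ^ β ∂m
        ≤ ENNReal.ofReal b ^ a * (A ^ β * X ^ (β / a)) := by
      have hba : 0 ≤ β - a := by linarith
      calc ∫⁻ x, m (Iio x) ^ (-1 - β) * (A * m (Iio x) ^ a⁻¹ * J x) ^ β ∂m
          ≤ ∫⁻ x, A ^ β * X ^ (a⁻¹ * (β - a)) * ((m (Iio x))⁻¹ * J x) ^ a ∂m := by
            refine lintegral_mono_ae ?_
            filter_upwards [ae_measure_Iio_ne_zero m] with x hx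
            have hJX : J x ≤ X ^ a⁻¹ * m (Iio x) ^ b⁻¹ :=
              setLIntegral_le_rpow_mul_rpow m hab hH _
            calc m (Iio x) ^ (-1 - β) * (A * m (Iio x) ^ a⁻¹ * J x) ^ β
                = A ^ β * (m (Iio x) ^ (-1 - β) * m (Iio x) ^ (a⁻¹ * β))
                    * (J x ^ (β - a) * J x ^ a) := by
                  rw [ENNReal.mul_rpow_of_nonneg _ _ hβ.le, ENNReal.mul_rpow_of_nonneg _ _ hβ.le,
                    ← ENNReal.rpow_mul, ← ENNReal.rpow_add_of_nonneg _ _ hba ha.le,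
                    sub_add_cancel]
                  ring
              _ ≤ A ^ β * (m (Iio x) ^ (-1 - β) * m (Iio x) ^ (a⁻¹ * β))
                    * ((X ^ a⁻¹ * m (Iio x) ^ b⁻¹) ^ (β - a) * J x ^ a) := by gcongr
              _ = A ^ β * X ^ (a⁻¹ * (β - a)) * ((m (Iio x) ^ (-1 - β)
                    * m (Iio x) ^ (a⁻¹ * β) * m (Iio x) ^ (b⁻¹ * (β - a))) * J x ^ a) := by
                  rw [ENNReal.mul_rpow_of_nonneg _ _ hba, ← ENNReal.rpow_mul,
                    ← ENNReal.rpow_mul]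
                  ring
              _ = _ := by
                  rw [← ENNReal.rpow_add _ _ hx (hm.fin x), ← ENNReal.rpow_add _ _ hx (hm.fin x),
                    ENNReal.mul_rpow_of_nonneg _ _ ha.le, ENNReal.inv_rpow, ← ENNReal.rpow_neg]
                  congr 4
                  rw [hinv]
                  field_simp
                  ring
        _ ≤ A ^ β * X ^ (a⁻¹ * (β - a)) * (ENNReal.ofReal b ^ a * X) := by
            rw [lintegral_const_mul _ (show Measurable fun x => ((m (Iio x))⁻¹ * J x) ^ a from
              (hW.inv.mul hJm).pow_const _)]
            gcongr
        _ = ENNReal.ofReal b ^ a * (A ^ β * (X ^ (a⁻¹ * (β - a)) * X ^ (1 : ℝ))) := by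
            rw [ENNReal.rpow_one]
            ring
        _ = _ := by
            rw [← ENNReal.rpow_add_of_nonneg _ _ (by positivity) zero_le_one]
            congr 3
            field_simp
            ring
    refine hloc.trans ?_
    calc 2 ^ β * (ENNReal.ofReal β * ∫⁻ x, m (Iio x) ^ (-1 - β)
            * (A * m (Iio x) ^ a⁻¹ * J x) ^ β ∂m
          + m univ ^ (-β) * (A * m univ ^ a⁻¹ * ∫⁻ y, h (Ioi y) ∂m) ^ β)
        ≤ 2 ^ β * (ENNReal.ofReal β * (ENNReal.ofReal b ^ a * (A ^ β * X ^ (β / a)))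
            + A ^ β * X ^ (β / a)) := by gcongr
      _ = _ := by
          rw [hC₂]
          ring
  calc ∫⁻ t, (∫⁻ s in Iio t, V s ∂h) ^ β ∂q
      ≤ ∫⁻ t, 2 ^ (β - 1) * ((∫⁻ x in Iio t, m (Iio x) ^ (-2 : ℝ) * (V x * J x) ∂m) ^ β
          + ((m (Iio t))⁻¹ * ∫⁻ s in Iio t, V s * m (Iio s) ∂h) ^ β) ∂q := by
        refine lintegral_mono fun t => ?_
        refine le_trans ?_ (ENNReal.rpow_add_le_mul_rpow_add_rpow _ _ hβ1)
        gcongr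
        exact lintegral_Iio_le_add hm h0 hV t
    _ ≤ 2 ^ (β - 1) * (C₁ * A ^ β * X ^ (β / a) + C₂ * A ^ β * X ^ (β / a)) := by
        rw [lintegral_const_mul' _ _ h2b,
          lintegral_add_left ((measurable_lintegral_Iio m _).pow_const _)]
        gcongr
    _ = _ := by ring

/-- The relations between the exponents `ρ`, with `1/ρ = 1/β - 1/a`, and `ρ/β'`. -/
theorem exponent_relations {a b β ρ : ℝ} (hab : a.HolderConjugate b) (hβ : 1 < β) (hρ : 0 < ρ)
    (hρβ : ρ⁻¹ = β⁻¹ - a⁻¹) :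
    1 + ρ * (β - 1) / β = ρ / b ∧ 1 + ρ * (β - 1) / β / a = ρ / b / β ∧
      -b + (1 - b) * (ρ * (β - 1) / β) = -(ρ / β) ∧ β / a + β / ρ = 1 := by
  have ha := hab.pos
  have hb := hab.symm.pos
  have hβ0 : 0 < β := by linarith
  have hinv : b⁻¹ = 1 - a⁻¹ := hab.one_sub_inv.symm
  have h1 : 1 = ρ * β⁻¹ - ρ * a⁻¹ := by
    rw [← mul_sub, ← hρβ, mul_inv_cancel₀ hρ.ne']
  have e1 : 1 + ρ * (β - 1) / β = ρ / b := by
    have h2 : ρ * (β - 1) / β = ρ - ρ * β⁻¹ := by field_simp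
    rw [h2, div_eq_mul_inv, hinv]
    linarith
  have h3 : β / a + β / ρ = 1 := by
    rw [div_eq_mul_inv β ρ, hρβ]
    field_simp
    ring
  have e2 : 1 + ρ * (β - 1) / β / a = ρ / b / β := by
    have h2 : ρ * (β - 1) / β = ρ / b - 1 := by linarith
    have h4 : 1 / a = 1 / β - 1 / ρ := by
      rw [one_div, one_div, one_div, hρβ]
      ring
    have h5 : 1 / b = 1 - 1 / β + 1 / ρ := by
      rw [one_div, hinv, ← one_div, h4]
      ring
    have h6 : ρ / b * (1 / ρ) = 1 / b := by field_simp
    rw [h2, show (ρ / b - 1) / a = (ρ / b - 1) * (1 / a) by ring, h4]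
    linear_combination -h6 - h5
  refine ⟨e1, e2, ?_, h3⟩
  have h5 : b - 1 = b / a := by
    have := hab.symm.div_conj_eq_sub_one
    linarith
  have : -b + (1 - b) * (ρ * (β - 1) / β) = -(b * (1 + ρ * (β - 1) / β / a)) := by
    rw [show (1 - b) = -(b / a) by linarith]
    ring
  rw [this, e2]
  field_simp

/-- The tail of the dual measure may replace the power `W ^ (1 - b)`, up to a term carried by the
total mass of `m`. -/
theorem lintegral_rpow_mul_neg_le {m : Measure ℝ} (hm : IsHalfLine m) {a b β ρ : ℝ}
    (hab : a.HolderConjugate b) (hβ : 1 < β) (hρ : 0 < ρ) (hρβ : ρ⁻¹ = β⁻¹ - a⁻¹)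
    {Φ : ℝ → ℝ≥0∞} (hΦ : Measurable Φ) {Q A : ℝ≥0∞} (hΦQ : ∀ x, Φ x ≤ Q)
    (hA : ∫⁻ x, dualMeasure m b (Ioi x) ^ (ρ * (β - 1) / β) * Φ x ^ ρ ∂(dualMeasure m b) ≤ A ^ ρ)
    (hQ : m univ ^ (-a⁻¹) * Q ≤ A) :
    ∫⁻ x, Φ x ^ ρ * m (Iio x) ^ (-(ρ / β)) ∂m
      ≤ (2 ^ (ρ * (β - 1) / β) * (ENNReal.ofReal (b - 1))⁻¹ + 2 ^ (ρ / β / (b - 1))) * A ^ ρ := by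
  have hβ0 : 0 < β := by linarith
  have hβ1 : 0 < β - 1 := by linarith
  have hb := hab.symm.pos
  have hb1 : 0 < b - 1 := hab.symm.sub_one_pos
  obtain ⟨-, -, e3, -⟩ := exponent_relations hab hβ hρ hρβ
  set κ := ρ * (β - 1) / β with hκ
  have hκ0 : 0 ≤ κ := by positivity
  set e := ρ / β / (b - 1) with he
  have he0 : 0 ≤ e := by positivity
  set B := ENNReal.ofReal (b - 1) with hB
  have hB0 : B ≠ 0 := by simpa [hB] using hb1
  have hBt : B ≠ ∞ := ENNReal.ofReal_ne_top
  have hM0 : m univ ≠ 0 := fun h => hm.pos 1 one_pos (measure_mono_null (subset_univ _) h)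
  have hMt : m univ ^ (1 - b) ≠ ∞ := by
    intro h
    rcases ENNReal.rpow_eq_top_iff.1 h with h | h
    · exact hM0 h.1
    · linarith [h.2]
  have hW := measurable_measure_Iio m
  have hT := measurable_measure_Ioi (dualMeasure m b)
  have hF : Measurable fun x => B * m (Iio x) ^ (-b)
      * (dualMeasure m b (Ioi x) ^ κ * Φ x ^ ρ) :=
    (measurable_dualDensity m b).mul ((hT.pow_const _).mul (hΦ.pow_const _))
  have hpt : ∀ᵐ x ∂m, Φ x ^ ρ * m (Iio x) ^ (-(ρ / β))
      ≤ 2 ^ κ * B⁻¹ * (B * m (Iio x) ^ (-b) * (dualMeasure m b (Ioi x) ^ κ * Φ x ^ ρ))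
        + 2 ^ e * Q ^ ρ * m univ ^ (-(ρ / β)) := by
    filter_upwards [ae_pos_of_Iic_zero hm.Iic_zero] with x hx
    have h0 := hm.pos x hx
    have hsum := dualMeasure_Ioi_add hm hab.symm.lt hx
    by_cases hG : m univ ^ (1 - b) ≤ dualMeasure m b (Ioi x)
    · refine le_trans ?_ le_self_add
      calc Φ x ^ ρ * m (Iio x) ^ (-(ρ / β))
          = Φ x ^ ρ * (m (Iio x) ^ (-b) * (m (Iio x) ^ (1 - b)) ^ κ) := by
            rw [← e3, ENNReal.rpow_add _ _ h0 (hm.fin x), ENNReal.rpow_mul]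
        _ ≤ Φ x ^ ρ * (m (Iio x) ^ (-b) * (2 * dualMeasure m b (Ioi x)) ^ κ) := by
            gcongr
            rw [← hsum, two_mul]
            gcongr
        _ = (B⁻¹ * B) * (Φ x ^ ρ * (m (Iio x) ^ (-b) * (2 ^ κ
              * dualMeasure m b (Ioi x) ^ κ))) := by
            rw [ENNReal.inv_mul_cancel hB0 hBt, one_mul, ENNReal.mul_rpow_of_nonneg _ _ hκ0]
        _ = _ := by ring
    · refine le_trans ?_ le_add_self
      have h1 : m (Iio x) ^ (1 - b) ≤ 2 * m univ ^ (1 - b) := by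
        rw [← hsum, two_mul]
        exact add_le_add (not_le.1 hG).le le_rfl
      calc Φ x ^ ρ * m (Iio x) ^ (-(ρ / β)) = Φ x ^ ρ * (m (Iio x) ^ (1 - b)) ^ e := by
            rw [← ENNReal.rpow_mul]
            congr 2
            rw [he]
            field_simp
            ring
        _ ≤ Q ^ ρ * (2 * m univ ^ (1 - b)) ^ e := by
            gcongr
            exact hΦQ x
        _ = _ := by
            rw [ENNReal.mul_rpow_of_nonneg _ _ he0, ← ENNReal.rpow_mul,
              show (1 - b) * e = -(ρ / β) by rw [he]; field_simp; ring]
            ring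
  calc ∫⁻ x, Φ x ^ ρ * m (Iio x) ^ (-(ρ / β)) ∂m
      ≤ ∫⁻ x, (2 ^ κ * B⁻¹ * (B * m (Iio x) ^ (-b) * (dualMeasure m b (Ioi x) ^ κ * Φ x ^ ρ))
        + 2 ^ e * Q ^ ρ * m univ ^ (-(ρ / β))) ∂m := lintegral_mono_ae hpt
    _ = 2 ^ κ * B⁻¹ * ∫⁻ x, dualMeasure m b (Ioi x) ^ κ * Φ x ^ ρ ∂(dualMeasure m b)
        + 2 ^ e * Q ^ ρ * (m univ ^ (-(ρ / β)) * m univ) := by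
        rw [lintegral_add_left (hF.const_mul _), lintegral_const_mul _ hF,
          lintegral_dualMeasure m b (show Measurable fun x =>
            dualMeasure m b (Ioi x) ^ κ * Φ x ^ ρ from (hT.pow_const _).mul (hΦ.pow_const _)),
          lintegral_const]
        ring
    _ ≤ 2 ^ κ * B⁻¹ * A ^ ρ + 2 ^ e * A ^ ρ := by
        refine add_le_add (mul_le_mul_right hA _) ?_
        rw [mul_assoc]
        refine mul_le_mul_right ?_ _
        rcases eq_or_ne (m univ) ∞ with hMT | hMT
        · rw [hMT, ENNReal.top_rpow_of_neg (by simp; positivity)]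
          simp
        · calc Q ^ ρ * (m univ ^ (-(ρ / β)) * m univ) = (m univ ^ (-a⁻¹) * Q) ^ ρ := by
                rw [ENNReal.mul_rpow_of_nonneg _ _ hρ.le, ← ENNReal.rpow_mul, mul_comm]
                congr 1
                nth_rw 2 [← ENNReal.rpow_one (m univ)]
                rw [← ENNReal.rpow_add _ _ hM0 hMT]
                congr 1
                have : 1 = ρ * β⁻¹ - ρ * a⁻¹ := by
                  rw [← mul_sub, ← hρβ, mul_inv_cancel₀ hρ.ne']
                rw [div_eq_mul_inv]
                linarith
            _ ≤ _ := by gcongr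
    _ = _ := by ring

/-- The upper estimate for the operator `h ↦ ∫_{(0,t)} V dh` in the range `β < a`. -/
theorem operator_upper_of_lt {a b β ρ : ℝ} (hab : a.HolderConjugate b) (hβ : 1 < β) (hρ : 0 < ρ)
    (hρβ : ρ⁻¹ = β⁻¹ - a⁻¹) :
    ∃ C : ℝ≥0, ∀ (m q h : Measure ℝ) (V Φ : ℝ → ℝ≥0∞) (Q A : ℝ≥0∞), IsHalfLine m → SFinite q →
      q (Iic 0) = 0 → NullSingletonClass h → SFinite h → h (Iic 0) = 0 → Monotone V →
      (∀ x, V x ≠ ∞) →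
      (∀ x, ((dualMeasure m b).withDensity fun x => V x ^ b) (Iio x) ≠ ∞) →
      Measurable Φ →
      (∀ s x, 0 < s → s < x → V s * q (Ioi s) ^ β⁻¹ ≤ Φ x) →
      (∀ s, 0 < s → V s * q (Ioi s) ^ β⁻¹ ≤ Q) → (∀ x, Φ x ≤ Q) →
      (∫⁻ x, dualMeasure m b (Ioi x) ^ (ρ * (β - 1) / β) * Φ x ^ ρ ∂(dualMeasure m b) ≤ A ^ ρ) →
      (∫⁻ x, ((dualMeasure m b).withDensity fun x => V x ^ b) (Iio x) ^ (ρ * (β - 1) / β)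
        * q (Ioi x) ^ (ρ / β) ∂((dualMeasure m b).withDensity fun x => V x ^ b) ≤ A ^ ρ) →
      (m univ ^ (-a⁻¹) * Q ≤ A) →
      ∫⁻ t, (∫⁻ s in Iio t, V s ∂h) ^ β ∂q
        ≤ C * A ^ β * (∫⁻ t, h (Ioi t) ^ a ∂m) ^ (β / a) := by
  have ha := hab.pos
  have hb := hab.symm.pos
  have hb1 : 0 < b - 1 := hab.symm.sub_one_pos
  have hβ0 : 0 < β := by linarith
  have hβ1 : 0 < β - 1 := by linarith
  obtain ⟨-, -, -, e4⟩ := exponent_relations hab hβ hρ hρβ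
  set D : ℝ≥0∞ := 2 ^ (ρ * (β - 1) / β) * (ENNReal.ofReal (b - 1))⁻¹ + 2 ^ (ρ / β / (b - 1))
    with hD
  -- the constants of the two parts of the operator
  set C₁ : ℝ≥0∞ := 2 ^ β * ENNReal.ofReal b ^ (β - 1)
    * (ENNReal.ofReal (b - 1) ^ (1 - a) * ENNReal.ofReal b ^ a) ^ (β / a) with hC₁
  set C₂ : ℝ≥0∞ := 2 ^ β * (ENNReal.ofReal β * (ENNReal.ofReal b ^ β * D ^ (β / ρ)) + 1) with hC₂
  have h2 : ∀ e : ℝ, 0 ≤ e → (2 : ℝ≥0∞) ^ e ≠ ∞ := fun e he =>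
    ENNReal.rpow_ne_top_of_nonneg he (by simp)
  have hbt : ∀ e : ℝ, 0 ≤ e → ENNReal.ofReal b ^ e ≠ ∞ := fun e he =>
    ENNReal.rpow_ne_top_of_nonneg he ENNReal.ofReal_ne_top
  have hDt : D ≠ ∞ := ENNReal.add_ne_top.2 ⟨ENNReal.mul_ne_top (h2 _ (by positivity))
    (ENNReal.inv_ne_top.2 (by simpa using hb1)), h2 _ (by positivity)⟩
  have hC₁t : C₁ ≠ ∞ := by
    refine ENNReal.mul_ne_top (ENNReal.mul_ne_top (h2 _ hβ0.le) (hbt _ hβ1.le))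
      (ENNReal.rpow_ne_top_of_nonneg (by positivity) (ENNReal.mul_ne_top ?_ (hbt _ ha.le)))
    exact ENNReal.rpow_ne_top_of_ne_zero (by simpa using hb1) ENNReal.ofReal_ne_top
  have hC₂t : C₂ ≠ ∞ := ENNReal.mul_ne_top (h2 _ hβ0.le) (ENNReal.add_ne_top.2
    ⟨ENNReal.mul_ne_top ENNReal.ofReal_ne_top (ENNReal.mul_ne_top (hbt _ hβ0.le)
      (ENNReal.rpow_ne_top_of_nonneg (by positivity) hDt)), ENNReal.one_ne_top⟩)
  refine ⟨(2 ^ (β - 1) * (C₁ + C₂)).toNNReal, ?_⟩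
  rw [ENNReal.coe_toNNReal (ENNReal.mul_ne_top (h2 _ hβ1.le) (ENNReal.add_ne_top.2 ⟨hC₁t, hC₂t⟩))]
  intro m q h V Φ Q A hm _ q0 _ _ h0 hV hVt hfin hΦ hVΦ hVQ hΦQ hA₁ hA₂ hA₃
  have := hm.null
  have := hm.sfinite
  have hW := measurable_measure_Iio m
  have hH := measurable_measure_Ioi h
  set X := ∫⁻ t, h (Ioi t) ^ a ∂m with hX
  set J : ℝ → ℝ≥0∞ := fun x => ∫⁻ y in Iio x, h (Ioi y) ∂m with hJ
  have hJm : Measurable J := measurable_lintegral_Iio m _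
  have hardyJ : ∫⁻ x, ((m (Iio x))⁻¹ * J x) ^ a ∂m ≤ ENNReal.ofReal b ^ a * X :=
    hardy m hm.fin hab hH
  obtain ⟨χ, hχ, hχ₁, hχ₂⟩ := exists_density hm hab hV.measurable hVt hJm
  set ν := (dualMeasure m b).withDensity fun x => V x ^ b with hν
  have hνn : NullSingletonClass ν := by rw [hν, dualMeasure]; infer_instance
  have hνs : SFinite ν := by rw [hν, dualMeasure]; infer_instance
  have hAρ : (A ^ ρ) ^ (β / ρ) = A ^ β := by
    rw [← ENNReal.rpow_mul]
    congr 1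
    field_simp
  have hT₁ : ∫⁻ t, (∫⁻ x in Iio t, m (Iio x) ^ (-2 : ℝ) * (V x * J x) ∂m) ^ β ∂q
      ≤ C₁ * A ^ β * X ^ (β / a) := by
    calc ∫⁻ t, (∫⁻ x in Iio t, m (Iio x) ^ (-2 : ℝ) * (V x * J x) ∂m) ^ β ∂q
        ≤ ∫⁻ t, (∫⁻ x in Iio t, χ x ∂ν) ^ β ∂q :=
          lintegral_mono fun t => ENNReal.rpow_le_rpow (hχ₁ t) hβ0.le
      _ ≤ 2 ^ β * ENNReal.ofReal b ^ (β - 1) * (∫⁻ x, ν (Iio x) ^ (ρ * (β - 1) / β)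
            * q (Ioi x) ^ (ρ / β) ∂ν) ^ (β / ρ) * (∫⁻ x, χ x ^ a ∂ν) ^ (β / a) :=
          weighted_hardy_of_lt ν q hfin hab hβ hρ hρβ hχ
      _ ≤ 2 ^ β * ENNReal.ofReal b ^ (β - 1) * (A ^ ρ) ^ (β / ρ)
            * (ENNReal.ofReal (b - 1) ^ (1 - a) * (ENNReal.ofReal b ^ a * X)) ^ (β / a) := by
          gcongr
          exact hχ₂.trans (mul_le_mul_right hardyJ _)
      _ = _ := by
          rw [hAρ, ← mul_assoc (ENNReal.ofReal (b - 1) ^ (1 - a)),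
            ENNReal.mul_rpow_of_nonneg _ X (by positivity), hC₁]
          ring
  have hT₂ : ∫⁻ t, ((m (Iio t))⁻¹ * ∫⁻ s in Iio t, V s * m (Iio s) ∂h) ^ β ∂q
      ≤ C₂ * A ^ β * X ^ (β / a) := by
    have hloc := lintegral_local_part_le hm h0 q0 hβ.le hV.measurable hVΦ hVQ
    have hend := univ_term_le hm hab hβ0 hH hA₃
    have hmain : ∫⁻ x, m (Iio x) ^ (-1 - β) * (Φ x * J x) ^ β ∂m
        ≤ ENNReal.ofReal b ^ β * D ^ (β / ρ) * (A ^ β * X ^ (β / a)) := by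
      have hF : Measurable fun x => ((m (Iio x))⁻¹ * J x) ^ a := (hW.inv.mul hJm).pow_const _
      have hG : Measurable fun x => Φ x ^ ρ * m (Iio x) ^ (-(ρ / β)) :=
        (hΦ.pow_const _).mul (hW.pow_const _)
      calc ∫⁻ x, m (Iio x) ^ (-1 - β) * (Φ x * J x) ^ β ∂m
          = ∫⁻ x, (((m (Iio x))⁻¹ * J x) ^ a) ^ (β / a)
              * (Φ x ^ ρ * m (Iio x) ^ (-(ρ / β))) ^ (β / ρ) ∂m := by
            refine lintegral_congr_ae ?_
            filter_upwards [ae_measure_Iio_ne_zero m] with x hx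
            rw [ENNReal.mul_rpow_of_nonneg _ _ hβ0.le,
              ENNReal.mul_rpow_of_nonneg (Φ x ^ ρ) _ (by positivity), ← ENNReal.rpow_mul,
              ← ENNReal.rpow_mul, ← ENNReal.rpow_mul, show a * (β / a) = β by field_simp,
              show ρ * (β / ρ) = β by field_simp, show -(ρ / β) * (β / ρ) = -1 by field_simp,
              ENNReal.mul_rpow_of_nonneg _ _ hβ0.le, ENNReal.inv_rpow, ← ENNReal.rpow_neg,
              show -1 - β = -β + -1 by ring, ENNReal.rpow_add _ _ hx (hm.fin x)]
            ring
        _ ≤ (∫⁻ x, ((m (Iio x))⁻¹ * J x) ^ a ∂m) ^ (β / a)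
              * (∫⁻ x, Φ x ^ ρ * m (Iio x) ^ (-(ρ / β)) ∂m) ^ (β / ρ) :=
            ENNReal.lintegral_mul_norm_pow_le hF.aemeasurable hG.aemeasurable (by positivity)
              (by positivity) e4
        _ ≤ (ENNReal.ofReal b ^ a * X) ^ (β / a) * (D * A ^ ρ) ^ (β / ρ) := by
            gcongr
            exact lintegral_rpow_mul_neg_le hm hab hβ hρ hρβ hΦ hΦQ hA₁ hA₃
        _ = _ := by
            rw [ENNReal.mul_rpow_of_nonneg _ _ (by positivity),
              ENNReal.mul_rpow_of_nonneg _ _ (by positivity), hAρ, ← ENNReal.rpow_mul,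
              show a * (β / a) = β by field_simp]
            ring
    refine hloc.trans ?_
    calc 2 ^ β * (ENNReal.ofReal β * ∫⁻ x, m (Iio x) ^ (-1 - β) * (Φ x * J x) ^ β ∂m
          + m univ ^ (-β) * (Q * ∫⁻ y, h (Ioi y) ∂m) ^ β)
        ≤ 2 ^ β * (ENNReal.ofReal β * (ENNReal.ofReal b ^ β * D ^ (β / ρ)
            * (A ^ β * X ^ (β / a))) + A ^ β * X ^ (β / a)) := by gcongr
      _ = _ := by
          rw [hC₂]
          ring
  calc ∫⁻ t, (∫⁻ s in Iio t, V s ∂h) ^ β ∂q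
      ≤ ∫⁻ t, 2 ^ (β - 1) * ((∫⁻ x in Iio t, m (Iio x) ^ (-2 : ℝ) * (V x * J x) ∂m) ^ β
          + ((m (Iio t))⁻¹ * ∫⁻ s in Iio t, V s * m (Iio s) ∂h) ^ β) ∂q := by
        refine lintegral_mono fun t => ?_
        refine le_trans ?_ (ENNReal.rpow_add_le_mul_rpow_add_rpow _ _ hβ.le)
        gcongr
        exact lintegral_Iio_le_add hm h0 hV t
    _ ≤ 2 ^ (β - 1) * (C₁ * A ^ β * X ^ (β / a) + C₂ * A ^ β * X ^ (β / a)) := by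
        rw [lintegral_const_mul' _ _ (h2 _ hβ1.le),
          lintegral_add_left ((measurable_lintegral_Iio m _).pow_const _)]
        gcongr
    _ = _ := by ring

/-! ### Lower estimates for the integral operator -/

/-- The inequality `(∫ (∫_{(0,t]} V dh) ^ β dq) ^ (1/β) ≤ K (∫ h(t,∞) ^ a dm) ^ (1/a)` for all
measures `h` on `(0,∞)` for which the right-hand side is finite. -/
def OperatorBound (m q : Measure ℝ) (V : ℝ → ℝ≥0∞) (a β : ℝ) (K : ℝ≥0∞) : Prop :=
  ∀ h : Measure ℝ, h (Iic 0) = 0 → ∫⁻ t, h (Ioi t) ^ a ∂m ≠ ∞ →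
    ∫⁻ t, (∫⁻ s in Iic t, V s ∂h) ^ β ∂q ≤ K ^ β * (∫⁻ t, h (Ioi t) ^ a ∂m) ^ (β / a)

theorem rpow_one_sub_le_of_le_mul_rpow {I D : ℝ≥0∞} {θ : ℝ} (hθ1 : θ < 1)
    (hI : I ≠ ∞) (h : I ≤ D * I ^ θ) : I ^ (1 - θ) ≤ D := by
  rcases eq_or_ne I 0 with h0 | h0
  · rw [h0, ENNReal.zero_rpow_of_pos (by linarith)]
    exact zero_le
  calc I ^ (1 - θ) = I * I ^ (-θ) := by
        rw [show 1 - θ = 1 + -θ by ring, ENNReal.rpow_add _ _ h0 hI, ENNReal.rpow_one]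
    _ ≤ D * I ^ θ * I ^ (-θ) := by gcongr
    _ = D := by rw [mul_assoc, rpow_mul_rpow_cancel h0 hI (by ring), mul_one]

/-- Testing the operator on a point mass. -/
theorem OperatorBound.mul_rpow_le {m q : Measure ℝ} {V : ℝ → ℝ≥0∞} {a β : ℝ} {K : ℝ≥0∞}
    (hK : OperatorBound m q V a β K) (ha : 0 < a) (hβ : 0 < β) (hV : Measurable V)
    {x : ℝ} (hx : 0 < x) (hfin : m (Iio x) ≠ ∞) :
    V x * q (Ioi x) ^ β⁻¹ ≤ K * m (Iio x) ^ a⁻¹ := by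
  have h1 : ∫⁻ t, (Measure.dirac x) (Ioi t) ^ a ∂m = m (Iio x) := by
    rw [← lintegral_indicator_one measurableSet_Iio]
    refine lintegral_congr fun t => ?_
    rw [Measure.dirac_apply' _ measurableSet_Ioi]
    by_cases ht : t < x <;> simp [ht, ha]
  have h := hK (Measure.dirac x) (by simp [Measure.dirac_apply' _ measurableSet_Iic, hx])
    (by rwa [h1])
  rw [h1] at h
  have h2 : V x ^ β * q (Ioi x) ≤ K ^ β * m (Iio x) ^ (β / a) := by
    refine le_trans ?_ h
    rw [← setLIntegral_const]
    refine (setLIntegral_mono' measurableSet_Ioi fun t ht => ?_).trans (setLIntegral_le_lintegral _ _)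
    rw [setLIntegral_dirac' hV measurableSet_Iic, if_pos (mem_Iic.2 (mem_Ioi.1 ht).le)]
  rw [← ENNReal.rpow_le_rpow_iff hβ, ENNReal.mul_rpow_of_nonneg _ _ hβ.le,
    ENNReal.mul_rpow_of_nonneg _ _ hβ.le, ← ENNReal.rpow_mul, ← ENNReal.rpow_mul,
    inv_mul_cancel₀ hβ.ne', ENNReal.rpow_one, inv_mul_eq_div]
  exact h2

/-- Testing the operator on densities with respect to `ν = V ^ b dμ`: the dual Hardy inequality
turns the bound into a weighted Hardy inequality for `ν`. -/
theorem OperatorBound.weighted_hardy {m q : Measure ℝ} (hm : IsHalfLine m) {V : ℝ → ℝ≥0∞}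
    {a b β : ℝ} (hab : a.HolderConjugate b) (hβ : 0 < β) {K : ℝ≥0∞}
    (hK : OperatorBound m q V a β K) (hV : Measurable V) {G : ℝ → ℝ≥0∞} (hG : Measurable G)
    (hfin : ∫⁻ x, G x ^ a ∂((dualMeasure m b).withDensity fun x => V x ^ b) ≠ ∞) :
    ∫⁻ t, (∫⁻ s in Iic t, G s ∂((dualMeasure m b).withDensity fun x => V x ^ b)) ^ β ∂q
      ≤ K ^ β * (ENNReal.ofReal a ^ a * ENNReal.ofReal (b - 1) ^ (a - 1)
        * ∫⁻ x, G x ^ a ∂((dualMeasure m b).withDensity fun x => V x ^ b)) ^ (β / a) := by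
  have ha := hab.pos
  have hb1 : 0 < b - 1 := hab.symm.sub_one_pos
  set μ := dualMeasure m b with hμ
  have hη : Measurable fun x => V x ^ (b - 1) * G x := (hV.pow_const _).mul hG
  set h := μ.withDensity fun x => V x ^ (b - 1) * G x with hh
  have hexp : (b - 1) * a = b := by
    have := hab.mul_eq_add
    linarith
  have hpow : ∫⁻ x, (V x ^ (b - 1) * G x) ^ a ∂μ = ∫⁻ x, G x ^ a ∂(μ.withDensity fun x => V x ^ b) := by
    rw [lintegral_withDensity_eq_lintegral_mul _ (hV.pow_const b) (hG.pow_const a)]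
    refine lintegral_congr fun x => ?_
    rw [ENNReal.mul_rpow_of_nonneg _ _ ha.le, ← ENNReal.rpow_mul, hexp]
    rfl
  have htail : ∫⁻ t, h (Ioi t) ^ a ∂m ≤ ENNReal.ofReal a ^ a * ENNReal.ofReal (b - 1) ^ (a - 1)
        * ∫⁻ x, G x ^ a ∂(μ.withDensity fun x => V x ^ b) := by
    rw [← hpow]
    simp_rw [hh, withDensity_apply _ measurableSet_Ioi]
    exact hardy_dual_dualMeasure hm hab hη
  have hμ0 : μ (Iic 0) = 0 := withDensity_absolutelyContinuous m _ hm.Iic_zero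
  have h0 : h (Iic 0) = 0 := withDensity_absolutelyContinuous μ _ hμ0
  have hne : ∫⁻ t, h (Ioi t) ^ a ∂m ≠ ∞ := by
    refine ne_top_of_le_ne_top (ENNReal.mul_ne_top (ENNReal.mul_ne_top
      (ENNReal.rpow_ne_top_of_nonneg ha.le ENNReal.ofReal_ne_top)
      (ENNReal.rpow_ne_top_of_nonneg hab.sub_one_pos.le ENNReal.ofReal_ne_top)) hfin) htail
  have hmain := hK h h0 hne
  have hVG : ∀ t, ∫⁻ s in Iic t, V s ∂h
      = ∫⁻ s in Iic t, G s ∂(μ.withDensity fun x => V x ^ b) := fun t => by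
    rw [hh, setLIntegral_withDensity_eq_setLIntegral_mul μ hη hV measurableSet_Iic,
      setLIntegral_withDensity_eq_setLIntegral_mul μ (hV.pow_const b) hG measurableSet_Iic]
    refine lintegral_congr fun s => ?_
    simp only [Pi.mul_apply]
    have : V s ^ b = V s ^ (b - 1) * V s := by
      nth_rw 1 [show b = (b - 1) + 1 by ring]
      rw [ENNReal.rpow_add_of_nonneg _ _ hb1.le zero_le_one, ENNReal.rpow_one]
    rw [this]
    ring
  simp_rw [hVG] at hmain
  refine hmain.trans ?_
  gcongr

/-- The measure `ν = V ^ b dμ` is finite on bounded intervals away from the origin. -/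
theorem withDensity_Ioo_ne_top {m : Measure ℝ} (hm : IsHalfLine m) {b : ℝ} (hb : 1 < b)
    {V : ℝ → ℝ≥0∞} (hV : Monotone V) (hVt : ∀ x, V x ≠ ∞) {ε x : ℝ} (hε : 0 < ε) :
    ((dualMeasure m b).withDensity fun x => V x ^ b) (Ioo ε x) ≠ ∞ := by
  have hb0 : 0 ≤ b := by linarith
  rw [withDensity_apply _ measurableSet_Ioo]
  refine ne_top_of_le_ne_top (ENNReal.mul_ne_top (ENNReal.rpow_ne_top_of_nonneg hb0 (hVt x))
    (dualMeasure_Ioi_ne_top hm hb hε)) ?_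
  calc ∫⁻ y in Ioo ε x, V y ^ b ∂(dualMeasure m b)
      ≤ ∫⁻ _ in Ioo ε x, V x ^ b ∂(dualMeasure m b) := by
        refine setLIntegral_mono' measurableSet_Ioo fun y hy => ?_
        have := hV hy.2.le
        gcongr
    _ ≤ _ := by
        rw [setLIntegral_const]
        gcongr
        exact Ioo_subset_Ioi_self

theorem withDensity_Iio_eq_iSup {m : Measure ℝ} (hm : IsHalfLine m) {b : ℝ}
    {V : ℝ → ℝ≥0∞} (x : ℝ) :
    ((dualMeasure m b).withDensity fun x => V x ^ b) (Iio x)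
      = ⨆ n : ℕ, ((dualMeasure m b).withDensity fun x => V x ^ b) (Ioo ((n : ℝ) + 1)⁻¹ x) := by
  set ν := (dualMeasure m b).withDensity fun x => V x ^ b with hν
  have hν0 : ν (Iic 0) = 0 :=
    withDensity_absolutelyContinuous _ _ (withDensity_absolutelyContinuous m _ hm.Iic_zero)
  have hU : Ioo 0 x = ⋃ n : ℕ, Ioo ((n : ℝ) + 1)⁻¹ x := by
    ext y
    simp only [mem_Ioo, mem_iUnion]
    constructor
    · rintro ⟨h0, hy⟩
      obtain ⟨n, hn⟩ := exists_nat_one_div_lt h0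
      exact ⟨n, by rwa [one_div] at hn, hy⟩
    · rintro ⟨n, hn, hy⟩
      exact ⟨lt_trans (by positivity) hn, hy⟩
  have hmono : Monotone fun n : ℕ => Ioo ((n : ℝ) + 1)⁻¹ x := fun i j hij => by
    refine Ioo_subset_Ioo_left ?_
    gcongr
  rw [← hmono.measure_iUnion, ← hU]
  refine le_antisymm ?_ (measure_mono fun y hy => hy.2)
  calc ν (Iio x) ≤ ν (Iic 0 ∪ Ioo 0 x) := measure_mono fun y hy => by
        rcases le_or_gt y 0 with h | h
        · exact Or.inl h
        · exact Or.inr ⟨h, hy⟩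
    _ ≤ ν (Iic 0) + ν (Ioo 0 x) := measure_union_le _ _
    _ = ν (Ioo 0 x) := by rw [hν0, zero_add]

/-- Testing the operator on the density `V ^ (b - 1)` on `(0,x)`; the truncation away from `0` keeps
the right-hand side finite. -/
theorem OperatorBound.measure_rpow_le {m q : Measure ℝ} (hm : IsHalfLine m) {V : ℝ → ℝ≥0∞}
    {a b β : ℝ} (hab : a.HolderConjugate b) (hβ : 0 < β) {K : ℝ≥0∞}
    (hK : OperatorBound m q V a β K) (hV : Monotone V) (hVt : ∀ x, V x ≠ ∞) (x : ℝ) :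
    ((dualMeasure m b).withDensity fun x => V x ^ b) (Iio x) ^ b⁻¹ * q (Ioi x) ^ β⁻¹
      ≤ (ENNReal.ofReal a ^ a * ENNReal.ofReal (b - 1) ^ (a - 1)) ^ a⁻¹ * K := by
  have ha := hab.pos
  have hb := hab.symm.pos
  have hinv : b⁻¹ = 1 - a⁻¹ := hab.one_sub_inv.symm
  set D := ENNReal.ofReal a ^ a * ENNReal.ofReal (b - 1) ^ (a - 1) with hD
  rw [withDensity_Iio_eq_iSup hm x]
  set ν := (dualMeasure m b).withDensity fun x => V x ^ b with hν
  have hsup : (⨆ n : ℕ, ν (Ioo ((n : ℝ) + 1)⁻¹ x)) ^ b⁻¹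
      = ⨆ n : ℕ, ν (Ioo ((n : ℝ) + 1)⁻¹ x) ^ b⁻¹ :=
    (ENNReal.orderIsoRpow b⁻¹ (by positivity)).map_iSup _
  rw [hsup, ENNReal.iSup_mul]
  refine iSup_le fun n => ?_
  set ε : ℝ := ((n : ℝ) + 1)⁻¹ with hε
  have hε0 : 0 < ε := by positivity
  have hN : ν (Ioo ε x) ≠ ∞ := withDensity_Ioo_ne_top hm hab.symm.lt hV hVt hε0
  rcases eq_or_ne (ν (Ioo ε x)) 0 with h0 | h0
  · rw [h0, ENNReal.zero_rpow_of_pos (by positivity), zero_mul]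
    exact zero_le
  have hG : ∫⁻ y, (Ioo ε x).indicator (1 : ℝ → ℝ≥0∞) y ^ a ∂ν = ν (Ioo ε x) := by
    rw [← lintegral_indicator_one measurableSet_Ioo]
    refine lintegral_congr fun y => ?_
    by_cases hy : y ∈ Ioo ε x <;> simp [hy, ha]
  have h := hK.weighted_hardy hm hab hβ hV.measurable
    (measurable_one.indicator (measurableSet_Ioo (a := ε) (b := x))) (by rw [hG]; exact hN)
  rw [← hν, hG, ← hD] at h
  have h2 : ν (Ioo ε x) ^ β * q (Ioi x) ≤ K ^ β * (D * ν (Ioo ε x)) ^ (β / a) := by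
    refine le_trans ?_ h
    rw [← setLIntegral_const]
    refine (setLIntegral_mono' measurableSet_Ioi fun t ht => ?_).trans (setLIntegral_le_lintegral _ _)
    rw [lintegral_indicator_one measurableSet_Ioo, Measure.restrict_apply measurableSet_Ioo,
      inter_eq_left.2 fun y hy => hy.2.le.trans (le_of_lt ht)]
  rw [← ENNReal.rpow_le_rpow_iff hβ, ENNReal.mul_rpow_of_nonneg _ _ hβ.le,
    ENNReal.mul_rpow_of_nonneg _ _ hβ.le, ← ENNReal.rpow_mul, ← ENNReal.rpow_mul,
    ← ENNReal.rpow_mul, inv_mul_cancel₀ hβ.ne', ENNReal.rpow_one]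
  calc ν (Ioo ε x) ^ (b⁻¹ * β) * q (Ioi x)
      = (ν (Ioo ε x) ^ β * q (Ioi x)) * ν (Ioo ε x) ^ (-(β / a)) := by
        rw [show b⁻¹ * β = β + -(β / a) by rw [hinv]; ring, ENNReal.rpow_add _ _ h0 hN]
        ring
    _ ≤ K ^ β * (D * ν (Ioo ε x)) ^ (β / a) * ν (Ioo ε x) ^ (-(β / a)) := by gcongr
    _ = D ^ (β / a) * K ^ β * (ν (Ioo ε x) ^ (β / a) * ν (Ioo ε x) ^ (-(β / a))) := by
        rw [ENNReal.mul_rpow_of_nonneg _ _ (by positivity)]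
        ring
    _ = _ := by
        rw [rpow_mul_rpow_cancel h0 hN (by ring), mul_one, inv_mul_eq_div]

/-- Lower bound for the Hardy operator at the extremal function of the range `β < a`. -/
theorem extremal_lower (l q : Measure ℝ) [NullSingletonClass l] [SFinite l]
    [NullSingletonClass q] [SFinite q] {a b β ρ : ℝ} (hab : a.HolderConjugate b) (hβ : 1 < β)
    (hρ : 0 < ρ) (hρβ : ρ⁻¹ = β⁻¹ - a⁻¹) :
    ∫⁻ x, l (Iio x) ^ (ρ * (β - 1) / β) * q (Ioi x) ^ (ρ / β) ∂l
      ≤ 2 ^ (ρ / b) * 2 ^ (ρ / β) * ∫⁻ t, (∫⁻ s in Iic t,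
        l (Iio s) ^ (ρ * (β - 1) / β / a) * q (Ioi s) ^ (ρ / β / a) ∂l) ^ β ∂q := by
  have ha := hab.pos
  have hb := hab.symm.pos
  have hβ0 : 0 < β := by linarith
  have hβ1 : 0 < β - 1 := by linarith
  obtain ⟨e1, e2, -, e4⟩ := exponent_relations hab hβ hρ hρβ
  set κ := ρ * (β - 1) / β with hκ
  have hκ0 : 0 ≤ κ := by positivity
  have hN := measurable_measure_Iio l
  have hU := measurable_measure_Ioi q
  have e5 : 1 + ρ / a = ρ / β := by
    have : ρ * (β / a + β / ρ) = ρ := by rw [e4, mul_one]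
    field_simp at this ⊢
    linarith
  have hpt : ∀ t, q (Ioi t) ^ (ρ / a) * ∫⁻ s in Iio t, l (Iio s) ^ κ ∂l
      ≤ 2 ^ (ρ / b) * (∫⁻ s in Iic t, l (Iio s) ^ (κ / a) * q (Ioi s) ^ (ρ / β / a) ∂l) ^ β := by
    intro t
    have h1 : l (Iio t) ^ (1 + κ / a) * q (Ioi t) ^ (ρ / β / a) ≤ 2 ^ (1 + κ / a)
        * ∫⁻ s in Iic t, l (Iio s) ^ (κ / a) * q (Ioi s) ^ (ρ / β / a) ∂l := by
      calc l (Iio t) ^ (1 + κ / a) * q (Ioi t) ^ (ρ / β / a)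
          ≤ 2 ^ (1 + κ / a) * (∫⁻ s in Iio t, l (Iio s) ^ (κ / a) ∂l)
              * q (Ioi t) ^ (ρ / β / a) := by
            gcongr
            exact measure_Iio_rpow_le l (by positivity) t
        _ = 2 ^ (1 + κ / a) * ∫⁻ s in Iio t, l (Iio s) ^ (κ / a) * q (Ioi t) ^ (ρ / β / a) ∂l := by
            rw [lintegral_mul_const _ (hN.pow_const _), mul_assoc]
        _ ≤ 2 ^ (1 + κ / a) * ∫⁻ s in Iio t, l (Iio s) ^ (κ / a) * q (Ioi s) ^ (ρ / β / a) ∂l := by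
            refine mul_le_mul_right (setLIntegral_mono' measurableSet_Iio fun s hs => ?_) _
            have : q (Ioi t) ≤ q (Ioi s) := measure_mono (Ioi_subset_Ioi (le_of_lt hs))
            gcongr
        _ ≤ _ := mul_le_mul_right (lintegral_mono_set Iio_subset_Iic_self) _
    calc q (Ioi t) ^ (ρ / a) * ∫⁻ s in Iio t, l (Iio s) ^ κ ∂l
        ≤ q (Ioi t) ^ (ρ / a) * ∫⁻ s in Iio t, l (Iio t) ^ κ ∂l := by
          refine mul_le_mul_right (setLIntegral_mono' measurableSet_Iio fun s hs => ?_) _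
          have : l (Iio s) ≤ l (Iio t) := measure_mono (Iio_subset_Iio (le_of_lt hs))
          gcongr
      _ = (l (Iio t) ^ (1 + κ / a) * q (Ioi t) ^ (ρ / β / a)) ^ β := by
          rw [setLIntegral_const, ENNReal.mul_rpow_of_nonneg _ _ hβ0.le, ← ENNReal.rpow_mul,
            ← ENNReal.rpow_mul, show ρ / β / a * β = ρ / a by field_simp, e2,
            show ρ / b / β * β = ρ / b by field_simp, ← e1, add_comm 1 κ,
            ENNReal.rpow_add_of_nonneg _ _ hκ0 zero_le_one, ENNReal.rpow_one, mul_comm]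
      _ ≤ (2 ^ (1 + κ / a) * ∫⁻ s in Iic t, l (Iio s) ^ (κ / a)
            * q (Ioi s) ^ (ρ / β / a) ∂l) ^ β := by gcongr
      _ = _ := by
          rw [ENNReal.mul_rpow_of_nonneg _ _ hβ0.le, ← ENNReal.rpow_mul, e2,
            show ρ / b / β * β = ρ / b by field_simp]
  calc ∫⁻ x, l (Iio x) ^ κ * q (Ioi x) ^ (ρ / β) ∂l
      ≤ ∫⁻ x, 2 ^ (ρ / β) * (l (Iio x) ^ κ * ∫⁻ t in Ioi x, q (Ioi t) ^ (ρ / a) ∂q) ∂l := by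
        refine lintegral_mono fun x => ?_
        rw [mul_left_comm, ← e5]
        gcongr
        exact measure_Ioi_rpow_le q (by positivity) x
    _ = 2 ^ (ρ / β) * ∫⁻ t, q (Ioi t) ^ (ρ / a) * ∫⁻ s in Iio t, l (Iio s) ^ κ ∂l ∂q := by
        rw [lintegral_const_mul' _ _ (ENNReal.rpow_ne_top_of_nonneg (by positivity) (by simp)),
          lintegral_mul_lintegral_Iio q l (hU.pow_const _) (hN.pow_const _)]
    _ ≤ 2 ^ (ρ / β) * ∫⁻ t, 2 ^ (ρ / b) * (∫⁻ s in Iic t, l (Iio s) ^ (κ / a)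
          * q (Ioi s) ^ (ρ / β / a) ∂l) ^ β ∂q :=
        mul_le_mul_right (lintegral_mono hpt) _
    _ = _ := by
        rw [lintegral_const_mul' _ _ (ENNReal.rpow_ne_top_of_nonneg (by positivity) (by simp))]
        ring

/-- The necessity of the second integral condition in the range `β < a`. -/
theorem OperatorBound.lintegral_measure_rpow_le {a b β ρ : ℝ} (hab : a.HolderConjugate b)
    (hβ : 1 < β) (hρ : 0 < ρ) (hρβ : ρ⁻¹ = β⁻¹ - a⁻¹) :
    ∃ C : ℝ≥0, ∀ (m q : Measure ℝ) (V : ℝ → ℝ≥0∞) (K : ℝ≥0∞), IsHalfLine m →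
      NullSingletonClass q → SFinite q → (∀ x, 0 < x → q (Ioi x) ≠ ∞) →
      OperatorBound m q V a β K → Monotone V → (∀ x, V x ≠ ∞) →
      ∫⁻ x, ((dualMeasure m b).withDensity fun x => V x ^ b) (Iio x) ^ (ρ * (β - 1) / β)
          * q (Ioi x) ^ (ρ / β) ∂((dualMeasure m b).withDensity fun x => V x ^ b)
        ≤ C * K ^ ρ := by
  have ha := hab.pos
  have hb := hab.symm.pos
  have hβ0 : 0 < β := by linarith
  have hβ1 : 0 < β - 1 := by linarith
  have hb1 : 0 < b - 1 := hab.symm.sub_one_pos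
  obtain ⟨e1, e2, -, e4⟩ := exponent_relations hab hβ hρ hρβ
  set κ := ρ * (β - 1) / β with hκ
  have hκ0 : 0 ≤ κ := by positivity
  set D := ENNReal.ofReal a ^ a * ENNReal.ofReal (b - 1) ^ (a - 1) with hD
  have hDt : D ≠ ∞ := ENNReal.mul_ne_top
    (ENNReal.rpow_ne_top_of_nonneg ha.le ENNReal.ofReal_ne_top)
    (ENNReal.rpow_ne_top_of_nonneg hab.sub_one_pos.le ENNReal.ofReal_ne_top)
  set C₀ : ℝ≥0∞ := 2 ^ (ρ / b) * 2 ^ (ρ / β) * D ^ (β / a) with hC₀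
  have h2 : ∀ e : ℝ, 0 ≤ e → (2 : ℝ≥0∞) ^ e ≠ ∞ := fun e he =>
    ENNReal.rpow_ne_top_of_nonneg he (by simp)
  have hC₀t : C₀ ≠ ∞ := ENNReal.mul_ne_top (ENNReal.mul_ne_top (h2 _ (by positivity))
    (h2 _ (by positivity))) (ENNReal.rpow_ne_top_of_nonneg (by positivity) hDt)
  refine ⟨(C₀ ^ (ρ / β)).toNNReal, ?_⟩
  rw [ENNReal.coe_toNNReal (ENNReal.rpow_ne_top_of_nonneg (by positivity) hC₀t)]
  intro m q V K hm _ _ hq hK hV hVt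
  have := hm.null
  have := hm.sfinite
  set ν := (dualMeasure m b).withDensity fun x => V x ^ b with hν
  have hνn : NullSingletonClass ν := by rw [hν, dualMeasure]; infer_instance
  have hνs : SFinite ν := by rw [hν, dualMeasure]; infer_instance
  have hU := measurable_measure_Ioi q
  set S : ℕ → Set ℝ := fun n => Ioo ((n : ℝ) + 1)⁻¹ n with hS
  have hSm : ∀ n, MeasurableSet (S n) := fun n => measurableSet_Ioo
  have hSmono : Monotone S := fun i j hij => by
    refine Ioo_subset_Ioo ?_ (by exact_mod_cast hij)
    gcongr
  -- the estimate for the truncated measures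
  have htrunc : ∀ n, ∫⁻ x in S n, (ν.restrict (S n)) (Iio x) ^ κ * q (Ioi x) ^ (ρ / β) ∂ν
      ≤ C₀ ^ (ρ / β) * K ^ ρ := by
    intro n
    have hε : (0 : ℝ) < ((n : ℝ) + 1)⁻¹ := by positivity
    set l := ν.restrict (S n) with hl
    have hN := measurable_measure_Iio l
    have hνS : ν (S n) ≠ ∞ := withDensity_Ioo_ne_top hm hab.symm.lt hV hVt hε
    set I := ∫⁻ x, l (Iio x) ^ κ * q (Ioi x) ^ (ρ / β) ∂l with hI
    have hIt : I ≠ ∞ := by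
      refine ne_top_of_le_ne_top (b := ν (S n) ^ κ * q (Ioi ((n : ℝ) + 1)⁻¹) ^ (ρ / β) * ν (S n))
        (ENNReal.mul_ne_top (ENNReal.mul_ne_top (ENNReal.rpow_ne_top_of_nonneg hκ0 hνS)
          (ENNReal.rpow_ne_top_of_nonneg (by positivity) (hq _ hε))) hνS) ?_
      rw [← setLIntegral_const]
      refine setLIntegral_mono' (hSm n) fun x hx => ?_
      have h3 : l (Iio x) ≤ ν (S n) := by
        rw [hl, Measure.restrict_apply measurableSet_Iio]
        exact measure_mono inter_subset_right
      have h4 : q (Ioi x) ≤ q (Ioi ((n : ℝ) + 1)⁻¹) := measure_mono (Ioi_subset_Ioi hx.1.le)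
      gcongr
    have hGm : Measurable fun x => l (Iio x) ^ (κ / a) * q (Ioi x) ^ (ρ / β / a) :=
      (hN.pow_const _).mul (hU.pow_const _)
    have hGa : ∫⁻ x, (S n).indicator (fun x => l (Iio x) ^ (κ / a) * q (Ioi x) ^ (ρ / β / a)) x ^ a
        ∂ν = I := by
      rw [hI, ← lintegral_indicator (hSm n)]
      refine lintegral_congr fun x => ?_
      by_cases hx : x ∈ S n
      · rw [indicator_of_mem hx, indicator_of_mem hx, ENNReal.mul_rpow_of_nonneg _ _ ha.le,
          ← ENNReal.rpow_mul, ← ENNReal.rpow_mul, div_mul_cancel₀ _ ha.ne',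
          div_mul_cancel₀ _ ha.ne']
      · simp [hx, ha]
    have h5 := hK.weighted_hardy hm hab hβ0 hV.measurable (hGm.indicator (hSm n))
      (by rw [hGa]; exact hIt)
    rw [← hν, hGa, ← hD] at h5
    have h6 : ∀ t, ∫⁻ s in Iic t, (S n).indicator (fun x => l (Iio x) ^ (κ / a)
        * q (Ioi x) ^ (ρ / β / a)) s ∂ν
        = ∫⁻ s in Iic t, l (Iio s) ^ (κ / a) * q (Ioi s) ^ (ρ / β / a) ∂l := fun t => by
      rw [lintegral_indicator (hSm n), hl, Measure.restrict_restrict (hSm n),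
        Measure.restrict_restrict measurableSet_Iic, inter_comm]
    simp_rw [h6] at h5
    have h7 : I ≤ C₀ * K ^ β * I ^ (β / a) := by
      calc I ≤ 2 ^ (ρ / b) * 2 ^ (ρ / β) * ∫⁻ t, (∫⁻ s in Iic t,
            l (Iio s) ^ (κ / a) * q (Ioi s) ^ (ρ / β / a) ∂l) ^ β ∂q :=
            extremal_lower l q hab hβ hρ hρβ
        _ ≤ 2 ^ (ρ / b) * 2 ^ (ρ / β) * (K ^ β * (D * I) ^ (β / a)) := by gcongr
        _ = _ := by
            rw [ENNReal.mul_rpow_of_nonneg _ _ (by positivity), hC₀]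
            ring
    have h8 := rpow_one_sub_le_of_le_mul_rpow
      (by have : 0 < β / ρ := by positivity
          linarith) hIt h7
    rw [show 1 - β / a = β / ρ by linarith] at h8
    calc I = (I ^ (β / ρ)) ^ (ρ / β) := by
          rw [← ENNReal.rpow_mul, show β / ρ * (ρ / β) = 1 by field_simp, ENNReal.rpow_one]
      _ ≤ (C₀ * K ^ β) ^ (ρ / β) := by gcongr
      _ = _ := by
          rw [ENNReal.mul_rpow_of_nonneg _ _ (by positivity), ← ENNReal.rpow_mul,
            show β * (ρ / β) = ρ by field_simp]
  -- passage to the limit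
  have hν0 : ν (Iic 0) = 0 :=
    withDensity_absolutelyContinuous _ _ (withDensity_absolutelyContinuous m _ hm.Iic_zero)
  set f : ℕ → ℝ → ℝ≥0∞ := fun n => (S n).indicator
    fun x => (ν.restrict (S n)) (Iio x) ^ κ * q (Ioi x) ^ (ρ / β) with hf
  have hfm : ∀ n, Measurable (f n) := fun n =>
    (((measurable_measure_Iio _).pow_const _).mul (hU.pow_const _)).indicator (hSm n)
  have hlim : ∀ᵐ x ∂ν, Tendsto (fun n => f n x) atTop
      (𝓝 (ν (Iio x) ^ κ * q (Ioi x) ^ (ρ / β))) := by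
    filter_upwards [ae_pos_of_Iic_zero hν0] with x hx
    have hmem : ∀ᶠ n : ℕ in atTop, x ∈ S n := by
      obtain ⟨i, hi⟩ := exists_nat_one_div_lt hx
      obtain ⟨j, hj⟩ := exists_nat_gt x
      filter_upwards [eventually_ge_atTop (max i j)] with n hn
      refine ⟨lt_of_le_of_lt ?_ hi, hj.trans_le ?_⟩
      · rw [one_div]
        have : (i : ℝ) ≤ n := by exact_mod_cast (le_max_left i j).trans hn
        gcongr
      · exact_mod_cast (le_max_right i j).trans hn
    have hmeas : Tendsto (fun n => (ν.restrict (S n)) (Iio x)) atTop (𝓝 (ν (Iio x))) := by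
      have h9 : ∀ n, (ν.restrict (S n)) (Iio x) = ν (S n ∩ Iio x) := fun n => by
        rw [Measure.restrict_apply measurableSet_Iio, inter_comm]
      simp_rw [h9]
      have hmono : Monotone fun n => S n ∩ Iio x :=
        fun i j hij => inter_subset_inter_left _ (hSmono hij)
      have h10 : ν (⋃ n, S n ∩ Iio x) = ν (Iio x) := by
        refine le_antisymm (measure_mono (iUnion_subset fun n => inter_subset_right)) ?_
        calc ν (Iio x) ≤ ν (Iic 0 ∪ ⋃ n, S n ∩ Iio x) := measure_mono fun y hy => by
              rcases le_or_gt y 0 with h | h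
              · exact Or.inl h
              · right
                obtain ⟨i, hi⟩ := exists_nat_one_div_lt h
                obtain ⟨j, hj⟩ := exists_nat_gt y
                refine mem_iUnion.2 ⟨max i j, ⟨lt_of_le_of_lt ?_ hi, hj.trans_le ?_⟩, hy⟩
                · rw [one_div]
                  have : (i : ℝ) ≤ (max i j : ℕ) := by exact_mod_cast le_max_left i j
                  gcongr
                · exact_mod_cast le_max_right i j
          _ ≤ ν (Iic 0) + ν (⋃ n, S n ∩ Iio x) := measure_union_le _ _
          _ = _ := by rw [hν0, zero_add]
      rw [← h10]
      exact tendsto_measure_iUnion_atTop hmono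
    have h11 : Tendsto (fun n => (ν.restrict (S n)) (Iio x) ^ κ * q (Ioi x) ^ (ρ / β)) atTop
        (𝓝 (ν (Iio x) ^ κ * q (Ioi x) ^ (ρ / β))) :=
      ENNReal.Tendsto.mul_const ((ENNReal.continuous_rpow_const.tendsto _).comp hmeas)
        (Or.inr (ENNReal.rpow_ne_top_of_nonneg (by positivity) (hq x hx)))
    refine h11.congr' ?_
    filter_upwards [hmem] with n hn
    rw [hf]
    simp only [indicator_of_mem hn]
  calc ∫⁻ x, ν (Iio x) ^ κ * q (Ioi x) ^ (ρ / β) ∂ν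
      = ∫⁻ x, liminf (fun n => f n x) atTop ∂ν := by
        refine lintegral_congr_ae ?_
        filter_upwards [hlim] with x hx
        exact hx.liminf_eq.symm
    _ ≤ liminf (fun n => ∫⁻ x, f n x ∂ν) atTop := lintegral_liminf_le hfm
    _ ≤ liminf (fun _ : ℕ => C₀ ^ (ρ / β) * K ^ ρ) atTop := by
        refine liminf_le_liminf (Eventually.of_forall fun n => ?_)
        rw [hf]
        simp only
        rw [lintegral_indicator (hSm n)]
        exact htrunc n
    _ = _ := liminf_const _

/-! ### Dyadic sums of point masses -/

/-- The dyadic sum `∑_{2^k < y} 2^(ks)`, comparable to `y ^ s`. -/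
def dyadicSum (s : ℝ) (y : ℝ≥0∞) : ℝ≥0∞ :=
  ∑' k : ℤ, if (2 : ℝ≥0∞) ^ (k : ℝ) < y then (2 : ℝ≥0∞) ^ ((k : ℝ) * s) else 0

theorem exists_dyadic {y : ℝ≥0∞} (h0 : y ≠ 0) (ht : y ≠ ∞) :
    ∃ n : ℤ, (2 : ℝ≥0∞) ^ (n : ℝ) < y ∧ y ≤ (2 : ℝ≥0∞) ^ ((n : ℝ) + 1) := by
  obtain ⟨n, hn⟩ := ENNReal.exists_mem_Ioc_zpow h0 ht (y := 2) (by norm_num) (by simp)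
  refine ⟨n, ?_, ?_⟩
  · rw [ENNReal.rpow_intCast]
    exact hn.1
  · have := hn.2
    rw [← ENNReal.rpow_intCast] at this
    push_cast at this
    exact this

theorem rpow_le_dyadicSum {s : ℝ} (hs : 0 < s) {y : ℝ≥0∞} (ht : y ≠ ∞) :
    y ^ s ≤ 2 ^ s * dyadicSum s y := by
  rcases eq_or_ne y 0 with h0 | h0
  · rw [h0, ENNReal.zero_rpow_of_pos hs]
    exact zero_le
  obtain ⟨n, hn, hn'⟩ := exists_dyadic h0 ht
  calc y ^ s ≤ ((2 : ℝ≥0∞) ^ ((n : ℝ) + 1)) ^ s := by gcongr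
    _ = 2 ^ s * (if (2 : ℝ≥0∞) ^ (n : ℝ) < y then (2 : ℝ≥0∞) ^ ((n : ℝ) * s) else 0) := by
        rw [if_pos hn, ← ENNReal.rpow_mul, ← ENNReal.rpow_add _ _ (by simp) (by simp)]
        congr 1
        ring
    _ ≤ _ := by
        gcongr
        exact ENNReal.le_tsum n

theorem dyadicSum_le {s : ℝ} {y : ℝ≥0∞} (hs : 0 < s) (ht : y ≠ ∞) :
    dyadicSum s y ≤ (1 - 2 ^ (-s))⁻¹ * y ^ s := by
  rcases eq_or_ne y 0 with h0 | h0
  · simp [dyadicSum, h0]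
  obtain ⟨n, hn, hn'⟩ := exists_dyadic h0 ht
  have hle : ∀ k : ℤ, (2 : ℝ≥0∞) ^ (k : ℝ) < y → k ≤ n := fun k hk => by
    by_contra hcon
    have h1 : (n : ℝ) + 1 ≤ k := by exact_mod_cast not_le.1 hcon
    have h2 : (2 : ℝ≥0∞) ^ ((n : ℝ) + 1) ≤ 2 ^ (k : ℝ) :=
      ENNReal.rpow_le_rpow_of_exponent_le (by norm_num) h1
    exact absurd (hk.trans_le (hn'.trans h2)) (lt_irrefl _)
  have hinj : Function.Injective fun j : ℕ => n - (j : ℤ) := fun i j h => by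
    simpa using h
  have hsupp : Function.support (fun k : ℤ =>
      if (2 : ℝ≥0∞) ^ (k : ℝ) < y then (2 : ℝ≥0∞) ^ ((k : ℝ) * s) else 0)
      ⊆ range fun j : ℕ => n - (j : ℤ) := fun k hk => by
    have h1 : (2 : ℝ≥0∞) ^ (k : ℝ) < y := by
      by_contra hcon
      exact hk (if_neg hcon)
    have h2 := hle k h1
    exact ⟨(n - k).toNat, by simp only; omega⟩
  rw [dyadicSum, ← hinj.tsum_eq hsupp]
  calc ∑' j : ℕ, (if (2 : ℝ≥0∞) ^ (((n - (j : ℤ) : ℤ)) : ℝ) < y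
          then (2 : ℝ≥0∞) ^ (((n - (j : ℤ) : ℤ) : ℝ) * s) else 0)
      ≤ ∑' j : ℕ, (2 : ℝ≥0∞) ^ ((n : ℝ) * s) * ((2 : ℝ≥0∞) ^ (-s)) ^ j := by
        refine ENNReal.tsum_le_tsum fun j => ?_
        have h1 : (2 : ℝ≥0∞) ^ (((n - (j : ℤ) : ℤ) : ℝ) * s)
            = (2 : ℝ≥0∞) ^ ((n : ℝ) * s) * ((2 : ℝ≥0∞) ^ (-s)) ^ j := by
          rw [← ENNReal.rpow_natCast, ← ENNReal.rpow_mul, ← ENNReal.rpow_add _ _ (by simp) (by simp)]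
          congr 1
          push_cast
          ring
        split_ifs
        · exact h1.le
        · exact zero_le
    _ = (1 - 2 ^ (-s))⁻¹ * ((2 : ℝ≥0∞) ^ (n : ℝ)) ^ s := by
        rw [ENNReal.tsum_mul_left, ENNReal.tsum_geometric, ← ENNReal.rpow_mul, mul_comm]
    _ ≤ _ := by gcongr

/-- Superadditivity of `x ↦ x ^ β` on `[0,∞]`. -/
theorem tsum_rpow_le_rpow_tsum {ι : Type*} (f : ι → ℝ≥0∞) {β : ℝ} (hβ : 1 ≤ β) :
    ∑' i, f i ^ β ≤ (∑' i, f i) ^ β := by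
  have h1 : 0 ≤ β - 1 := by linarith
  set S := ∑' i, f i with hS
  calc ∑' i, f i ^ β = ∑' i, f i ^ (β - 1) * f i := by
        refine tsum_congr fun i => ?_
        nth_rw 3 [← ENNReal.rpow_one (f i)]
        rw [← ENNReal.rpow_add_of_nonneg _ _ h1 zero_le_one, sub_add_cancel]
    _ ≤ ∑' i, S ^ (β - 1) * f i := by
        refine ENNReal.tsum_le_tsum fun i => ?_
        gcongr
        exact ENNReal.le_tsum i
    _ = S ^ (β - 1) * S ^ (1 : ℝ) := by rw [ENNReal.tsum_mul_left, ENNReal.rpow_one]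
    _ = S ^ β := by rw [← ENNReal.rpow_add_of_nonneg _ _ h1 zero_le_one, sub_add_cancel]

/-- The supremum of `f τ` over the points `τ ≤ x` of a finite set. -/
def finsetSup (F : Finset ℝ) (f : ℝ → ℝ≥0∞) (x : ℝ) : ℝ≥0∞ :=
  F.sup fun τ => if τ ≤ x then f τ else 0

theorem finsetSup_mono (F : Finset ℝ) (f : ℝ → ℝ≥0∞) : Monotone (finsetSup F f) := by
  intro x y hxy
  refine Finset.sup_mono_fun fun τ _ => ?_
  split_ifs with h1 h2 h2
  · exact le_rfl
  · exact absurd (h1.trans hxy) h2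
  · exact zero_le
  · exact le_rfl

/-- The superlevel sets of `finsetSup` are closed half-lines whose endpoints belong to the finite
set and realize the level. -/
theorem setOf_lt_finsetSup (F : Finset ℝ) (f : ℝ → ℝ≥0∞) (c : ℝ≥0∞) :
    {x | c < finsetSup F f x} = ∅ ∨ ∃ τ ∈ F, c < f τ ∧ {x | c < finsetSup F f x} = Ici τ := by
  classical
  have hiff : ∀ x, c < finsetSup F f x ↔ ∃ τ ∈ F, τ ≤ x ∧ c < f τ := fun x => by
    rw [finsetSup, Finset.lt_sup_iff]
    refine exists_congr fun τ => and_congr_right fun _ => ?_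
    split_ifs with h
    · simp [h]
    · simp [h]
  set G := F.filter fun τ => c < f τ with hG
  rcases G.eq_empty_or_nonempty with h | h
  · left
    ext x
    simp only [mem_ofPred_eq, mem_empty_iff_false, iff_false, hiff]
    rintro ⟨τ, hτ, -, hc⟩
    have : τ ∈ G := Finset.mem_filter.2 ⟨hτ, hc⟩
    simp [h] at this
  · right
    have hmin := Finset.mem_filter.1 (G.min'_mem h)
    refine ⟨G.min' h, hmin.1, hmin.2, ?_⟩
    ext x
    simp only [mem_ofPred_eq, mem_Ici, hiff]
    constructor
    · rintro ⟨τ, hτ, hτx, hc⟩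
      exact (G.min'_le τ (Finset.mem_filter.2 ⟨hτ, hc⟩)).trans hτx
    · intro hx
      exact ⟨_, hmin.1, hx, hmin.2⟩

/-- The necessity of the first integral condition in the range `β < a`, for suprema over finite
sets: at each dyadic level `2 ^ k` of the supremum the operator is tested on a point mass at the
left endpoint of the superlevel set. -/
theorem OperatorBound.lintegral_finsetSup_le {a b β ρ : ℝ} (hab : a.HolderConjugate b)
    (hβ : 1 < β) (hρ : 0 < ρ) (hρβ : ρ⁻¹ = β⁻¹ - a⁻¹) :
    ∃ C : ℝ≥0, ∀ (m q : Measure ℝ) (V : ℝ → ℝ≥0∞) (K : ℝ≥0∞) (F : Finset ℝ), IsHalfLine m →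
      NullSingletonClass q → (∀ x, 0 < x → q (Ioi x) ≠ ∞) →
      OperatorBound m q V a β K → Measurable V → (∀ x, V x ≠ ∞) → (∀ τ ∈ F, 0 < τ) →
      ∫⁻ x, dualMeasure m b (Ioi x) ^ (ρ * (β - 1) / β)
          * finsetSup F (fun τ => V τ * q (Ioi τ) ^ β⁻¹) x ^ ρ ∂(dualMeasure m b)
        ≤ C * K ^ ρ := by
  have ha := hab.pos
  have hb := hab.symm.pos
  have hβ0 : 0 < β := by linarith
  have hβ1 : 0 < β - 1 := by linarith
  have hb1 : 0 < b - 1 := hab.symm.sub_one_pos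
  obtain ⟨e1, e2, -, e4⟩ := exponent_relations hab hβ hρ hρβ
  set κ := ρ * (β - 1) / β with hκ
  have hκ0 : 0 ≤ κ := by positivity
  set D := ENNReal.ofReal a ^ a * ENNReal.ofReal (b - 1) ^ (a - 1) with hD
  have hDt : D ≠ ∞ := ENNReal.mul_ne_top
    (ENNReal.rpow_ne_top_of_nonneg ha.le ENNReal.ofReal_ne_top)
    (ENNReal.rpow_ne_top_of_nonneg hab.sub_one_pos.le ENNReal.ofReal_ne_top)
  set c : ℝ≥0∞ := (1 - 2 ^ (-(ρ / a)))⁻¹ with hc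
  have hct : c ≠ ∞ := by
    rw [hc, ENNReal.inv_ne_top]
    refine (tsub_pos_of_lt ?_).ne'
    exact ENNReal.rpow_lt_one_of_one_lt_of_neg (by norm_num)
      (by have : 0 < ρ / a := by positivity
          linarith)
  have hDct : D * c ^ a ≠ ∞ := ENNReal.mul_ne_top hDt (ENNReal.rpow_ne_top_of_nonneg ha.le hct)
  have h2 : ∀ e : ℝ, 0 ≤ e → (2 : ℝ≥0∞) ^ e ≠ ∞ := fun e he =>
    ENNReal.rpow_ne_top_of_nonneg he (by simp)
  set C₀ : ℝ≥0∞ := 2 ^ ρ * 2 ^ (ρ / b) * (D * c ^ a) ^ (β / a) with hC₀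
  have hC₀t : C₀ ≠ ∞ := ENNReal.mul_ne_top (ENNReal.mul_ne_top (h2 _ hρ.le)
    (h2 _ (by positivity))) (ENNReal.rpow_ne_top_of_nonneg (by positivity) hDct)
  refine ⟨(C₀ ^ (ρ / β)).toNNReal, ?_⟩
  rw [ENNReal.coe_toNNReal (ENNReal.rpow_ne_top_of_nonneg (by positivity) hC₀t)]
  intro m q V K F hm _ hq hK hV hVt hF
  have := hm.null
  have := hm.sfinite
  set μ := dualMeasure m b with hμ
  have hμn : NullSingletonClass μ := by rw [hμ, dualMeasure]; infer_instance
  have hμs : SFinite μ := by rw [hμ, dualMeasure]; infer_instance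
  have hT := measurable_measure_Ioi μ
  set f : ℝ → ℝ≥0∞ := fun τ => V τ * q (Ioi τ) ^ β⁻¹ with hf
  set Φ := finsetSup F f with hΦ
  have hΦm : Measurable Φ := (finsetSup_mono F f).measurable
  have hft : ∀ τ ∈ F, f τ ≠ ∞ := fun τ hτ =>
    ENNReal.mul_ne_top (hVt τ) (ENNReal.rpow_ne_top_of_nonneg (by positivity) (hq τ (hF τ hτ)))
  set B := F.sup f with hB
  have hBt : B ≠ ∞ := by
    rw [← lt_top_iff_ne_top, hB, Finset.sup_lt_iff (by simp)]
    exact fun τ hτ => (hft τ hτ).lt_top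
  have hΦB : ∀ x, Φ x ≤ B := fun x => by
    refine Finset.sup_mono_fun fun τ _ => ?_
    split_ifs
    · exact le_rfl
    · exact zero_le
  have hΦt : ∀ x, Φ x ≠ ∞ := fun x => ne_top_of_le_ne_top hBt (hΦB x)
  -- the integral is finite
  set I := ∫⁻ x, μ (Ioi x) ^ κ * Φ x ^ ρ ∂μ with hI
  have hIt : I ≠ ∞ := by
    rcases setOf_lt_finsetSup F f 0 with h | ⟨τ, hτ, -, h⟩
    · have : I = 0 := by
        rw [hI]
        refine (lintegral_congr fun x => ?_).trans lintegral_zero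
        have h3 : x ∉ {x | 0 < finsetSup F f x} := by rw [h]; simp
        have h4 : Φ x = 0 := by simpa using h3
        rw [h4, ENNReal.zero_rpow_of_pos hρ, mul_zero]
      rw [this]
      simp
    · refine ne_top_of_le_ne_top (b := μ (Ioi τ) ^ κ * B ^ ρ * μ (Ioi τ)) ?_ ?_
      · have := dualMeasure_Ioi_ne_top hm hab.symm.lt (hF τ hτ)
        exact ENNReal.mul_ne_top (ENNReal.mul_ne_top (ENNReal.rpow_ne_top_of_nonneg hκ0 this)
          (ENNReal.rpow_ne_top_of_nonneg hρ.le hBt)) this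
      · rw [measure_congr (Ioi_ae_eq_Ici (a := τ)), ← setLIntegral_const,
          ← lintegral_indicator measurableSet_Ici]
        refine lintegral_mono fun x => ?_
        by_cases hx : x ∈ Ici τ
        · rw [indicator_of_mem hx]
          have h5 : μ (Ioi x) ≤ μ (Ici τ) := measure_mono fun y hy => (mem_Ici.1 hx).trans (le_of_lt hy)
          have := hΦB x
          gcongr
        · rw [← h] at hx
          have h4 : Φ x = 0 := by simpa using hx
          rw [h4, ENNReal.zero_rpow_of_pos hρ, mul_zero]
          exact zero_le
  -- the superlevel sets and the test measure
  set L : ℤ → Set ℝ := fun k => {x | (2 : ℝ≥0∞) ^ (k : ℝ) < Φ x} with hL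
  have hLm : ∀ k, MeasurableSet (L k) := fun k => measurableSet_lt measurable_const hΦm
  have hex : ∀ k, ∃ τ : ℝ, 0 < τ ∧ (L k = ∅ ∨ (2 : ℝ≥0∞) ^ (k : ℝ) < f τ ∧ L k = Ici τ) := by
    intro k
    rcases setOf_lt_finsetSup F f (2 ^ (k : ℝ)) with h | ⟨τ, hτ, h, h'⟩
    · exact ⟨1, one_pos, Or.inl h⟩
    · exact ⟨τ, hF τ hτ, Or.inr ⟨h, h'⟩⟩
  choose τ hτ0 hτ using hex
  set η : ℤ → ℝ≥0∞ := fun k => 2 ^ ((k : ℝ) * (ρ / a)) * ∫⁻ x in L k, μ (Ioi x) ^ (κ / a) ∂μ with hη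
  set h : Measure ℝ := Measure.sum fun k => η k • Measure.dirac (τ k) with hh
  have h0 : h (Iic 0) = 0 := by
    rw [hh, Measure.sum_apply _ measurableSet_Iic, ENNReal.tsum_eq_zero]
    intro k
    simp [Measure.dirac_apply' _ measurableSet_Iic, hτ0 k]
  have hdy : ∀ (s : ℝ) (g : ℝ → ℝ≥0∞) (A : Set ℝ), MeasurableSet A → Measurable g →
      ∑' k : ℤ, (2 : ℝ≥0∞) ^ ((k : ℝ) * s) * ∫⁻ x in A, (L k).indicator g x ∂μ
        = ∫⁻ x in A, dyadicSum s (Φ x) * g x ∂μ := by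
    intro s g A hA hg
    simp_rw [dyadicSum, ← ENNReal.tsum_mul_right]
    have hme : ∀ k : ℤ, AEMeasurable (fun x => (if (2 : ℝ≥0∞) ^ (k : ℝ) < Φ x
        then (2 : ℝ≥0∞) ^ ((k : ℝ) * s) else 0) * g x) (μ.restrict A) := fun k =>
      ((Measurable.ite (hLm k) measurable_const measurable_const).mul hg).aemeasurable
    rw [lintegral_tsum hme]
    refine tsum_congr fun k => ?_
    rw [← lintegral_const_mul _ (hg.indicator (hLm k))]
    refine lintegral_congr fun x => ?_
    by_cases hx : (2 : ℝ≥0∞) ^ (k : ℝ) < Φ x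
    · rw [if_pos hx, indicator_of_mem (show x ∈ L k from hx)]
    · rw [if_neg hx, indicator_of_notMem (show x ∉ L k from hx), mul_zero, zero_mul]
  have hG : Measurable fun x => μ (Ioi x) ^ (κ / a) := hT.pow_const _
  have htail : ∀ t, h (Ioi t) ≤ ∫⁻ x in Ioi t, c * (Φ x ^ (ρ / a) * μ (Ioi x) ^ (κ / a)) ∂μ := by
    intro t
    calc h (Ioi t) = ∑' k, η k * (Ioi t).indicator 1 (τ k) := by
          rw [hh, Measure.sum_apply _ measurableSet_Ioi]
          refine tsum_congr fun k => ?_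
          rw [Measure.smul_apply, Measure.dirac_apply' _ measurableSet_Ioi, smul_eq_mul]
      _ ≤ ∑' k : ℤ, (2 : ℝ≥0∞) ^ ((k : ℝ) * (ρ / a))
            * ∫⁻ x in Ioi t, (L k).indicator (fun x => μ (Ioi x) ^ (κ / a)) x ∂μ := by
          refine ENNReal.tsum_le_tsum fun k => ?_
          rw [hη]
          simp only
          rw [mul_assoc]
          gcongr
          by_cases ht : t < τ k
          · rw [indicator_of_mem (mem_Ioi.2 ht), Pi.one_apply, mul_one,
              lintegral_indicator (hLm k), Measure.restrict_restrict (hLm k)]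
            refine lintegral_mono_set fun x hx => ⟨hx, ?_⟩
            rcases hτ k with h3 | ⟨-, h3⟩
            · rw [h3] at hx
              exact absurd hx (by simp)
            · rw [h3] at hx
              exact ht.trans_le hx
          · rw [indicator_of_notMem (by simpa using ht), mul_zero]
            exact zero_le
      _ = ∫⁻ x in Ioi t, dyadicSum (ρ / a) (Φ x) * μ (Ioi x) ^ (κ / a) ∂μ :=
          hdy _ _ _ measurableSet_Ioi hG
      _ ≤ _ := by
          refine lintegral_mono fun x => ?_
          rw [← mul_assoc]
          gcongr
          exact dyadicSum_le (by positivity) (hΦt x)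
  have htailI : ∫⁻ t, h (Ioi t) ^ a ∂m ≤ D * c ^ a * I := by
    have hξ : Measurable fun x => c * (Φ x ^ (ρ / a) * μ (Ioi x) ^ (κ / a)) :=
      ((hΦm.pow_const _).mul hG).const_mul _
    calc ∫⁻ t, h (Ioi t) ^ a ∂m
        ≤ ∫⁻ t, (∫⁻ x in Ioi t, c * (Φ x ^ (ρ / a) * μ (Ioi x) ^ (κ / a)) ∂μ) ^ a ∂m :=
          lintegral_mono fun t => ENNReal.rpow_le_rpow (htail t) ha.le
      _ ≤ D * ∫⁻ x, (c * (Φ x ^ (ρ / a) * μ (Ioi x) ^ (κ / a))) ^ a ∂μ :=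
          hardy_dual_dualMeasure hm hab hξ
      _ = D * ∫⁻ x, c ^ a * (μ (Ioi x) ^ κ * Φ x ^ ρ) ∂μ := by
          congr 1
          refine lintegral_congr fun x => ?_
          rw [ENNReal.mul_rpow_of_nonneg _ _ ha.le, ENNReal.mul_rpow_of_nonneg _ _ ha.le,
            ← ENNReal.rpow_mul, ← ENNReal.rpow_mul, div_mul_cancel₀ _ ha.ne',
            div_mul_cancel₀ _ ha.ne', mul_comm (Φ x ^ ρ)]
      _ = _ := by
          rw [lintegral_const_mul _ (show Measurable fun x => μ (Ioi x) ^ κ * Φ x ^ ρ from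
            (hT.pow_const _).mul (hΦm.pow_const _)), ← mul_assoc]
  have hmain := hK h h0 (ne_top_of_le_ne_top (ENNReal.mul_ne_top hDct hIt) htailI)
  -- the left-hand side dominates the sum over the levels
  have hlow : ∑' k, (η k * f (τ k)) ^ β ≤ ∫⁻ t, (∫⁻ s in Iic t, V s ∂h) ^ β ∂q := by
    calc ∑' k, (η k * f (τ k)) ^ β
        = ∑' k, ∫⁻ t in Ici (τ k), (η k * V (τ k)) ^ β ∂q := by
          refine tsum_congr fun k => ?_
          rw [setLIntegral_const, hf]
          simp only
          rw [← mul_assoc, ENNReal.mul_rpow_of_nonneg _ _ hβ0.le, ← ENNReal.rpow_mul,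
            inv_mul_cancel₀ hβ0.ne', ENNReal.rpow_one, measure_congr Ioi_ae_eq_Ici]
      _ = ∫⁻ t, ∑' k, ((Ici (τ k)).indicator (fun _ => η k * V (τ k)) t) ^ β ∂q := by
          rw [lintegral_tsum fun k =>
            ((measurable_const.indicator measurableSet_Ici).pow_const _).aemeasurable]
          refine tsum_congr fun k => ?_
          rw [← lintegral_indicator measurableSet_Ici]
          refine lintegral_congr fun t => ?_
          by_cases ht : t ∈ Ici (τ k)
          · simp [indicator_of_mem ht]
          · simp [indicator_of_notMem ht, hβ0]
      _ ≤ ∫⁻ t, (∑' k, (Ici (τ k)).indicator (fun _ => η k * V (τ k)) t) ^ β ∂q :=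
          lintegral_mono fun t => tsum_rpow_le_rpow_tsum _ hβ.le
      _ = _ := by
          refine lintegral_congr fun t => ?_
          congr 1
          rw [hh, Measure.restrict_sum _ measurableSet_Iic, lintegral_sum_measure]
          refine tsum_congr fun k => ?_
          rw [Measure.restrict_smul, lintegral_smul_measure,
            setLIntegral_dirac' hV measurableSet_Iic, smul_eq_mul]
          by_cases ht : τ k ≤ t
          · rw [indicator_of_mem (mem_Ici.2 ht), if_pos (mem_Iic.2 ht)]
          · rw [indicator_of_notMem (by simpa using ht), if_neg (by simpa using ht), mul_zero]
  have hlevel : ∀ k : ℤ, (2 : ℝ≥0∞) ^ ((k : ℝ) * ρ) * ∫⁻ x in L k, μ (Ioi x) ^ κ ∂μ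
      ≤ 2 ^ (ρ / b) * (η k * f (τ k)) ^ β := by
    intro k
    rcases hτ k with h3 | ⟨h3, h4⟩
    · rw [h3]
      simp
    calc (2 : ℝ≥0∞) ^ ((k : ℝ) * ρ) * ∫⁻ x in L k, μ (Ioi x) ^ κ ∂μ
        ≤ (2 : ℝ≥0∞) ^ ((k : ℝ) * ρ) * (μ (Ioi (τ k)) ^ κ * μ (Ioi (τ k))) := by
          rw [h4, ← restrict_Ioi_eq_restrict_Ici, ← setLIntegral_const]
          refine mul_le_mul_right (setLIntegral_mono' measurableSet_Ioi fun x hx => ?_) _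
          have : μ (Ioi x) ≤ μ (Ioi (τ k)) := measure_mono (Ioi_subset_Ioi (le_of_lt hx))
          gcongr
      _ = (2 : ℝ≥0∞) ^ ((k : ℝ) * ρ) * (μ (Ioi (τ k)) ^ (1 + κ / a)) ^ β := by
          rw [← ENNReal.rpow_mul, e2, show ρ / b / β * β = ρ / b by field_simp, ← e1, add_comm 1 κ,
            ENNReal.rpow_add_of_nonneg _ _ hκ0 zero_le_one, ENNReal.rpow_one]
      _ ≤ (2 : ℝ≥0∞) ^ ((k : ℝ) * ρ)
            * (2 ^ (1 + κ / a) * ∫⁻ x in L k, μ (Ioi x) ^ (κ / a) ∂μ) ^ β := by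
          gcongr
          rw [h4, ← restrict_Ioi_eq_restrict_Ici]
          exact measure_Ioi_rpow_le μ (by positivity) _
      _ = 2 ^ (ρ / b) * (η k * 2 ^ (k : ℝ)) ^ β := by
          rw [hη]
          simp only
          rw [ENNReal.mul_rpow_of_nonneg _ _ hβ0.le, ENNReal.mul_rpow_of_nonneg _ _ hβ0.le,
            ENNReal.mul_rpow_of_nonneg _ _ hβ0.le, ← ENNReal.rpow_mul, ← ENNReal.rpow_mul,
            ← ENNReal.rpow_mul, e2, show ρ / b / β * β = ρ / b by field_simp]
          have h5 : (2 : ℝ≥0∞) ^ ((k : ℝ) * ρ)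
              = 2 ^ ((k : ℝ) * (ρ / a) * β) * 2 ^ ((k : ℝ) * β) := by
            rw [← ENNReal.rpow_add _ _ (by simp) (by simp)]
            congr 1
            have : ρ * (β / a + β / ρ) = ρ := by rw [e4, mul_one]
            have h6 : ρ = ρ / a * β + β := by
              field_simp at this ⊢
              linarith
            nth_rw 1 [h6]
            ring
          rw [h5]
          ring
      _ ≤ _ := by gcongr
  have h7 : I ≤ C₀ * K ^ β * I ^ (β / a) := by
    calc I ≤ ∫⁻ x, 2 ^ ρ * (dyadicSum ρ (Φ x) * μ (Ioi x) ^ κ) ∂μ := by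
          refine lintegral_mono fun x => ?_
          rw [mul_comm, ← mul_assoc]
          gcongr
          exact rpow_le_dyadicSum hρ (hΦt x)
      _ = 2 ^ ρ * ∑' k : ℤ, (2 : ℝ≥0∞) ^ ((k : ℝ) * ρ) * ∫⁻ x in L k, μ (Ioi x) ^ κ ∂μ := by
          rw [lintegral_const_mul' _ _ (h2 _ hρ.le)]
          congr 1
          have h8 := hdy ρ (fun x => μ (Ioi x) ^ κ) univ MeasurableSet.univ (hT.pow_const _)
          simp only [Measure.restrict_univ] at h8
          rw [← h8]
          refine tsum_congr fun k => ?_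
          rw [lintegral_indicator (hLm k)]
      _ ≤ 2 ^ ρ * ∑' k, 2 ^ (ρ / b) * (η k * f (τ k)) ^ β :=
          mul_le_mul_right (ENNReal.tsum_le_tsum hlevel) _
      _ ≤ 2 ^ ρ * (2 ^ (ρ / b) * (K ^ β * (D * c ^ a * I) ^ (β / a))) := by
          rw [ENNReal.tsum_mul_left]
          gcongr
          exact hlow.trans (hmain.trans (by gcongr))
      _ = _ := by
          rw [ENNReal.mul_rpow_of_nonneg _ I (by positivity), hC₀]
          ring
  have h8 := rpow_one_sub_le_of_le_mul_rpow
    (by have : 0 < β / ρ := by positivity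
        linarith) hIt h7
  rw [show 1 - β / a = β / ρ by linarith] at h8
  calc I = (I ^ (β / ρ)) ^ (ρ / β) := by
        rw [← ENNReal.rpow_mul, show β / ρ * (ρ / β) = 1 by field_simp, ENNReal.rpow_one]
    _ ≤ (C₀ * K ^ β) ^ (ρ / β) := by gcongr
    _ = _ := by
        rw [ENNReal.mul_rpow_of_nonneg _ _ (by positivity), ← ENNReal.rpow_mul,
          show β * (ρ / β) = ρ by field_simp]

/-- The necessity of the first integral condition in the range `β < a`. -/
theorem OperatorBound.lintegral_iSup_le {a b β ρ : ℝ} (hab : a.HolderConjugate b)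
    (hβ : 1 < β) (hρ : 0 < ρ) (hρβ : ρ⁻¹ = β⁻¹ - a⁻¹) :
    ∃ C : ℝ≥0, ∀ (m q : Measure ℝ) (V : ℝ → ℝ≥0∞) (K : ℝ≥0∞), IsHalfLine m →
      NullSingletonClass q → (∀ x, 0 < x → q (Ioi x) ≠ ∞) →
      OperatorBound m q V a β K → Monotone V → (∀ x, V x ≠ ∞) →
      (∀ x, 0 < x → ∀ c < V x, ∃ s, 0 < s ∧ s < x ∧ c < V s) →
      ∫⁻ x, dualMeasure m b (Ioi x) ^ (ρ * (β - 1) / β)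
          * (⨆ τ ∈ Ioc 0 x, V τ * q (Ioi τ) ^ β⁻¹) ^ ρ ∂(dualMeasure m b)
        ≤ C * K ^ ρ := by
  classical
  obtain ⟨C, hC⟩ := OperatorBound.lintegral_finsetSup_le hab hβ hρ hρβ
  refine ⟨C, fun m q V K hm hqn hq hK hV hVt hVl => ?_⟩
  have hβ0 : 0 < β := by linarith
  have hκ0 : 0 ≤ ρ * (β - 1) / β := by
    have : 0 < β - 1 := by linarith
    positivity
  set μ := dualMeasure m b with hμ
  set f : ℝ → ℝ≥0∞ := fun τ => V τ * q (Ioi τ) ^ β⁻¹ with hf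
  -- by left continuity only rational points matter
  let ι := {r : ℚ // 0 < r}
  let F : Finset ι → Finset ℝ := fun T => Finset.image (fun r : ι => ((r.1 : ℚ) : ℝ)) T
  have hF0 : ∀ T, ∀ τ ∈ F T, 0 < τ := fun T τ hτ => by
    obtain ⟨r, -, rfl⟩ := Finset.mem_image.1 hτ
    exact Rat.cast_pos.2 r.2
  have hFmono : Monotone F := fun S T hST => Finset.image_subset_image hST
  have hsup : ∀ x, ⨆ τ ∈ Ioc 0 x, f τ = ⨆ T : Finset ι, finsetSup (F T) f x := by
    intro x
    refine le_antisymm (iSup₂_le fun τ hτ => ?_) (iSup_le fun T => Finset.sup_le fun τ hτ => ?_)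
    · have hq0 : q (Ioi τ) ^ β⁻¹ ≠ ∞ := ENNReal.rpow_ne_top_of_nonneg (by positivity) (hq τ hτ.1)
      refine le_of_forall_lt fun d hd => ?_
      obtain ⟨c, hc, hd'⟩ : ∃ c < V τ, d < c * q (Ioi τ) ^ β⁻¹ := by
        have hq1 : q (Ioi τ) ^ β⁻¹ ≠ 0 := fun h => by
          rw [hf] at hd
          simp [h] at hd
        have h1 : d / q (Ioi τ) ^ β⁻¹ < V τ := by
          rwa [ENNReal.div_lt_iff (Or.inl hq1) (Or.inl hq0)]
        obtain ⟨c, hc1, hc2⟩ := exists_between h1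
        exact ⟨c, hc2, by rwa [ENNReal.div_lt_iff (Or.inl hq1) (Or.inl hq0)] at hc1⟩
      obtain ⟨s, hs0, hsτ, hcs⟩ := hVl τ hτ.1 c hc
      obtain ⟨r, hr1, hr2⟩ := exists_rat_btwn hsτ
      have hr0 : 0 < r := by exact_mod_cast hs0.trans hr1
      have hmem : ((r : ℚ) : ℝ) ∈ F {⟨r, hr0⟩} := by simp [F]
      calc d < c * q (Ioi τ) ^ β⁻¹ := hd'
        _ ≤ V r * q (Ioi (r : ℝ)) ^ β⁻¹ := by
            have h1 : c ≤ V r := hcs.le.trans (hV hr1.le)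
            have h2 : q (Ioi τ) ≤ q (Ioi (r : ℝ)) := measure_mono (Ioi_subset_Ioi hr2.le)
            gcongr
        _ = (if (r : ℝ) ≤ x then f r else 0) := by rw [if_pos (hr2.le.trans hτ.2)]
        _ ≤ finsetSup (F {⟨r, hr0⟩}) f x :=
            Finset.le_sup (f := fun τ => if τ ≤ x then f τ else 0) hmem
        _ ≤ _ := le_iSup (fun T : Finset ι => finsetSup (F T) f x) _
    · split_ifs with h
      · exact le_iSup₂ (f := fun τ (_ : τ ∈ Ioc 0 x) => f τ) τ ⟨hF0 T τ hτ, h⟩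
      · exact zero_le
  have hpow : ∀ x, μ (Ioi x) ^ (ρ * (β - 1) / β) * (⨆ τ ∈ Ioc 0 x, f τ) ^ ρ
      = ⨆ T : Finset ι, μ (Ioi x) ^ (ρ * (β - 1) / β) * finsetSup (F T) f x ^ ρ := fun x => by
    rw [hsup, ← ENNReal.mul_iSup]
    congr 1
    exact (ENNReal.orderIsoRpow ρ hρ).map_iSup _
  have hmono : Monotone fun (T : Finset ι) (x : ℝ) =>
      μ (Ioi x) ^ (ρ * (β - 1) / β) * finsetSup (F T) f x ^ ρ := fun S T hST x => by
    have : finsetSup (F S) f x ≤ finsetSup (F T) f x := Finset.sup_mono (hFmono hST)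
    exact mul_le_mul_right (ENNReal.rpow_le_rpow this hρ.le) _
  refine (lintegral_congr hpow).trans_le ?_
  have hme : ∀ T : Finset ι, AEMeasurable (fun x =>
      μ (Ioi x) ^ (ρ * (β - 1) / β) * finsetSup (F T) f x ^ ρ) μ := fun T =>
    (((measurable_measure_Ioi μ).pow_const _).mul
      ((finsetSup_mono _ f).measurable.pow_const _)).aemeasurable
  rw [lintegral_iSup_directed hme hmono.directed_le]
  exact iSup_le fun T => hC m q V K (F T) hm hqn hq hK hV.measurable hVt (hF0 T)

/-! ### The one-dimensional inequality -/

/-- The quantity `M ^ (-1/a) sup_{t > 0} V(t) U(t) ^ (1/β)`, where `M` is the total mass of `m` and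
`U(t) = q(t,∞)`. -/
def endBound (m q : Measure ℝ) (V : ℝ → ℝ≥0∞) (a β : ℝ) : ℝ≥0∞ :=
  m univ ^ (-a⁻¹) * ⨆ t ∈ Ioi (0 : ℝ), V t * q (Ioi t) ^ β⁻¹

/-- The quantity `sup_{x > 0} (V(x) ^ b μ(x,∞) + ∫_{(0,x)} V ^ b dμ) ^ (1/b) U(x) ^ (1/β)`, where `μ`
is the dual measure of `m`. -/
def supBound (m q : Measure ℝ) (V : ℝ → ℝ≥0∞) (b β : ℝ) : ℝ≥0∞ :=
  ⨆ x ∈ Ioi (0 : ℝ), (V x ^ b * dualMeasure m b (Ioi x)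
    + ∫⁻ t in Ioo 0 x, V t ^ b ∂(dualMeasure m b)) ^ b⁻¹ * q (Ioi x) ^ β⁻¹

/-- The quantity `(∫ μ(x,∞) ^ κ (sup_{τ ≤ x} V(τ) U(τ) ^ (1/β)) ^ ρ dμ(x)) ^ (1/ρ)` with
`κ = ρ (β - 1) / β`. -/
def intBound₁ (m q : Measure ℝ) (V : ℝ → ℝ≥0∞) (b β ρ : ℝ) : ℝ≥0∞ :=
  (∫⁻ x, dualMeasure m b (Ioi x) ^ (ρ * (β - 1) / β)
    * (⨆ τ ∈ Ioc 0 x, V τ * q (Ioi τ) ^ β⁻¹) ^ ρ ∂(dualMeasure m b)) ^ ρ⁻¹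

/-- The quantity `(∫ (∫_{(0,x)} V ^ b dμ) ^ κ V(x) ^ b U(x) ^ (ρ/β) dμ(x)) ^ (1/ρ)` with
`κ = ρ (β - 1) / β`. -/
def intBound₂ (m q : Measure ℝ) (V : ℝ → ℝ≥0∞) (b β ρ : ℝ) : ℝ≥0∞ :=
  (∫⁻ x, (∫⁻ t in Ioo 0 x, V t ^ b ∂(dualMeasure m b)) ^ (ρ * (β - 1) / β)
    * V x ^ b * q (Ioi x) ^ (ρ / β) ∂(dualMeasure m b)) ^ ρ⁻¹

theorem setLIntegral_Ioo_dualMeasure {m : Measure ℝ} (hm : IsHalfLine m) (V : ℝ → ℝ≥0∞)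
    (b x : ℝ) :
    ∫⁻ t in Ioo 0 x, V t ^ b ∂(dualMeasure m b)
      = ((dualMeasure m b).withDensity fun x => V x ^ b) (Iio x) := by
  have h0 : dualMeasure m b (Iic 0) = 0 := withDensity_absolutelyContinuous m _ hm.Iic_zero
  rw [withDensity_apply _ measurableSet_Iio]
  refine setLIntegral_congr ?_
  filter_upwards [ae_pos_of_Iic_zero h0] with t ht
  exact propext ⟨fun h => h.2, fun h => ⟨ht, h⟩⟩

theorem intBound₂_eq {m : Measure ℝ} (hm : IsHalfLine m) (q : Measure ℝ) {V : ℝ → ℝ≥0∞}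
    (hV : Measurable V) (b β ρ : ℝ) :
    intBound₂ m q V b β ρ
      = (∫⁻ x, ((dualMeasure m b).withDensity fun x => V x ^ b) (Iio x) ^ (ρ * (β - 1) / β)
          * q (Ioi x) ^ (ρ / β) ∂((dualMeasure m b).withDensity fun x => V x ^ b)) ^ ρ⁻¹ := by
  set ν := (dualMeasure m b).withDensity fun x => V x ^ b with hν
  have h1 : Measurable fun x => ν (Iio x) ^ (ρ * (β - 1) / β) * q (Ioi x) ^ (ρ / β) :=
    ((measurable_measure_Iio ν).pow_const _).mul ((measurable_measure_Ioi q).pow_const _)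
  rw [intBound₂, hν, lintegral_withDensity_eq_lintegral_mul _ (hV.pow_const b) h1]
  congr 1
  refine lintegral_congr fun x => ?_
  rw [setLIntegral_Ioo_dualMeasure hm, ← hν, Pi.mul_apply]
  ring

theorem le_endBound (m q : Measure ℝ) (V : ℝ → ℝ≥0∞) (a β : ℝ) {x : ℝ} (hx : 0 < x) :
    m univ ^ (-a⁻¹) * (V x * q (Ioi x) ^ β⁻¹) ≤ endBound m q V a β :=
  mul_le_mul_right (le_iSup₂ (f := fun t (_ : t ∈ Ioi (0 : ℝ)) => V t * q (Ioi t) ^ β⁻¹) x hx) _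

theorem one_sub_mul_inv_of_holderConjugate {a b : ℝ} (hab : a.HolderConjugate b) :
    (1 - b) * b⁻¹ = -a⁻¹ := by
  have := hab.symm.pos
  have h : b⁻¹ = 1 - a⁻¹ := hab.one_sub_inv.symm
  rw [sub_mul, one_mul, mul_inv_cancel₀ this.ne', h]
  ring

/-- The sufficiency of the conditions for the one-dimensional inequality in the range `a ≤ β`. -/
theorem lintegral_le_supBound {a b β : ℝ} (hab : a.HolderConjugate b) (haβ : a ≤ β) :
    ∃ C : ℝ≥0, ∀ (m q h : Measure ℝ) (V : ℝ → ℝ≥0∞), IsHalfLine m → SFinite q →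
      q (Iic 0) = 0 → (∀ x, 0 < x → q (Ioi x) ≠ 0) → NullSingletonClass h → SFinite h →
      h (Iic 0) = 0 → Monotone V → (∀ x, V x ≠ ∞) →
      supBound m q V b β + endBound m q V a β ≠ ∞ →
      ∫⁻ t, (∫⁻ s in Iio t, V s ∂h) ^ β ∂q
        ≤ C * (supBound m q V b β + endBound m q V a β) ^ β
          * (∫⁻ t, h (Ioi t) ^ a ∂m) ^ (β / a) := by
  obtain ⟨C, hC⟩ := operator_upper_of_le hab haβ
  refine ⟨C, fun m q h V hm hqs hq0 hqp hhn hhs hh0 hV hVt hA => ?_⟩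
  have ha := hab.pos
  have hb := hab.symm.pos
  have hb1 := hab.symm.lt
  have hβ0 : 0 < β := ha.trans_le haβ
  have hbinv : 0 ≤ b⁻¹ := by positivity
  have hbinv1 : b⁻¹ ≤ 1 := inv_le_one_of_one_le₀ hb1.le
  have hν0 : ((dualMeasure m b).withDensity fun x => V x ^ b) (Iic 0) = 0 :=
    withDensity_absolutelyContinuous _ _ (withDensity_absolutelyContinuous m _ hm.Iic_zero)
  set A := supBound m q V b β + endBound m q V a β with hAdef
  set ν := (dualMeasure m b).withDensity fun x => V x ^ b with hν
  have hsup : ∀ x, 0 < x → (V x ^ b * dualMeasure m b (Ioi x) + ν (Iio x)) ^ b⁻¹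
      * q (Ioi x) ^ β⁻¹ ≤ supBound m q V b β := fun x hx => by
    rw [hν, ← setLIntegral_Ioo_dualMeasure hm]
    exact le_iSup₂ (f := fun x (_ : x ∈ Ioi (0 : ℝ)) => (V x ^ b * dualMeasure m b (Ioi x)
      + ∫⁻ t in Ioo 0 x, V t ^ b ∂(dualMeasure m b)) ^ b⁻¹ * q (Ioi x) ^ β⁻¹) x hx
  have hneg : ∀ x, x ≤ 0 → ν (Iio x) = 0 := fun x hx =>
    measure_mono_null (fun y hy => (le_of_lt hy).trans hx) hν0
  have h1 : ∀ x, ν (Iio x) ^ b⁻¹ * q (Ioi x) ^ β⁻¹ ≤ A := fun x => by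
    rcases le_or_gt x 0 with hx | hx
    · rw [hneg x hx, ENNReal.zero_rpow_of_pos (by positivity), zero_mul]
      exact zero_le
    · exact ((mul_le_mul_left (ENNReal.rpow_le_rpow le_add_self hbinv) _).trans
        (hsup x hx)).trans le_self_add
  refine hC m q h V A hm hqs hq0 hhn hhs hh0 hV hVt (fun x => ?_) h1 fun x hx => ?_
  · rcases le_or_gt x 0 with hx | hx
    · rw [hneg x hx]
      simp
    · intro htop
      have := h1 x
      rw [htop, ENNReal.top_rpow_of_pos (by positivity), ENNReal.top_mul] at this
      · exact hA (top_le_iff.1 this)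
      · intro h0
        rcases ENNReal.rpow_eq_zero_iff.1 h0 with h | h
        · exact hqp x hx h.1
        · exact absurd h.2 (by simpa using hβ0.le)
  · have hW0 := hm.pos x hx
    have hWt := hm.fin x
    have h2 : V x * q (Ioi x) ^ β⁻¹ * m (Iio x) ^ (-a⁻¹) ≤ A := by
      calc V x * q (Ioi x) ^ β⁻¹ * m (Iio x) ^ (-a⁻¹)
          = V x * q (Ioi x) ^ β⁻¹ * (dualMeasure m b (Ioi x) + m univ ^ (1 - b)) ^ b⁻¹ := by
            rw [dualMeasure_Ioi_add hm hb1 hx, ← ENNReal.rpow_mul,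
              one_sub_mul_inv_of_holderConjugate hab]
        _ ≤ V x * q (Ioi x) ^ β⁻¹ * (dualMeasure m b (Ioi x) ^ b⁻¹ + (m univ ^ (1 - b)) ^ b⁻¹) :=
            mul_le_mul_right (ENNReal.rpow_add_le_add_rpow _ _ hbinv hbinv1) _
        _ = (V x ^ b * dualMeasure m b (Ioi x)) ^ b⁻¹ * q (Ioi x) ^ β⁻¹
              + m univ ^ (-a⁻¹) * (V x * q (Ioi x) ^ β⁻¹) := by
            rw [← ENNReal.rpow_mul, one_sub_mul_inv_of_holderConjugate hab,
              ENNReal.mul_rpow_of_nonneg _ _ hbinv, ← ENNReal.rpow_mul, mul_inv_cancel₀ hb.ne',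
              ENNReal.rpow_one]
            ring
        _ ≤ A := add_le_add ((mul_le_mul_left (ENNReal.rpow_le_rpow le_self_add hbinv) _).trans
              (hsup x hx)) (le_endBound m q V a β hx)
    calc V x * q (Ioi x) ^ β⁻¹
        = V x * q (Ioi x) ^ β⁻¹ * m (Iio x) ^ (-a⁻¹) * m (Iio x) ^ a⁻¹ := by
          rw [mul_assoc _ (m (Iio x) ^ (-a⁻¹)), rpow_mul_rpow_cancel hW0 hWt (by ring), mul_one]
      _ ≤ _ := by gcongr

/-- The sufficiency of the conditions for the one-dimensional inequality in the range `β < a`. -/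
theorem lintegral_le_intBound {a b β ρ : ℝ} (hab : a.HolderConjugate b) (hβ : 1 < β) (hρ : 0 < ρ)
    (hρβ : ρ⁻¹ = β⁻¹ - a⁻¹) :
    ∃ C : ℝ≥0, ∀ (m q h : Measure ℝ) (V : ℝ → ℝ≥0∞), IsHalfLine m → SFinite q →
      q (Iic 0) = 0 → (∀ x, 0 < x → q (Ioi x) ≠ 0) → NullSingletonClass h → SFinite h →
      h (Iic 0) = 0 → Monotone V → (∀ x, V x ≠ ∞) →
      intBound₁ m q V b β ρ + intBound₂ m q V b β ρ + endBound m q V a β ≠ ∞ →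
      ∫⁻ t, (∫⁻ s in Iio t, V s ∂h) ^ β ∂q
        ≤ C * (intBound₁ m q V b β ρ + intBound₂ m q V b β ρ + endBound m q V a β) ^ β
          * (∫⁻ t, h (Ioi t) ^ a ∂m) ^ (β / a) := by
  obtain ⟨C, hC⟩ := operator_upper_of_lt hab hβ hρ hρβ
  refine ⟨C, fun m q h V hm hqs hq0 hqp hhn hhs hh0 hV hVt hA => ?_⟩
  have ha := hab.pos
  have hb1 := hab.symm.lt
  have hβ0 : 0 < β := by linarith
  have hκ0 : 0 < ρ * (β - 1) / β := by
    have : 0 < β - 1 := by linarith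
    positivity
  have hν0 : ((dualMeasure m b).withDensity fun x => V x ^ b) (Iic 0) = 0 :=
    withDensity_absolutelyContinuous _ _ (withDensity_absolutelyContinuous m _ hm.Iic_zero)
  have hI2 := intBound₂_eq hm q hV.measurable b β ρ
  have hroot : ∀ (I A : ℝ≥0∞), I ^ ρ⁻¹ ≤ A → I ≤ A ^ ρ := fun I A hI => by
    calc I = (I ^ ρ⁻¹) ^ ρ := by rw [← ENNReal.rpow_mul, inv_mul_cancel₀ hρ.ne', ENNReal.rpow_one]
      _ ≤ A ^ ρ := ENNReal.rpow_le_rpow hI hρ.le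
  set A := intBound₁ m q V b β ρ + intBound₂ m q V b β ρ + endBound m q V a β with hAdef
  set ν := (dualMeasure m b).withDensity fun x => V x ^ b with hν
  have hJ1 : intBound₁ m q V b β ρ ≤ A := le_self_add.trans le_self_add
  have hJ2 : intBound₂ m q V b β ρ ≤ A := le_add_self.trans le_self_add
  have hJ3 : endBound m q V a β ≤ A := le_add_self
  refine hC m q h V (fun x => ⨆ τ ∈ Ioc 0 x, V τ * q (Ioi τ) ^ β⁻¹)
    (⨆ t ∈ Ioi (0 : ℝ), V t * q (Ioi t) ^ β⁻¹) A hm hqs hq0 hhn hhs hh0 hV hVt (fun x hx => ?_)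
    ?_ (fun s x hs hsx => ?_) (fun s hs => ?_) (fun x => ?_) ?_ ?_ hJ3
  · -- if `ν` is infinite near the origin, then so is the second integral
    have hall : ∀ z, 0 < z → ν (Iio z) = ∞ := fun z hz => by
      by_contra hfin
      refine absurd hx (ne_top_of_le_ne_top (ENNReal.add_ne_top.2 ⟨hfin,
        withDensity_Ioo_ne_top hm hb1 hV hVt (x := x) (half_pos hz)⟩) ?_)
      refine (measure_mono fun y hy => ?_).trans (measure_union_le (Iio z) (Ioo (z / 2) x))
      rcases lt_or_ge y z with h | h
      · exact Or.inl h
      · exact Or.inr ⟨by linarith, hy⟩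
    refine hA (top_le_iff.1 (le_trans (le_of_eq ?_) hJ2))
    rw [hI2, eq_comm, ENNReal.rpow_eq_top_iff_of_pos (by positivity)]
    have h1 : ∫⁻ x, ν (Iio x) ^ (ρ * (β - 1) / β) * q (Ioi x) ^ (ρ / β) ∂ν = ∫⁻ _, ∞ ∂ν := by
      refine lintegral_congr_ae ?_
      filter_upwards [ae_pos_of_Iic_zero hν0] with y hy
      rw [hall y hy, ENNReal.top_rpow_of_pos hκ0, ENNReal.top_mul]
      intro h0
      rcases ENNReal.rpow_eq_zero_iff.1 h0 with h | h
      · exact hqp y hy h.1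
      · have : 0 < ρ / β := by positivity
        exact absurd h.2 this.not_gt
    rw [h1, lintegral_const, ENNReal.top_mul]
    intro h0
    have := hall 1 one_pos
    rw [measure_mono_null (subset_univ _) h0] at this
    exact ENNReal.zero_ne_top this
  · refine Monotone.measurable fun x y hxy => ?_
    exact biSup_mono fun τ hτ => ⟨hτ.1, hτ.2.trans hxy⟩
  · exact le_iSup₂ (f := fun τ (_ : τ ∈ Ioc 0 x) => V τ * q (Ioi τ) ^ β⁻¹) s ⟨hs, hsx.le⟩
  · exact le_iSup₂ (f := fun τ (_ : τ ∈ Ioi (0 : ℝ)) => V τ * q (Ioi τ) ^ β⁻¹) s hs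
  · exact biSup_mono fun τ hτ => hτ.1
  · exact hroot _ _ hJ1
  · exact hroot _ _ (hI2 ▸ hJ2)

theorem OperatorBound.endBound_le {m q : Measure ℝ} (hm : IsHalfLine m) {V : ℝ → ℝ≥0∞} {a β : ℝ}
    {K : ℝ≥0∞} (hK : OperatorBound m q V a β K) (ha : 0 < a) (hβ : 0 < β) (hV : Measurable V) :
    endBound m q V a β ≤ K := by
  rw [endBound, ENNReal.mul_iSup]
  refine iSup_le fun x => ?_
  rw [ENNReal.mul_iSup]
  refine iSup_le fun hx => ?_
  calc m univ ^ (-a⁻¹) * (V x * q (Ioi x) ^ β⁻¹)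
      ≤ m (Iio x) ^ (-a⁻¹) * (K * m (Iio x) ^ a⁻¹) := by
        refine mul_le_mul' ?_ (hK.mul_rpow_le ha hβ hV hx (hm.fin x))
        rw [ENNReal.rpow_neg, ENNReal.rpow_neg]
        exact ENNReal.inv_le_inv.2
          (ENNReal.rpow_le_rpow (measure_mono (subset_univ _)) (by positivity))
    _ = K := by
        rw [mul_left_comm, rpow_mul_rpow_cancel (hm.pos x hx) (hm.fin x) (by ring), mul_one]

/-- The necessity of the conditions for the one-dimensional inequality in the range `a ≤ β`. -/
theorem OperatorBound.supBound_add_endBound_le {a b : ℝ} (hab : a.HolderConjugate b) :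
    ∃ C : ℝ≥0, ∀ (m q : Measure ℝ) (V : ℝ → ℝ≥0∞) (β : ℝ) (K : ℝ≥0∞), IsHalfLine m → 0 < β →
      OperatorBound m q V a β K → Monotone V → (∀ x, V x ≠ ∞) →
      supBound m q V b β + endBound m q V a β ≤ C * K := by
  have ha := hab.pos
  have hb := hab.symm.pos
  have hb1 := hab.symm.lt
  have hbinv : 0 ≤ b⁻¹ := by positivity
  have hbinv1 : b⁻¹ ≤ 1 := inv_le_one_of_one_le₀ hb1.le
  set D : ℝ≥0∞ := (ENNReal.ofReal a ^ a * ENNReal.ofReal (b - 1) ^ (a - 1)) ^ a⁻¹ with hD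
  have hDt : D ≠ ∞ := ENNReal.rpow_ne_top_of_nonneg (by positivity) (ENNReal.mul_ne_top
    (ENNReal.rpow_ne_top_of_nonneg ha.le ENNReal.ofReal_ne_top)
    (ENNReal.rpow_ne_top_of_nonneg hab.sub_one_pos.le ENNReal.ofReal_ne_top))
  refine ⟨(1 + D + 1).toNNReal, fun m q V β K hm hβ hK hV hVt => ?_⟩
  rw [ENNReal.coe_toNNReal (by simp [hDt]), add_mul, one_mul]
  refine add_le_add (iSup₂_le fun x hx => ?_) (hK.endBound_le hm ha hβ hV.measurable)
  rw [setLIntegral_Ioo_dualMeasure hm]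
  set ν := (dualMeasure m b).withDensity fun x => V x ^ b with hν
  have h1 : dualMeasure m b (Ioi x) ^ b⁻¹ ≤ m (Iio x) ^ (-a⁻¹) := by
    rw [← one_sub_mul_inv_of_holderConjugate hab, ENNReal.rpow_mul]
    exact ENNReal.rpow_le_rpow (dualMeasure_Ioi_le hm hb1 hx) hbinv
  calc (V x ^ b * dualMeasure m b (Ioi x) + ν (Iio x)) ^ b⁻¹ * q (Ioi x) ^ β⁻¹
      ≤ ((V x ^ b * dualMeasure m b (Ioi x)) ^ b⁻¹ + ν (Iio x) ^ b⁻¹) * q (Ioi x) ^ β⁻¹ :=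
        mul_le_mul_left (ENNReal.rpow_add_le_add_rpow _ _ hbinv hbinv1) _
    _ = dualMeasure m b (Ioi x) ^ b⁻¹ * (V x * q (Ioi x) ^ β⁻¹)
          + ν (Iio x) ^ b⁻¹ * q (Ioi x) ^ β⁻¹ := by
        rw [ENNReal.mul_rpow_of_nonneg _ _ hbinv, ← ENNReal.rpow_mul, mul_inv_cancel₀ hb.ne',
          ENNReal.rpow_one]
        ring
    _ ≤ m (Iio x) ^ (-a⁻¹) * (K * m (Iio x) ^ a⁻¹) + D * K :=
        add_le_add (mul_le_mul' h1 (hK.mul_rpow_le ha hβ hV.measurable hx (hm.fin x)))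
          (hK.measure_rpow_le hm hab hβ hV hVt x)
    _ = (1 + D) * K := by
        rw [mul_left_comm, rpow_mul_rpow_cancel (hm.pos x hx) (hm.fin x) (by ring), mul_one]
        ring

/-- The necessity of the conditions for the one-dimensional inequality in the range `β < a`. -/
theorem OperatorBound.intBound_add_endBound_le {a b β ρ : ℝ} (hab : a.HolderConjugate b)
    (hβ : 1 < β) (hρ : 0 < ρ) (hρβ : ρ⁻¹ = β⁻¹ - a⁻¹) :
    ∃ C : ℝ≥0, ∀ (m q : Measure ℝ) (V : ℝ → ℝ≥0∞) (K : ℝ≥0∞), IsHalfLine m →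
      NullSingletonClass q → SFinite q → (∀ x, 0 < x → q (Ioi x) ≠ ∞) →
      OperatorBound m q V a β K → Monotone V → (∀ x, V x ≠ ∞) →
      (∀ x, 0 < x → ∀ c < V x, ∃ s, 0 < s ∧ s < x ∧ c < V s) →
      intBound₁ m q V b β ρ + intBound₂ m q V b β ρ + endBound m q V a β ≤ C * K := by
  obtain ⟨C₁, hC₁⟩ := OperatorBound.lintegral_iSup_le hab hβ hρ hρβ
  obtain ⟨C₂, hC₂⟩ := OperatorBound.lintegral_measure_rpow_le hab hβ hρ hρβ
  have hρi : 0 ≤ ρ⁻¹ := by positivity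
  have hroot : ∀ (C : ℝ≥0) (I K : ℝ≥0∞), I ≤ C * K ^ ρ → I ^ ρ⁻¹ ≤ ((C ^ ρ⁻¹ : ℝ≥0) : ℝ≥0∞) * K := by
    intro C I K h
    rw [ENNReal.coe_rpow_of_nonneg _ hρi]
    calc I ^ ρ⁻¹ ≤ (C * K ^ ρ) ^ ρ⁻¹ := ENNReal.rpow_le_rpow h hρi
      _ = _ := by
        rw [ENNReal.mul_rpow_of_nonneg _ _ hρi, ← ENNReal.rpow_mul, mul_inv_cancel₀ hρ.ne',
          ENNReal.rpow_one]
  refine ⟨C₁ ^ ρ⁻¹ + C₂ ^ ρ⁻¹ + 1, fun m q V K hm hqn hqs hq hK hV hVt hVl => ?_⟩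
  rw [ENNReal.coe_add, ENNReal.coe_add, ENNReal.coe_one, add_mul, add_mul, one_mul]
  refine add_le_add (add_le_add ?_ ?_)
    (hK.endBound_le hm hab.pos (by linarith) hV.measurable)
  · exact hroot _ _ _ (hC₁ m q V K hm hqn hq hK hV hVt hVl)
  · rw [intBound₂_eq hm q hV.measurable]
    exact hroot _ _ _ (hC₂ m q V K hm hqn hqs hq hK hV hVt)

/-! ### Measures on the half-line attached to the weights `ω` -/

/-- The measure `ω ^ θ dt` on the half-line `(0,∞)`. -/
def powMeasure (θ : ℝ) (ω : ℝ → ℝ≥0∞) : Measure ℝ :=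
  (volume.restrict (Ioi 0)).withDensity fun t => ω t ^ θ

theorem nullSingletonClass_powMeasure (θ : ℝ) (ω : ℝ → ℝ≥0∞) :
    NullSingletonClass (powMeasure θ ω) := by
  rw [powMeasure]; infer_instance

theorem sfinite_powMeasure (θ : ℝ) (ω : ℝ → ℝ≥0∞) : SFinite (powMeasure θ ω) := by
  rw [powMeasure]; infer_instance

theorem powMeasure_Iic_zero (θ : ℝ) (ω : ℝ → ℝ≥0∞) : powMeasure θ ω (Iic 0) = 0 := by
  refine withDensity_absolutelyContinuous _ _ ?_
  rw [Measure.restrict_apply measurableSet_Iic, Iic_inter_Ioi, Ioc_self, measure_empty]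

theorem powMeasure_congr {θ : ℝ} {ω : ℝ → ℝ≥0∞} {A B : Set ℝ} (h : ∀ t, 0 < t → (t ∈ A ↔ t ∈ B)) :
    powMeasure θ ω A = powMeasure θ ω B := by
  refine measure_congr ?_
  filter_upwards [ae_pos_of_Iic_zero (powMeasure_Iic_zero θ ω)] with t ht
  exact propext (h t ht)

theorem nrm_eq {α : Type*} [MeasureSpace α] {θ : ℝ≥0∞} (h0 : θ ≠ 0) (ht : θ ≠ ∞) (A : Set α)
    (g : α → ℝ≥0∞) : nrm θ A g = (∫⁻ x in A, g x ^ θ.toReal) ^ θ.toReal⁻¹ := by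
  rw [nrm, eLpNorm_eq_lintegral_rpow_enorm_toReal h0 ht, one_div]
  simp

theorem nrm_eq_powMeasure {θ : ℝ≥0∞} (h0 : θ ≠ 0) (ht : θ ≠ ∞) (ω : ℝ → ℝ≥0∞) {A : Set ℝ}
    (hA : MeasurableSet A) (hA0 : A ⊆ Ioi 0) :
    nrm θ A ω = powMeasure θ.toReal ω A ^ θ.toReal⁻¹ := by
  rw [nrm_eq h0 ht, powMeasure, withDensity_apply _ hA, Measure.restrict_restrict hA,
    inter_eq_self_of_subset_left hA0]

/-- The norm over `(0,t)` as the mass of `Iio t`: `powMeasure` does not charge `Iic 0`. -/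
theorem nrm_Ioo {θ : ℝ≥0∞} (h0 : θ ≠ 0) (ht : θ ≠ ∞) (ω : ℝ → ℝ≥0∞) (t : ℝ) :
    nrm θ (Ioo 0 t) ω = powMeasure θ.toReal ω (Iio t) ^ θ.toReal⁻¹ := by
  rw [nrm_eq_powMeasure h0 ht ω measurableSet_Ioo fun x hx => hx.1]
  congr 1
  exact powMeasure_congr fun x hx => ⟨fun h => h.2, fun h => ⟨hx, h⟩⟩

theorem nrm_Ioi {θ : ℝ≥0∞} (h0 : θ ≠ 0) (ht : θ ≠ ∞) (ω : ℝ → ℝ≥0∞) {t : ℝ} (h : 0 < t) :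
    nrm θ (Ioi t) ω = powMeasure θ.toReal ω (Ioi t) ^ θ.toReal⁻¹ :=
  nrm_eq_powMeasure h0 ht ω measurableSet_Ioi fun _ hx => h.trans hx

theorem nrm_Ioi_zero {θ : ℝ≥0∞} (h0 : θ ≠ 0) (ht : θ ≠ ∞) (ω : ℝ → ℝ≥0∞) :
    nrm θ (Ioi 0) ω = powMeasure θ.toReal ω univ ^ θ.toReal⁻¹ := by
  rw [nrm_eq_powMeasure h0 ht ω measurableSet_Ioi subset_rfl]
  congr 1
  exact powMeasure_congr fun x hx => ⟨fun _ => mem_univ _, fun _ => hx⟩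

theorem rpow_inv_ne_zero {x : ℝ≥0∞} {θ : ℝ} (hθ : 0 < θ) (h : 0 < x ^ θ⁻¹) : x ≠ 0 := by
  rintro rfl
  rw [ENNReal.zero_rpow_of_pos (by positivity)] at h
  exact lt_irrefl _ h

theorem rpow_inv_ne_top {x : ℝ≥0∞} {θ : ℝ} (hθ : 0 < θ) (h : x ^ θ⁻¹ < ∞) : x ≠ ∞ := by
  rintro rfl
  rw [ENNReal.top_rpow_of_pos (by positivity)] at h
  exact lt_irrefl _ h

theorem MemComplOmega.isHalfLine {θ : ℝ≥0∞} (h0 : θ ≠ 0) (ht : θ ≠ ∞) {ω : ℝ → ℝ≥0∞}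
    (h : MemComplOmega θ ω) : IsHalfLine (powMeasure θ.toReal ω) where
  null := nullSingletonClass_powMeasure _ _
  sfinite := sfinite_powMeasure _ _
  Iic_zero := powMeasure_Iic_zero _ _
  pos x hx := rpow_inv_ne_zero (ENNReal.toReal_pos h0 ht) (nrm_Ioo h0 ht ω x ▸ h.pos x hx)
  fin x := by
    rcases le_or_gt x 0 with hx | hx
    · have : powMeasure θ.toReal ω (Iio x) = 0 :=
        measure_mono_null (fun y hy => (le_of_lt hy).trans hx) (powMeasure_Iic_zero _ _)
      simp [this]
    · exact rpow_inv_ne_top (ENNReal.toReal_pos h0 ht) (nrm_Ioo h0 ht ω x ▸ h.finite x hx)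

theorem MemOmega.powMeasure_Ioi_ne_zero {θ : ℝ≥0∞} (h0 : θ ≠ 0) (ht : θ ≠ ∞) {ω : ℝ → ℝ≥0∞}
    (h : MemOmega θ ω) {x : ℝ} (hx : 0 < x) : powMeasure θ.toReal ω (Ioi x) ≠ 0 :=
  rpow_inv_ne_zero (ENNReal.toReal_pos h0 ht) (nrm_Ioi h0 ht ω hx ▸ h.pos x hx)

theorem MemOmega.powMeasure_Ioi_ne_top {θ : ℝ≥0∞} (h0 : θ ≠ 0) (ht : θ ≠ ∞) {ω : ℝ → ℝ≥0∞}
    (h : MemOmega θ ω) {x : ℝ} (hx : 0 < x) : powMeasure θ.toReal ω (Ioi x) ≠ ∞ :=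
  rpow_inv_ne_top (ENNReal.toReal_pos h0 ht) (nrm_Ioi h0 ht ω hx ▸ h.finite x hx)

theorem lintegral_powMeasure {θ : ℝ} {ω : ℝ → ℝ≥0∞}
    (hω : AEMeasurable ω (volume.restrict (Ioi 0))) {g : ℝ → ℝ≥0∞} (hg : Measurable g) :
    ∫⁻ t, g t ∂(powMeasure θ ω) = ∫⁻ t in Ioi 0, ω t ^ θ * g t :=
  lintegral_withDensity_eq_lintegral_mul₀ (hω.pow_const θ) hg.aemeasurable

theorem arrow_toReal {θ p : ℝ≥0∞} (h0 : p ≠ 0) (h : p < θ) :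
    (arrow θ p).toReal = (p.toReal⁻¹ - θ.toReal⁻¹)⁻¹ := by
  have hθ0 : θ ≠ 0 := (zero_le.trans_lt h).ne'
  rw [arrow, if_pos h, ENNReal.toReal_inv, one_div, one_div, ENNReal.toReal_sub_of_le
    (ENNReal.inv_le_inv.2 h.le) (ENNReal.inv_ne_top.2 h0), ENNReal.toReal_inv, ENNReal.toReal_inv]

theorem dualMeasure_Ioc_add {m : Measure ℝ} (hm : IsHalfLine m) {b : ℝ} (hb : 1 < b) {x y : ℝ}
    (hx : 0 < x) (hxy : x ≤ y) :
    dualMeasure m b (Ioc x y) + m (Iio y) ^ (1 - b) = m (Iio x) ^ (1 - b) := by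
  rw [← dualMeasure_Ioi_add hm hb hx, ← dualMeasure_Ioi_add hm hb (hx.trans_le hxy), ← add_assoc,
    ← measure_union _ measurableSet_Ioi, Ioc_union_Ioi_eq_Ioi hxy]
  exact disjoint_left.2 fun z hz hz' => absurd hz.2 (not_le.2 hz')

theorem continuous_measure_Iio_toReal {m : Measure ℝ} (hm : IsHalfLine m) :
    Continuous fun t => (m (Iio t)).toReal := by
  have := hm.null
  have hloc : IsLocallyFiniteMeasure m := ⟨fun x => ⟨Iio (x + 1), Iio_mem_nhds (by linarith),
    (hm.fin _).lt_top⟩⟩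
  have hc := intervalIntegral.continuous_primitive (μ := m) (f := fun _ => (1 : ℝ))
    (fun a b => (continuous_const.intervalIntegrable a b)) 0
  have hzero : ∀ t : ℝ, t ≤ 0 → m (Iio t) = 0 := fun t ht =>
    measure_mono_null (fun y hy => (le_of_lt hy).trans ht) hm.Iic_zero
  have heq : ∀ t, (m (Iio t)).toReal = ∫ _ in (0 : ℝ)..t, (1 : ℝ) ∂m := by
    intro t
    rcases le_total t 0 with ht | ht
    · rw [hzero t ht, intervalIntegral.integral_of_ge ht]
      have : m (Ioc t 0) = 0 := measure_mono_null (fun y hy => hy.2) hm.Iic_zero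
      simp [Measure.restrict_eq_zero.2 this]
    · rw [intervalIntegral.integral_of_le ht]
      have : m (Iio t) = m (Ioc 0 t) := by
        rw [measure_congr (Iio_ae_eq_Iic (a := t))]
        refine measure_congr ?_
        filter_upwards [ae_pos_of_Iic_zero hm.Iic_zero] with y hy
        exact propext ⟨fun h => ⟨hy, h⟩, fun h => h.2⟩
      simp [this, measureReal_def]
  simp_rw [heq]
  exact hc

/-- The Lebesgue-Stieltjes measure `d(-‖ω‖_{θ,(0,t)}^{-(θ → p)})` is the dual measure of
`ω ^ θ dt`. -/
theorem dNeg_eq_dualMeasure {θ p : ℝ≥0∞} (h0 : θ ≠ 0) (ht : θ ≠ ∞) {ω : ℝ → ℝ≥0∞}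
    (hω : MemComplOmega θ ω) {b : ℝ} (hb : 1 < b)
    (hexp : θ.toReal⁻¹ * (-(arrow θ p).toReal) = 1 - b) :
    dNeg θ p ω = dualMeasure (powMeasure θ.toReal ω) b := by
  have hm := hω.isHalfLine h0 ht
  set m := powMeasure θ.toReal ω with hmdef
  set μ := dualMeasure m b with hμ
  have hμ0 : μ (Iic 0) = 0 := withDensity_absolutelyContinuous m _ hm.Iic_zero
  set F : ℝ → ℝ := fun t => -((nrm θ (Ioo 0 t) ω) ^ (-(arrow θ p).toReal)).toReal with hF
  have hFeq : ∀ t, F t = -(m (Iio t) ^ (1 - b)).toReal := fun t => by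
    rw [hF]
    simp only
    rw [nrm_Ioo h0 ht, ← ENNReal.rpow_mul, hexp]
  have hfin : ∀ t, 0 < t → m (Iio t) ^ (1 - b) ≠ ∞ := fun t h =>
    ENNReal.rpow_ne_top_of_ne_zero (hm.pos t h) (hm.fin t)
  have hIoc : ∀ x y, 0 < x → x ≤ y → μ (Ioc x y) = ENNReal.ofReal (F y - F x) := by
    intro x y hx hxy
    have h1 := dualMeasure_Ioc_add hm hb hx hxy
    rw [hFeq, hFeq, neg_sub_neg, ENNReal.ofReal_sub _ ENNReal.toReal_nonneg,
      ENNReal.ofReal_toReal (hfin x hx), ENNReal.ofReal_toReal (hfin y (hx.trans_le hxy)), ← h1]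
    exact (ENNReal.add_sub_cancel_right (hfin y (hx.trans_le hxy))).symm
  have hmono : MonotoneOn F (Ioi 0) := by
    intro x hx y hy hxy
    have h1 := dualMeasure_Ioc_add hm hb hx hxy
    rw [hFeq, hFeq]
    exact neg_le_neg (ENNReal.toReal_mono (hfin x hx) (le_add_self.trans h1.le))
  have hcont : ContinuousOn F (Ioi 0) := by
    have h1 : F = fun t => -((m (Iio t)).toReal ^ (1 - b)) := by
      ext t
      rw [hFeq, ENNReal.toReal_rpow]
    rw [h1]
    exact ((continuous_measure_Iio_toReal hm).continuousOn.rpow_const fun t h =>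
      Or.inl (ENNReal.toReal_pos (hm.pos t h) (hm.fin t)).ne').neg
  obtain ⟨σ, hσ, hσF⟩ : ∃ σ : Measure ℝ, IsLocallyFiniteMeasure σ ∧
      stieltjes F = σ.map Real.exp := by
    rw [stieltjes]
    split_ifs with h
    · exact ⟨_, inferInstance, rfl⟩
    · exact ⟨0, inferInstance, by simp⟩
  have hσμ : σ = μ.map Real.log := by
    refine Measure.ext_of_Ioc _ _ fun x y hxy => ?_
    have hpre : Real.exp ⁻¹' Ioc (Real.exp x) (Real.exp y) = Ioc x y := by
      ext s
      simp
    have h1 : σ (Ioc x y) = stieltjes F (Ioc (Real.exp x) (Real.exp y)) := by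
      rw [hσF, Measure.map_apply Real.measurable_exp measurableSet_Ioc, hpre]
    rw [h1, stieltjes_Ioc hmono hcont (Real.exp_pos x) (Real.exp_le_exp.2 hxy.le),
      ← hIoc _ _ (Real.exp_pos x) (Real.exp_le_exp.2 hxy.le),
      Measure.map_apply Real.measurable_log measurableSet_Ioc]
    refine measure_congr ?_
    filter_upwards [ae_pos_of_Iic_zero hμ0] with t ht
    refine propext ?_
    show t ∈ Ioc _ _ ↔ Real.log t ∈ Ioc x y
    rw [mem_Ioc, mem_Ioc, Real.lt_log_iff_exp_lt ht, Real.log_le_iff_le_exp ht]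
  rw [dNeg, ← hF, hσF, hσμ, Measure.map_map Real.measurable_exp Real.measurable_log]
  have h2 : (Real.exp ∘ Real.log) =ᵐ[μ] id := by
    filter_upwards [ae_pos_of_Iic_zero hμ0] with t ht
    exact Real.exp_log ht
  rw [Measure.map_congr h2, Measure.map_id]

theorem biSup_rpow (S : Set ℝ) (f : ℝ → ℝ≥0∞) {r : ℝ} (hr : 0 < r) :
    (⨆ x ∈ S, f x) ^ r = ⨆ x ∈ S, f x ^ r :=
  ((ENNReal.orderIsoRpow r hr).map_iSup _).trans
    (iSup_congr fun _ => (ENNReal.orderIsoRpow r hr).map_iSup _)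

/-! ### The conditions in terms of measures on the half-line -/

section Terms

variable {n : ℕ} {p θ₁ θ₂ : ℝ≥0∞} {v₁ v₂ : E n → ℝ≥0∞} {ω₁ ω₂ : ℝ → ℝ≥0∞} {a b β ρ : ℝ}

/-- The `p`-th power of `Ṽ`. -/
def powV (p : ℝ≥0∞) (v₁ v₂ : E n → ℝ≥0∞) (x : ℝ) : ℝ≥0∞ :=
  tildeV p p v₁ v₂ x ^ p.toReal

theorem powV_rpow (hp : 0 < p.toReal) (x e : ℝ) :
    powV p v₁ v₂ x ^ (p.toReal⁻¹ * e) = tildeV p p v₁ v₂ x ^ e := by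
  rw [powV, ← ENNReal.rpow_mul, mul_inv_cancel_left₀ hp.ne']

theorem powV_mul_rpow (hp : 0 < p.toReal) (h0 : θ₂ ≠ 0) (ht : θ₂ ≠ ∞)
    (hβ : β = θ₂.toReal / p.toReal) {x : ℝ} (hx : 0 < x) :
    (powV p v₁ v₂ x * powMeasure θ₂.toReal ω₂ (Ioi x) ^ β⁻¹) ^ p.toReal⁻¹
      = tildeV p p v₁ v₂ x * nrm θ₂ (Ioi x) ω₂ := by
  have hθ := ENNReal.toReal_pos h0 ht
  rw [ENNReal.mul_rpow_of_nonneg _ _ (by positivity), ← mul_one p.toReal⁻¹, powV_rpow hp,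
    ENNReal.rpow_one, nrm_Ioi h0 ht ω₂ hx, ← ENNReal.rpow_mul]
  congr 2
  rw [hβ]
  field_simp

theorem endTerm_eq (hp : 0 < p.toReal) (h₁ : θ₁ ≠ 0) (h₁t : θ₁ ≠ ∞) (h₂ : θ₂ ≠ 0) (h₂t : θ₂ ≠ ∞)
    (ha : a = θ₁.toReal / p.toReal) (hβ : β = θ₂.toReal / p.toReal) :
    endTerm p θ₁ θ₂ v₁ v₂ ω₁ ω₂ = endBound (powMeasure θ₁.toReal ω₁) (powMeasure θ₂.toReal ω₂)
      (powV p v₁ v₂) a β ^ p.toReal⁻¹ := by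
  have hθ := ENNReal.toReal_pos h₁ h₁t
  rw [endTerm, endBound, ENNReal.mul_rpow_of_nonneg _ _ (by positivity), biSup_rpow _ _
    (by positivity), nrm_Ioi_zero h₁ h₁t, ← ENNReal.rpow_mul, ← ENNReal.rpow_neg]
  congr 1
  · congr 1
    rw [ha]
    field_simp
  · exact iSup_congr fun x => iSup_congr fun hx => (powV_mul_rpow hp h₂ h₂t hβ hx).symm

theorem supTerm_eq (hp : 0 < p.toReal) (h₂ : θ₂ ≠ 0) (h₂t : θ₂ ≠ ∞)
    (hβ : β = θ₂.toReal / p.toReal) (hb : 0 < b) (hr : (arrow θ₁ p).toReal = p.toReal * b)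
    (hμ : dNeg θ₁ p ω₁ = dualMeasure (powMeasure θ₁.toReal ω₁) b) :
    supTerm p θ₁ θ₂ v₁ v₂ ω₁ ω₂ = supBound (powMeasure θ₁.toReal ω₁) (powMeasure θ₂.toReal ω₂)
      (powV p v₁ v₂) b β ^ p.toReal⁻¹ := by
  rw [supTerm, supBound, biSup_rpow _ _ (by positivity), hμ, hr]
  refine iSup_congr fun x => iSup_congr fun hx => ?_
  have hV : ∀ t, tildeV p p v₁ v₂ t ^ (p.toReal * b) = powV p v₁ v₂ t ^ b := fun t => by
    rw [powV, ENNReal.rpow_mul]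
  simp_rw [hV]
  rw [ENNReal.mul_rpow_of_nonneg _ _ (by positivity), nrm_Ioi h₂ h₂t ω₂ hx, ← ENNReal.rpow_mul,
    ← ENNReal.rpow_mul]
  congr 2
  · field_simp
  · rw [hβ]
    field_simp

theorem restrict_Ioi_dualMeasure {m : Measure ℝ} (hm : IsHalfLine m) (b : ℝ) :
    (dualMeasure m b).restrict (Ioi 0) = dualMeasure m b := by
  have h0 : dualMeasure m b (Iic 0) = 0 := withDensity_absolutelyContinuous m _ hm.Iic_zero
  exact Measure.restrict_eq_self_of_ae_mem (ae_pos_of_Iic_zero h0)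

theorem intTerm₁_eq (hp : 0 < p.toReal) (h₂ : θ₂ ≠ 0) (h₂t : θ₂ ≠ ∞)
    (hβ : β = θ₂.toReal / p.toReal) (hβ1 : 1 < β) (hρ : 0 < ρ)
    (hr : (arrow θ₁ θ₂).toReal = p.toReal * ρ)
    (hr' : (arrow θ₂ p).toReal = p.toReal * (β / (β - 1)))
    (hm : IsHalfLine (powMeasure θ₁.toReal ω₁))
    (hμ : dNeg θ₁ p ω₁ = dualMeasure (powMeasure θ₁.toReal ω₁) b) :
    intTerm₁ p θ₁ θ₂ v₁ v₂ ω₁ ω₂ = intBound₁ (powMeasure θ₁.toReal ω₁) (powMeasure θ₂.toReal ω₂)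
      (powV p v₁ v₂) b β ρ ^ p.toReal⁻¹ := by
  have hβ0 : 0 < β - 1 := by linarith
  rw [intTerm₁, intBound₁, hμ, hr, hr', restrict_Ioi_dualMeasure hm, ← ENNReal.rpow_mul]
  congr 1
  · refine lintegral_congr fun x => ?_
    congr 1
    · congr 1
      field_simp
    · rw [ENNReal.rpow_mul]
      congr 1
      rw [biSup_rpow _ _ hp]
      refine iSup_congr fun τ => iSup_congr fun hτ => ?_
      rw [← powV_mul_rpow hp h₂ h₂t hβ hτ.1, ← ENNReal.rpow_mul, inv_mul_cancel₀ hp.ne',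
        ENNReal.rpow_one]
  · field_simp

theorem intTerm₂_eq (hp : 0 < p.toReal) (h₂ : θ₂ ≠ 0) (h₂t : θ₂ ≠ ∞)
    (hβ : β = θ₂.toReal / p.toReal) (hβ1 : 1 < β) (hρ : 0 < ρ)
    (hr₁ : (arrow θ₁ p).toReal = p.toReal * b)
    (hr : (arrow θ₁ θ₂).toReal = p.toReal * ρ)
    (hr' : (arrow θ₂ p).toReal = p.toReal * (β / (β - 1)))
    (hm : IsHalfLine (powMeasure θ₁.toReal ω₁))
    (hμ : dNeg θ₁ p ω₁ = dualMeasure (powMeasure θ₁.toReal ω₁) b) :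
    intTerm₂ p θ₁ θ₂ v₁ v₂ ω₁ ω₂ = intBound₂ (powMeasure θ₁.toReal ω₁) (powMeasure θ₂.toReal ω₂)
      (powV p v₁ v₂) b β ρ ^ p.toReal⁻¹ := by
  have hβ0 : 0 < β - 1 := by linarith
  have hμ0 : dualMeasure (powMeasure θ₁.toReal ω₁) b (Iic 0) = 0 :=
    withDensity_absolutelyContinuous _ _ hm.Iic_zero
  have hV : ∀ t, tildeV p p v₁ v₂ t ^ (p.toReal * b) = powV p v₁ v₂ t ^ b := fun t => by
    rw [powV, ENNReal.rpow_mul]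
  rw [intTerm₂, intBound₂, hμ, hr, hr', hr₁, restrict_Ioi_dualMeasure hm, ← ENNReal.rpow_mul]
  simp_rw [hV]
  congr 1
  · refine lintegral_congr_ae ?_
    filter_upwards [ae_pos_of_Iic_zero hμ0] with x hx
    congr 1
    · congr 2
      field_simp
    · rw [nrm_Ioi h₂ h₂t ω₂ hx, ← ENNReal.rpow_mul]
      congr 1
      rw [hβ]
      field_simp
  · field_simp

end Terms

/-! ### From the one-dimensional inequality to the embedding -/

section Spatial

variable {n : ℕ} {p θ θ₁ θ₂ : ℝ≥0∞} {v v₁ v₂ : E n → ℝ≥0∞} {ω ω₁ ω₂ : ℝ → ℝ≥0∞} {a : E n → ℝ≥0}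

/-- For a continuous function the essential supremum over an open ball is the supremum. -/
theorem tildeV_eq_iSup (ha : Continuous a) (hav : ∀ᵐ x, (v₁ x)⁻¹ * v₂ x = (a x : ℝ≥0∞)) (x : ℝ) :
    tildeV p p v₁ v₂ x = ⨆ y ∈ Metric.ball (0 : E n) x, (a y : ℝ≥0∞) := by
  have ha' : Continuous fun y => (a y : ℝ≥0∞) := ENNReal.continuous_coe.comp ha
  have h1 : tildeV p p v₁ v₂ x
      = essSup (fun y => (a y : ℝ≥0∞)) (volume.restrict (Metric.ball (0 : E n) x)) := by
    rw [tildeV, arrow, if_neg (lt_irrefl _), nrm, eLpNorm_exponent_top, eLpNormEssSup]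
    refine essSup_congr_ae ?_
    filter_upwards [ae_restrict_of_ae hav] with y hy
    rw [hy, enorm_eq_self]
  rw [h1]
  refine le_antisymm (essSup_le_of_ae_le _ ?_) (iSup₂_le fun y hy => ?_)
  · filter_upwards [ae_restrict_mem Metric.isOpen_ball.measurableSet] with y hy
    exact le_iSup₂ (f := fun y (_ : y ∈ Metric.ball (0 : E n) x) => (a y : ℝ≥0∞)) y hy
  · set S := essSup (fun y => (a y : ℝ≥0∞)) (volume.restrict (Metric.ball (0 : E n) x)) with hS
    by_contra hcon
    have h2 : ∀ᵐ z ∂(volume.restrict (Metric.ball (0 : E n) x)), (a z : ℝ≥0∞) ≤ S :=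
      ENNReal.ae_le_essSup _
    rw [ae_restrict_iff' Metric.isOpen_ball.measurableSet, ae_iff] at h2
    have hopen : IsOpen ({z | S < a z} ∩ Metric.ball (0 : E n) x) :=
      (isOpen_lt continuous_const ha').inter Metric.isOpen_ball
    have h3 : volume ({z | S < a z} ∩ Metric.ball (0 : E n) x) = 0 :=
      measure_mono_null (fun z hz => fun h => absurd (h hz.2) (not_le.2 hz.1)) h2
    rw [hopen.measure_eq_zero_iff (volume : Measure (E n))] at h3
    have : y ∈ ({z | S < a z} ∩ Metric.ball (0 : E n) x) := ⟨not_le.1 hcon, hy⟩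
    rw [h3] at this
    exact this

theorem tildeV_mono : Monotone (tildeV p p v₁ v₂) := fun _ _ hxy =>
  eLpNorm_mono_measure _ (Measure.restrict_mono (Metric.ball_subset_ball hxy) le_rfl)

/-- By continuity, the supremum of `a` over the open ball `B(0,‖y‖)` also bounds `a` at the boundary
point `y`; the origin is excluded since its ball is empty. -/
theorem le_tildeV (ha : Continuous a) (hav : ∀ᵐ x, (v₁ x)⁻¹ * v₂ x = (a x : ℝ≥0∞)) {y : E n}
    (hy : y ≠ 0) : (a y : ℝ≥0∞) ≤ tildeV p p v₁ v₂ ‖y‖ := by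
  have ha' : Continuous fun y => (a y : ℝ≥0∞) := ENNReal.continuous_coe.comp ha
  have h1 : Metric.ball (0 : E n) ‖y‖ ⊆ {z | (a z : ℝ≥0∞) ≤ tildeV p p v₁ v₂ ‖y‖} := fun z hz => by
    show (a z : ℝ≥0∞) ≤ _
    rw [tildeV_eq_iSup ha hav]
    exact le_iSup₂ (f := fun y' (_ : y' ∈ Metric.ball (0 : E n) ‖y‖) => (a y' : ℝ≥0∞)) z hz
  have h2 := closure_minimal h1 (isClosed_le ha' continuous_const)
  rw [closure_ball _ (norm_ne_zero_iff.2 hy)] at h2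
  exact h2 (by simp)

theorem tildeV_ne_top (ha : Continuous a) (hav : ∀ᵐ x, (v₁ x)⁻¹ * v₂ x = (a x : ℝ≥0∞)) (x : ℝ) :
    tildeV p p v₁ v₂ x ≠ ∞ := by
  obtain ⟨M, hM⟩ := (isCompact_closedBall (0 : E n) x).bddAbove_image ha.continuousOn
  refine ne_top_of_le_ne_top (ENNReal.coe_ne_top (r := M)) ?_
  rw [tildeV_eq_iSup ha hav]
  refine iSup₂_le fun y hy => ?_
  exact ENNReal.coe_le_coe.2 (hM ⟨y, Metric.ball_subset_closedBall hy, rfl⟩)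

theorem powV_mono : Monotone (powV p v₁ v₂) := fun _ _ hxy =>
  ENNReal.rpow_le_rpow (tildeV_mono hxy) ENNReal.toReal_nonneg

theorem powV_ne_top (ha : Continuous a) (hav : ∀ᵐ x, (v₁ x)⁻¹ * v₂ x = (a x : ℝ≥0∞)) (x : ℝ) :
    powV p v₁ v₂ x ≠ ∞ :=
  ENNReal.rpow_ne_top_of_nonneg ENNReal.toReal_nonneg (tildeV_ne_top ha hav x)

/-- The function `Ṽ` is left-continuous, since the open ball `B(0,x)` is the union of the balls
`B(0,s)` with `s < x`. -/
theorem exists_lt_powV (hp : 0 < p.toReal) (ha : Continuous a)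
    (hav : ∀ᵐ x, (v₁ x)⁻¹ * v₂ x = (a x : ℝ≥0∞)) {x : ℝ} (hx : 0 < x) {c : ℝ≥0∞}
    (hc : c < powV p v₁ v₂ x) : ∃ s, 0 < s ∧ s < x ∧ c < powV p v₁ v₂ s := by
  rw [powV, tildeV_eq_iSup ha hav] at hc
  have h1 : c ^ p.toReal⁻¹ < ⨆ y ∈ Metric.ball (0 : E n) x, (a y : ℝ≥0∞) := by
    rwa [ENNReal.rpow_inv_lt_iff hp]
  simp only [lt_iSup_iff] at h1
  obtain ⟨y, hy, hcy⟩ := h1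
  rw [mem_ball_zero_iff] at hy
  refine ⟨(‖y‖ + x) / 2, by positivity, by linarith, ?_⟩
  rw [powV, ← ENNReal.rpow_inv_lt_iff hp, tildeV_eq_iSup ha hav]
  exact hcy.trans_le (le_iSup₂ (f := fun y (_ : y ∈ Metric.ball (0 : E n) _) => (a y : ℝ≥0∞)) y
    (by rw [mem_ball_zero_iff]; linarith))

theorem wnrm_eq (h0 : p ≠ 0) (ht : p ≠ ∞) (v : E n → ℝ≥0∞) (A : Set (E n)) (f : E n → ℝ) :
    wnrm p v A f = (∫⁻ x in A, (‖f x‖ₑ * v x) ^ p.toReal) ^ p.toReal⁻¹ :=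
  nrm_eq h0 ht A _

theorem nrm_mul_eq (h0 : θ ≠ 0) (ht : θ ≠ ∞) (hω : AEMeasurable ω (volume.restrict (Ioi 0)))
    {G : ℝ → ℝ≥0∞} (hG : Measurable G) (r : ℝ) :
    nrm θ (Ioi 0) (fun t => G t ^ r⁻¹ * ω t)
      = (∫⁻ t, G t ^ (θ.toReal / r) ∂(powMeasure θ.toReal ω)) ^ θ.toReal⁻¹ := by
  rw [nrm_eq h0 ht, lintegral_powMeasure hω (hG.pow_const _)]
  congr 1
  refine lintegral_congr fun t => ?_
  rw [ENNReal.mul_rpow_of_nonneg _ _ ENNReal.toReal_nonneg, ← ENNReal.rpow_mul, mul_comm,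
    inv_mul_eq_div]

theorem monotone_lintegral_ball (g : E n → ℝ≥0∞) :
    Monotone fun t => ∫⁻ x in Metric.ball (0 : E n) t, g x := fun _ _ h =>
  lintegral_mono_set (Metric.ball_subset_ball h)

theorem antitone_lintegral_compl_ball (g : E n → ℝ≥0∞) :
    Antitone fun t => ∫⁻ x in (Metric.ball (0 : E n) t)ᶜ, g x := fun _ _ h =>
  lintegral_mono_set (compl_subset_compl.2 (Metric.ball_subset_ball h))

theorem localNorm_eq (hp0 : p ≠ 0) (hpt : p ≠ ∞) (h0 : θ ≠ 0) (ht : θ ≠ ∞)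
    (hω : AEMeasurable ω (volume.restrict (Ioi 0))) (v : E n → ℝ≥0∞) (f : E n → ℝ) :
    localNorm p θ ω v f
      = (∫⁻ t, (∫⁻ x in Metric.ball 0 t, (‖f x‖ₑ * v x) ^ p.toReal) ^ (θ.toReal / p.toReal)
          ∂(powMeasure θ.toReal ω)) ^ θ.toReal⁻¹ := by
  rw [localNorm, ← nrm_mul_eq h0 ht hω (monotone_lintegral_ball _).measurable]
  simp_rw [wnrm_eq hp0 hpt]

theorem complNorm_eq (hp0 : p ≠ 0) (hpt : p ≠ ∞) (h0 : θ ≠ 0) (ht : θ ≠ ∞)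
    (hω : AEMeasurable ω (volume.restrict (Ioi 0))) (v : E n → ℝ≥0∞) (f : E n → ℝ) :
    complNorm p θ ω v f
      = (∫⁻ t, (∫⁻ x in (Metric.ball 0 t)ᶜ, (‖f x‖ₑ * v x) ^ p.toReal) ^ (θ.toReal / p.toReal)
          ∂(powMeasure θ.toReal ω)) ^ θ.toReal⁻¹ := by
  rw [complNorm, ← nrm_mul_eq h0 ht hω (antitone_lintegral_compl_ball _).measurable]
  simp_rw [wnrm_eq hp0 hpt]

theorem nontrivial_E (hn : 1 ≤ n) : Nontrivial (E n) := by
  have : Nonempty (Fin n) := ⟨⟨0, hn⟩⟩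
  infer_instance

/-- The radial distribution of a density `g` on `ℝⁿ`: the image of `g dx` under `x ↦ ‖x‖`. -/
def radialMeasure (g : E n → ℝ≥0∞) : Measure ℝ :=
  (volume.withDensity g).map norm

theorem radialMeasure_apply (g : E n → ℝ≥0∞) {A : Set ℝ} (hA : MeasurableSet A) :
    radialMeasure g A = ∫⁻ x in norm ⁻¹' A, g x := by
  rw [radialMeasure, Measure.map_apply measurable_norm hA,
    withDensity_apply _ (measurable_norm hA)]

theorem nullSingletonClass_radialMeasure (hn : 1 ≤ n) (g : E n → ℝ≥0∞) :
    NullSingletonClass (radialMeasure g) := by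
  have := nontrivial_E hn
  refine ⟨fun r => ?_⟩
  rw [radialMeasure_apply g (measurableSet_singleton r)]
  have h1 : (norm ⁻¹' {r} : Set (E n)) = Metric.sphere 0 r := by
    ext x
    simp
  rw [h1, Measure.restrict_eq_zero.2 (Measure.addHaar_sphere _ _ _), lintegral_zero_measure]

theorem radialMeasure_Iic_zero (hn : 1 ≤ n) (g : E n → ℝ≥0∞) : radialMeasure g (Iic 0) = 0 := by
  have := nontrivial_E hn
  rw [radialMeasure_apply g measurableSet_Iic]
  have h1 : (norm ⁻¹' (Iic 0) : Set (E n)) = {0} := by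
    ext x
    simp
  rw [h1, Measure.restrict_eq_zero.2 (measure_singleton _), lintegral_zero_measure]

theorem setLIntegral_radialMeasure {g : E n → ℝ≥0∞} (hg : AEMeasurable g) {V : ℝ → ℝ≥0∞}
    (hV : Measurable V) (t : ℝ) :
    ∫⁻ s in Iio t, V s ∂(radialMeasure g) = ∫⁻ x in Metric.ball (0 : E n) t, g x * V ‖x‖ := by
  have hpre : (norm ⁻¹' (Iio t) : Set (E n)) = Metric.ball 0 t := by
    ext x
    simp
  have hVn : Measurable fun x : E n => V ‖x‖ := hV.comp measurable_norm
  rw [radialMeasure, setLIntegral_map measurableSet_Iio hV measurable_norm, hpre,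
    restrict_withDensity Metric.isOpen_ball.measurableSet,
    lintegral_withDensity_eq_lintegral_mul₀ hg.restrict hVn.aemeasurable]
  rfl

theorem ae_eq_mul_of_inv_mul (hv₁ : IsWeight v₁) (hav : ∀ᵐ x, (v₁ x)⁻¹ * v₂ x = (a x : ℝ≥0∞)) :
    ∀ᵐ x, v₂ x = v₁ x * a x := by
  filter_upwards [hv₁.pos, hv₁.finite, hav] with x h0 ht hx
  rw [← hx, ← mul_assoc, ENNReal.mul_inv_cancel h0.ne' ht.ne, one_mul]

/-- The one-dimensional inequality for atomless measures implies the embedding, through the radial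
distribution of `(|f| v₁) ^ p`. -/
theorem morreyEmbeddingNorm_le (hn : 1 ≤ n) (hp0 : p ≠ 0) (hpt : p ≠ ∞) (h₁ : θ₁ ≠ 0)
    (h₁t : θ₁ ≠ ∞) (h₂ : θ₂ ≠ 0) (h₂t : θ₂ ≠ ∞) (hv₁ : IsWeight v₁)
    (ha : Continuous a) (hav : ∀ᵐ x, (v₁ x)⁻¹ * v₂ x = (a x : ℝ≥0∞))
    (hω₁ : MemComplOmega θ₁ ω₁) (hω₂ : MemOmega θ₂ ω₂) {D : ℝ≥0∞} (hD : D ≠ ∞)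
    (H : ∀ h : Measure ℝ, NullSingletonClass h → SFinite h → h (Iic 0) = 0 →
      ∫⁻ t, (∫⁻ s in Iio t, powV p v₁ v₂ s ∂h) ^ (θ₂.toReal / p.toReal)
          ∂(powMeasure θ₂.toReal ω₂)
        ≤ D ^ (θ₂.toReal / p.toReal)
          * (∫⁻ t, h (Ioi t) ^ (θ₁.toReal / p.toReal) ∂(powMeasure θ₁.toReal ω₁))
            ^ (θ₂.toReal / p.toReal / (θ₁.toReal / p.toReal))) :
    morreyEmbeddingNorm p θ₁ p θ₂ v₁ v₂ ω₁ ω₂ ≤ D ^ p.toReal⁻¹ := by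
  have := nontrivial_E hn
  have hP := ENNReal.toReal_pos hp0 hpt
  have hT₁ := ENNReal.toReal_pos h₁ h₁t
  have hT₂ := ENNReal.toReal_pos h₂ h₂t
  have hDt : D ^ p.toReal⁻¹ ≠ ∞ := ENNReal.rpow_ne_top_of_nonneg (by positivity) hD
  have hmain : ∀ f ∈ complSpace p θ₁ ω₁ v₁,
      localNorm p θ₂ ω₂ v₂ f ≤ D ^ p.toReal⁻¹ * complNorm p θ₁ ω₁ v₁ f := by
    intro f hf
    set g : E n → ℝ≥0∞ := fun x => (‖f x‖ₑ * v₁ x) ^ p.toReal with hg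
    have hgm : AEMeasurable g := (hf.1.enorm.mul hv₁.aemeasurable).pow_const _
    have hsf : SFinite (radialMeasure g) := by rw [radialMeasure]; infer_instance
    have h := H (radialMeasure g) (nullSingletonClass_radialMeasure hn g) hsf
      (radialMeasure_Iic_zero hn g)
    rw [localNorm_eq hp0 hpt h₂ h₂t hω₂.aemeasurable, complNorm_eq hp0 hpt h₁ h₁t hω₁.aemeasurable]
    have hlow : ∀ t, ∫⁻ x in Metric.ball 0 t, (‖f x‖ₑ * v₂ x) ^ p.toReal
        ≤ ∫⁻ s in Iio t, powV p v₁ v₂ s ∂(radialMeasure g) := by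
      intro t
      rw [setLIntegral_radialMeasure hgm powV_mono.measurable]
      refine lintegral_mono_ae ?_
      have hne : ∀ᵐ x : E n, x ≠ 0 := by
        rw [ae_iff]
        simp
      filter_upwards [ae_restrict_of_ae (ae_eq_mul_of_inv_mul hv₁ hav), ae_restrict_of_ae hne] with x hx hx0
      rw [hx, ← mul_assoc, ENNReal.mul_rpow_of_nonneg _ _ hP.le]
      exact mul_le_mul_right (ENNReal.rpow_le_rpow (le_tildeV ha hav hx0) hP.le) _
    have hup : ∀ t, radialMeasure g (Ioi t) ≤ ∫⁻ x in (Metric.ball 0 t)ᶜ, g x := by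
      intro t
      rw [radialMeasure_apply g measurableSet_Ioi]
      refine lintegral_mono_set fun x hx => ?_
      simp only [mem_preimage, mem_Ioi] at hx
      simpa using hx.le
    calc (∫⁻ t, (∫⁻ x in Metric.ball 0 t, (‖f x‖ₑ * v₂ x) ^ p.toReal) ^ (θ₂.toReal / p.toReal)
          ∂(powMeasure θ₂.toReal ω₂)) ^ θ₂.toReal⁻¹
        ≤ (D ^ (θ₂.toReal / p.toReal)
          * (∫⁻ t, (∫⁻ x in (Metric.ball 0 t)ᶜ, g x) ^ (θ₁.toReal / p.toReal)
              ∂(powMeasure θ₁.toReal ω₁))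
            ^ (θ₂.toReal / p.toReal / (θ₁.toReal / p.toReal))) ^ θ₂.toReal⁻¹ := by
          refine ENNReal.rpow_le_rpow (((lintegral_mono fun t => ENNReal.rpow_le_rpow (hlow t)
            (by positivity)).trans h).trans (mul_le_mul_right (ENNReal.rpow_le_rpow
            (lintegral_mono fun t => ENNReal.rpow_le_rpow (hup t) (by positivity)) (by positivity))
            _)) (by positivity)
      _ = _ := by
          rw [ENNReal.mul_rpow_of_nonneg _ _ (by positivity), ← ENNReal.rpow_mul,
            ← ENNReal.rpow_mul]
          congr 2 <;> field_simp
  refine sInf_le ⟨hDt.lt_top, fun f hf => ?_, hmain⟩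
  have hfin : localNorm p θ₂ ω₂ v₂ f < ∞ :=
    (hmain f hf).trans_lt (ENNReal.mul_lt_top hDt.lt_top hf.2.2)
  refine ⟨hf.1, fun K hK => ?_, hfin⟩
  -- finiteness of the norm forces finiteness on arbitrarily large balls
  rw [localNorm_eq hp0 hpt h₂ h₂t hω₂.aemeasurable] at hfin
  have h1 := rpow_inv_ne_top hT₂ hfin
  have h2 := ae_lt_top (((monotone_lintegral_ball fun x =>
    (‖f x‖ₑ * v₂ x) ^ p.toReal).measurable).pow_const _) h1
  obtain ⟨r, hr⟩ := hK.isBounded.subset_ball (0 : E n)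
  have hpos := hω₂.powMeasure_Ioi_ne_zero h₂ h₂t (x := max r 1) (by positivity)
  obtain ⟨t, ht, htfin⟩ : ∃ t ∈ Ioi (max r 1),
      (∫⁻ x in Metric.ball 0 t, (‖f x‖ₑ * v₂ x) ^ p.toReal) ^ (θ₂.toReal / p.toReal) < ∞ := by
    by_contra! hcon
    refine hpos (measure_mono_null (fun t ht => ?_) (ae_iff.1 h2))
    exact not_lt.2 (hcon t ht)
  have h3 : ∫⁻ x in Metric.ball 0 t, (‖f x‖ₑ * v₂ x) ^ p.toReal ≠ ∞ := fun h => by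
    rw [h, ENNReal.top_rpow_of_pos (by positivity)] at htfin
    exact lt_irrefl _ htfin
  rw [wnrm_eq hp0 hpt]
  refine (ENNReal.rpow_ne_top_of_nonneg (by positivity) (ne_top_of_le_ne_top h3 ?_)).lt_top
  exact lintegral_mono_set (hr.trans (Metric.ball_subset_ball
    ((le_max_left _ _).trans (le_of_lt ht))))

end Spatial

/-! ### From the embedding to the one-dimensional inequality -/

section Spatial

variable {n : ℕ} {p θ₁ θ₂ : ℝ≥0∞} {v₁ v₂ : E n → ℝ≥0∞} {ω₁ ω₂ : ℝ → ℝ≥0∞} {a : E n → ℝ≥0}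

/-- The pairs `(s, y)` such that `y` lies in the ball `B(0,s)` and `a(y)` is at least half of the
supremum `u(s)` of `a` over this ball. -/
def nearSup (u : ℝ → ℝ≥0∞) (a : E n → ℝ≥0) : Set (ℝ × E n) :=
  {z | ‖z.2‖ < z.1 ∧ u z.1 < 2 * a z.2}

/-- The kernel `y ↦ k(s, y)` is the normalized indicator of the section of `nearSup` at `s`. -/
def nearSupKernel (u : ℝ → ℝ≥0∞) (a : E n → ℝ≥0) (s : ℝ) (y : E n) : ℝ≥0∞ :=
  (nearSup u a).indicator (fun z => (volume (Prod.mk z.1 ⁻¹' nearSup u a))⁻¹) (s, y)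

theorem measurableSet_nearSup {u : ℝ → ℝ≥0∞} (hu : Measurable u) (ha : Continuous a) :
    MeasurableSet (nearSup u a) := by
  have h1 : Measurable fun z : ℝ × E n => (2 : ℝ≥0∞) * a z.2 :=
    ((ENNReal.continuous_coe.comp ha).measurable.comp measurable_snd).const_mul _
  exact (measurableSet_lt measurable_snd.norm measurable_fst).inter
    (measurableSet_lt (hu.comp measurable_fst) h1)

theorem measurable_nearSupKernel {u : ℝ → ℝ≥0∞} (hu : Measurable u) (ha : Continuous a) :
    Measurable (Function.uncurry (nearSupKernel u a)) := by
  have hm := measurableSet_nearSup hu ha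
  exact ((measurable_measure_prodMk_left hm).inv.comp measurable_fst).indicator hm

theorem nearSupKernel_eq (u : ℝ → ℝ≥0∞) (a : E n → ℝ≥0) (s : ℝ) :
    nearSupKernel u a s = (Prod.mk s ⁻¹' nearSup u a).indicator
      fun _ => (volume (Prod.mk s ⁻¹' nearSup u a))⁻¹ := by
  ext y
  by_cases h : (s, y) ∈ nearSup u a
  · rw [nearSupKernel, indicator_of_mem h, indicator_of_mem (show y ∈ Prod.mk s ⁻¹' nearSup u a from h)]
  · rw [nearSupKernel, indicator_of_notMem h,
      indicator_of_notMem (show y ∉ Prod.mk s ⁻¹' nearSup u a from h)]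

theorem setLIntegral_nearSupKernel_le {u : ℝ → ℝ≥0∞} (hu : Measurable u) (ha : Continuous a)
    (s t : ℝ) :
    ∫⁻ y in (Metric.ball 0 t)ᶜ, nearSupKernel u a s y ≤ (Ioi t).indicator 1 s := by
  have hm : MeasurableSet (Prod.mk s ⁻¹' nearSup u a) :=
    measurable_prodMk_left (measurableSet_nearSup hu ha)
  by_cases hs : t < s
  · rw [indicator_of_mem (mem_Ioi.2 hs), Pi.one_apply]
    refine (setLIntegral_le_lintegral _ _).trans ?_
    rw [nearSupKernel_eq, lintegral_indicator hm, setLIntegral_const]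
    exact ENNReal.inv_mul_le_one _
  · rw [indicator_of_notMem (by simpa using hs), nonpos_iff_eq_zero]
    refine (setLIntegral_congr_fun Metric.isOpen_ball.measurableSet.compl fun y hy => ?_).trans
      lintegral_zero
    refine indicator_of_notMem (fun h => hy ?_) _
    rw [mem_ball_zero_iff]
    exact (show ‖y‖ < s from h.1).trans_le (not_lt.1 hs)

/-- The average of `a ^ p` against the kernel recovers `Ṽ(s) ^ p` up to the factor `2 ^ p`. -/
theorem powV_le_setLIntegral (hp : 0 < p.toReal) (ha : Continuous a)
    (hav : ∀ᵐ x, (v₁ x)⁻¹ * v₂ x = (a x : ℝ≥0∞)) {s t : ℝ} (hst : s ≤ t) :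
    powV p v₁ v₂ s ≤ 2 ^ p.toReal * ∫⁻ y in Metric.ball 0 t,
      nearSupKernel (tildeV p p v₁ v₂) a s y * (a y : ℝ≥0∞) ^ p.toReal := by
  set u := tildeV p p v₁ v₂ with hu
  set S : Set (E n) := Prod.mk s ⁻¹' nearSup u a with hS
  rcases eq_or_ne (u s) 0 with h0 | h0
  · rw [powV, ← hu, h0, ENNReal.zero_rpow_of_pos hp]
    exact zero_le
  have ha' : Continuous fun y => (2 : ℝ≥0∞) * a y :=
    (ENNReal.continuous_const_mul (by simp)).comp (ENNReal.continuous_coe.comp ha)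
  have hSball : S ⊆ Metric.ball 0 s := fun y hy => by
    rw [mem_ball_zero_iff]
    exact hy.1
  have hopen : IsOpen S := show IsOpen ({y : E n | ‖y‖ < s} ∩ {y | u s < 2 * a y}) from
    (isOpen_lt continuous_norm continuous_const).inter (isOpen_lt continuous_const ha')
  have hne : S.Nonempty := by
    by_contra hcon
    rw [not_nonempty_iff_eq_empty] at hcon
    have h1 : u s ≤ u s / 2 := by
      nth_rw 1 [hu]
      rw [tildeV_eq_iSup ha hav]
      refine iSup₂_le fun y hy => ?_
      rw [mem_ball_zero_iff] at hy
      have hyS : y ∉ S := by rw [hcon]; simp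
      have h2 : (2 : ℝ≥0∞) * a y ≤ u s := by
        by_contra h3
        exact hyS ⟨hy, not_le.1 h3⟩
      rw [ENNReal.le_div_iff_mul_le (by simp) (by simp), mul_comm]
      exact h2
    exact absurd h1 (not_le.2 (ENNReal.half_lt_self h0 (tildeV_ne_top ha hav s)))
  have hvol0 : volume S ≠ 0 := (hopen.measure_pos volume hne).ne'
  have hvolt : volume S ≠ ∞ :=
    ne_top_of_le_ne_top measure_ball_lt_top.ne (measure_mono hSball)
  calc powV p v₁ v₂ s = 2 ^ p.toReal * ((volume S)⁻¹ * (u s / 2) ^ p.toReal * volume S) := by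
        rw [mul_right_comm, ENNReal.inv_mul_cancel hvol0 hvolt, one_mul,
          ← ENNReal.mul_rpow_of_nonneg _ _ hp.le, ENNReal.mul_div_cancel (by simp) (by simp), powV]
    _ = 2 ^ p.toReal * ∫⁻ _ in S, (volume S)⁻¹ * (u s / 2) ^ p.toReal := by
        rw [setLIntegral_const]
    _ ≤ 2 ^ p.toReal * ∫⁻ y in S, nearSupKernel u a s y * (a y : ℝ≥0∞) ^ p.toReal := by
        refine mul_le_mul_right (setLIntegral_mono' hopen.measurableSet fun y hy => ?_) _
        rw [nearSupKernel_eq, indicator_of_mem hy]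
        refine mul_le_mul_right (ENNReal.rpow_le_rpow ?_ hp.le) _
        rw [ENNReal.div_le_iff_le_mul (by simp) (by simp), mul_comm]
        exact (show u s < 2 * a y from hy.2).le
    _ ≤ _ := mul_le_mul_right
        (lintegral_mono_set (hSball.trans (Metric.ball_subset_ball hst))) _

theorem sigmaFinite_of_measure_Ioi_ne_top {h : Measure ℝ} (h0 : h (Iic 0) = 0)
    (hfin : ∀ t, 0 < t → h (Ioi t) ≠ ∞) : SigmaFinite h := by
  refine ⟨⟨⟨fun k : ℕ => Iic 0 ∪ Ioi (1 / ((k : ℝ) + 1)), fun _ => mem_univ _, fun k => ?_, ?_⟩⟩⟩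
  · refine (measure_union_le _ _).trans_lt ?_
    rw [h0, zero_add]
    exact (hfin _ (by positivity)).lt_top
  · refine eq_univ_of_forall fun x => mem_iUnion.2 ?_
    rcases le_or_gt x 0 with hx | hx
    · exact ⟨0, Or.inl hx⟩
    · obtain ⟨k, hk⟩ := exists_nat_one_div_lt hx
      exact ⟨k, Or.inr hk⟩

/-- A measure `h` on the half-line is realized by a density on `ℝⁿ`, by spreading the mass at `s`
uniformly over the points of the ball `B(0,s)` at which `v₁⁻¹ v₂` is at least half of `Ṽ(s)`. -/
theorem exists_density_of_measure (hp : 0 < p.toReal) (ha : Continuous a)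
    (hav : ∀ᵐ x, (v₁ x)⁻¹ * v₂ x = (a x : ℝ≥0∞)) (h : Measure ℝ) [SFinite h] :
    ∃ g : E n → ℝ≥0∞, Measurable g ∧ (∀ t, ∫⁻ y in (Metric.ball 0 t)ᶜ, g y ≤ h (Ioi t)) ∧
      ∀ t, ∫⁻ s in Iic t, powV p v₁ v₂ s ∂h
        ≤ 2 ^ p.toReal * ∫⁻ y in Metric.ball 0 t, g y * (a y : ℝ≥0∞) ^ p.toReal := by
  obtain ⟨k, hkm, hk1, hk2⟩ : ∃ k : ℝ → E n → ℝ≥0∞, Measurable (Function.uncurry k) ∧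
      (∀ s t, ∫⁻ y in (Metric.ball 0 t)ᶜ, k s y ≤ (Ioi t).indicator 1 s) ∧
      ∀ s t, s ≤ t → powV p v₁ v₂ s
        ≤ 2 ^ p.toReal * ∫⁻ y in Metric.ball 0 t, k s y * (a y : ℝ≥0∞) ^ p.toReal :=
    ⟨nearSupKernel (tildeV p p v₁ v₂) a, measurable_nearSupKernel tildeV_mono.measurable ha,
      setLIntegral_nearSupKernel_le tildeV_mono.measurable ha,
      fun s t hst => powV_le_setLIntegral hp ha hav hst⟩
  have hkm' : Measurable (Function.uncurry fun (y : E n) (s : ℝ) => k s y) :=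
    hkm.comp measurable_swap
  have hap : Measurable fun y => (a y : ℝ≥0∞) ^ p.toReal :=
    (ENNReal.continuous_coe.comp ha).measurable.pow_const _
  refine ⟨fun y => ∫⁻ s, k s y ∂h, hkm'.lintegral_prod_right', fun t => ?_, fun t => ?_⟩
  · calc ∫⁻ y in (Metric.ball 0 t)ᶜ, ∫⁻ s, k s y ∂h
        = ∫⁻ s, (∫⁻ y in (Metric.ball 0 t)ᶜ, k s y) ∂h :=
          lintegral_lintegral_swap hkm'.aemeasurable
      _ ≤ ∫⁻ s, (Ioi t).indicator 1 s ∂h :=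
          lintegral_mono fun s => hk1 s t
      _ = h (Ioi t) := lintegral_indicator_one measurableSet_Ioi
  · have h2 : Measurable (Function.uncurry fun (s : ℝ) (y : E n) =>
        k s y * (a y : ℝ≥0∞) ^ p.toReal) := hkm.mul (hap.comp measurable_snd)
    calc ∫⁻ s in Iic t, powV p v₁ v₂ s ∂h
        ≤ ∫⁻ s in Iic t, 2 ^ p.toReal * (∫⁻ y in Metric.ball 0 t,
            k s y * (a y : ℝ≥0∞) ^ p.toReal) ∂h :=
          setLIntegral_mono' measurableSet_Iic fun s hs => hk2 s t hs
      _ = 2 ^ p.toReal * ∫⁻ s in Iic t, (∫⁻ y in Metric.ball 0 t,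
            k s y * (a y : ℝ≥0∞) ^ p.toReal) ∂h :=
          lintegral_const_mul' _ _ (ENNReal.rpow_ne_top_of_nonneg hp.le (by simp))
      _ ≤ 2 ^ p.toReal * ∫⁻ s, (∫⁻ y in Metric.ball 0 t,
            k s y * (a y : ℝ≥0∞) ^ p.toReal) ∂h :=
          mul_le_mul_right (setLIntegral_le_lintegral _ _) _
      _ = 2 ^ p.toReal * ∫⁻ y in Metric.ball 0 t, ∫⁻ s, k s y * (a y : ℝ≥0∞) ^ p.toReal ∂h := by
          rw [lintegral_lintegral_swap h2.aemeasurable]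
      _ = _ := by
          congr 1
          refine lintegral_congr fun y => ?_
          rw [lintegral_mul_const' _ _
            (ENNReal.rpow_ne_top_of_nonneg hp.le ENNReal.coe_ne_top)]

/-- A bound for the embedding implies the one-dimensional inequality. -/
theorem operatorBound_of_embedding (hn : 1 ≤ n) (hp0 : p ≠ 0) (hpt : p ≠ ∞) (h₁ : θ₁ ≠ 0)
    (h₁t : θ₁ ≠ ∞) (h₂ : θ₂ ≠ 0) (h₂t : θ₂ ≠ ∞) (hv₁ : IsWeight v₁)
    (ha : Continuous a) (hav : ∀ᵐ x, (v₁ x)⁻¹ * v₂ x = (a x : ℝ≥0∞))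
    (hω₁ : MemComplOmega θ₁ ω₁) (hω₂ : MemOmega θ₂ ω₂) {c : ℝ≥0∞}
    (hc : ∀ f ∈ complSpace p θ₁ ω₁ v₁, localNorm p θ₂ ω₂ v₂ f ≤ c * complNorm p θ₁ ω₁ v₁ f) :
    OperatorBound (powMeasure θ₁.toReal ω₁) (powMeasure θ₂.toReal ω₂) (powV p v₁ v₂)
      (θ₁.toReal / p.toReal) (θ₂.toReal / p.toReal) ((2 * c) ^ p.toReal) := by
  intro h h0 hfin
  have := nontrivial_E hn
  have hP := ENNReal.toReal_pos hp0 hpt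
  have hT₁ := ENNReal.toReal_pos h₁ h₁t
  have hT₂ := ENNReal.toReal_pos h₂ h₂t
  have hm := hω₁.isHalfLine h₁ h₁t
  have hhfin : ∀ t, 0 < t → h (Ioi t) ≠ ∞ := by
    intro t ht htop
    have h1 := ae_lt_top ((measurable_measure_Ioi h).pow_const _) hfin
    refine hm.pos t ht (measure_mono_null (fun s hs => ?_) (ae_iff.1 h1))
    have h2 : h (Ioi s) = ∞ := top_le_iff.1 (htop ▸ measure_mono (Ioi_subset_Ioi (le_of_lt hs)))
    show ¬ h (Ioi s) ^ (θ₁.toReal / p.toReal) < ∞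
    rw [h2, ENNReal.top_rpow_of_pos (by positivity)]
    exact lt_irrefl _
  have hsig := sigmaFinite_of_measure_Ioi_ne_top h0 hhfin
  obtain ⟨g, hgm, hup, hlow⟩ := exists_density_of_measure hP ha hav h
  -- the density `g` is finite almost everywhere, so it comes from a real function `f`
  have hgfin : ∀ᵐ y, g y < ∞ := by
    have h1 : ∀ j : ℕ, ∀ᵐ y, y ∈ (Metric.ball (0 : E n) (1 / ((j : ℝ) + 1)))ᶜ → g y < ∞ := fun j => by
      rw [← ae_restrict_iff' Metric.isOpen_ball.measurableSet.compl]
      exact ae_lt_top hgm (ne_top_of_le_ne_top (hhfin _ (by positivity)) (hup _))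
    have hne : ∀ᵐ y : E n, y ≠ 0 := by
      rw [ae_iff]
      simp
    filter_upwards [ae_all_iff.2 h1, hne] with y hy hy0
    obtain ⟨j, hj⟩ := exists_nat_one_div_lt (norm_pos_iff.2 hy0)
    refine hy j fun hmem => ?_
    rw [mem_ball_zero_iff] at hmem
    exact lt_asymm hj hmem
  set f : E n → ℝ := fun y => (g y ^ p.toReal⁻¹ / v₁ y).toReal with hf
  have hfm : AEMeasurable f :=
    ((hgm.pow_const _).aemeasurable.div hv₁.aemeasurable).ennreal_toReal
  have hfg : ∀ᵐ y, (‖f y‖ₑ * v₁ y) ^ p.toReal = g y := by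
    filter_upwards [hgfin, hv₁.pos, hv₁.finite] with y hy hv0 hvt
    have h1 : g y ^ p.toReal⁻¹ / v₁ y ≠ ∞ := ENNReal.div_ne_top
      (ENNReal.rpow_ne_top_of_nonneg (by positivity) hy.ne) hv0.ne'
    rw [hf]
    simp only
    rw [Real.enorm_of_nonneg ENNReal.toReal_nonneg, ENNReal.ofReal_toReal h1,
      ENNReal.div_mul_cancel hv0.ne' hvt.ne, ← ENNReal.rpow_mul, inv_mul_cancel₀ hP.ne',
      ENNReal.rpow_one]
  have hfg₂ : ∀ᵐ y, (‖f y‖ₑ * v₂ y) ^ p.toReal = g y * (a y : ℝ≥0∞) ^ p.toReal := by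
    filter_upwards [hfg, ae_eq_mul_of_inv_mul hv₁ hav] with y hy hv
    rw [hv, ← mul_assoc, ENNReal.mul_rpow_of_nonneg _ _ hP.le, hy]
  have hcompl : ∀ t, ∫⁻ y in (Metric.ball 0 t)ᶜ, (‖f y‖ₑ * v₁ y) ^ p.toReal ≤ h (Ioi t) :=
    fun t => (lintegral_congr_ae (ae_restrict_of_ae hfg)).trans_le (hup t)
  have hnorm : complNorm p θ₁ ω₁ v₁ f
      ≤ (∫⁻ t, h (Ioi t) ^ (θ₁.toReal / p.toReal) ∂(powMeasure θ₁.toReal ω₁)) ^ θ₁.toReal⁻¹ := by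
    rw [complNorm_eq hp0 hpt h₁ h₁t hω₁.aemeasurable]
    exact ENNReal.rpow_le_rpow (lintegral_mono fun t => ENNReal.rpow_le_rpow (hcompl t)
      (by positivity)) (by positivity)
  have hfX : f ∈ complSpace p θ₁ ω₁ v₁ := by
    refine ⟨hfm, fun t ht => ?_, hnorm.trans_lt
      (ENNReal.rpow_ne_top_of_nonneg (by positivity) hfin).lt_top⟩
    rw [wnrm_eq hp0 hpt]
    exact (ENNReal.rpow_ne_top_of_nonneg (by positivity)
      (ne_top_of_le_ne_top (hhfin t ht) (hcompl t))).lt_top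
  have hmain := (hc f hfX).trans (mul_le_mul_right hnorm c)
  rw [localNorm_eq hp0 hpt h₂ h₂t hω₂.aemeasurable] at hmain
  have hmain2 := ENNReal.rpow_le_rpow hmain hT₂.le
  rw [← ENNReal.rpow_mul, inv_mul_cancel₀ hT₂.ne', ENNReal.rpow_one,
    ENNReal.mul_rpow_of_nonneg _ _ hT₂.le, ← ENNReal.rpow_mul] at hmain2
  calc ∫⁻ t, (∫⁻ s in Iic t, powV p v₁ v₂ s ∂h) ^ (θ₂.toReal / p.toReal)
        ∂(powMeasure θ₂.toReal ω₂)
      ≤ ∫⁻ t, 2 ^ θ₂.toReal * (∫⁻ y in Metric.ball 0 t, (‖f y‖ₑ * v₂ y) ^ p.toReal)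
          ^ (θ₂.toReal / p.toReal) ∂(powMeasure θ₂.toReal ω₂) := by
        refine lintegral_mono fun t => ?_
        have h1 : (2 : ℝ≥0∞) ^ θ₂.toReal = (2 ^ p.toReal) ^ (θ₂.toReal / p.toReal) := by
          rw [← ENNReal.rpow_mul, mul_div_cancel₀ _ hP.ne']
        rw [h1, ← ENNReal.mul_rpow_of_nonneg _ _ (by positivity),
          lintegral_congr_ae (ae_restrict_of_ae hfg₂)]
        exact ENNReal.rpow_le_rpow (hlow t) (by positivity)
    _ = 2 ^ θ₂.toReal * ∫⁻ t, (∫⁻ y in Metric.ball 0 t, (‖f y‖ₑ * v₂ y) ^ p.toReal)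
          ^ (θ₂.toReal / p.toReal) ∂(powMeasure θ₂.toReal ω₂) :=
        lintegral_const_mul' _ _ (ENNReal.rpow_ne_top_of_nonneg hT₂.le (by simp))
    _ ≤ 2 ^ θ₂.toReal * (c ^ θ₂.toReal * (∫⁻ t, h (Ioi t) ^ (θ₁.toReal / p.toReal)
          ∂(powMeasure θ₁.toReal ω₁)) ^ (θ₁.toReal⁻¹ * θ₂.toReal)) := mul_le_mul_right hmain2 _
    _ = _ := by
        rw [← mul_assoc, ← ENNReal.mul_rpow_of_nonneg _ _ hT₂.le, ← ENNReal.rpow_mul]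
        congr 2 <;> field_simp

end Spatial

/-! ### The equivalence of the embedding norm and the conditions -/

theorem add_rpow_le {r : ℝ} (hr : 0 ≤ r) (x y : ℝ≥0∞) : (x + y) ^ r ≤ 2 ^ r * (x ^ r + y ^ r) := by
  calc (x + y) ^ r ≤ (2 * max x y) ^ r := by
        refine ENNReal.rpow_le_rpow ?_ hr
        rw [two_mul]
        exact add_le_add (le_max_left _ _) (le_max_right _ _)
    _ = 2 ^ r * max x y ^ r := ENNReal.mul_rpow_of_nonneg _ _ hr
    _ ≤ _ := by
        refine mul_le_mul_right ?_ _
        rcases max_cases x y with h | h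
        · rw [h.1]
          exact le_self_add
        · rw [h.1]
          exact le_add_self

/-- Taking roots termwise in a sum of three terms changes it at most by constant factors. -/
theorem exists_add_rpow_equiv {r : ℝ} (hr : 0 ≤ r) :
    ∃ k : ℝ≥0, ∀ x y z : ℝ≥0∞, (x + y + z) ^ r ≤ k * (x ^ r + y ^ r + z ^ r) ∧
      x ^ r + y ^ r + z ^ r ≤ k * (x + y + z) ^ r := by
  have h2 : (1 : ℝ≥0∞) ≤ 2 ^ r := 
    (ENNReal.one_rpow r).symm.trans_le (ENNReal.rpow_le_rpow (by norm_num) hr)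
  refine ⟨2 ^ r * 2 ^ r + 3, fun x y z => ⟨?_, ?_⟩⟩
  · calc (x + y + z) ^ r ≤ 2 ^ r * (2 ^ r * (x ^ r + y ^ r) + z ^ r) :=
          (add_rpow_le hr _ _).trans
            (mul_le_mul_right (add_le_add_left (add_rpow_le hr _ _) _) _)
      _ ≤ 2 ^ r * (2 ^ r * (x ^ r + y ^ r) + 2 ^ r * z ^ r) := by
          refine mul_le_mul_right (add_le_add_right ?_ _) _
          exact le_mul_of_one_le_left' h2
      _ = 2 ^ r * 2 ^ r * (x ^ r + y ^ r + z ^ r) := by ring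
      _ ≤ _ := by
          refine mul_le_mul_left ?_ _
          push_cast
          rw [ENNReal.coe_rpow_of_nonneg _ hr]
          exact le_self_add
  · have h1 : x ^ r ≤ (x + y + z) ^ r :=
      ENNReal.rpow_le_rpow (le_self_add.trans le_self_add) hr
    have h2 : y ^ r ≤ (x + y + z) ^ r :=
      ENNReal.rpow_le_rpow (le_add_self.trans le_self_add) hr
    have h3 : z ^ r ≤ (x + y + z) ^ r := ENNReal.rpow_le_rpow le_add_self hr
    calc x ^ r + y ^ r + z ^ r ≤ 3 * (x + y + z) ^ r :=
          (add_le_add (add_le_add h1 h2) h3).trans_eq (by ring)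
      _ ≤ _ := by
          refine mul_le_mul_left ?_ _
          push_cast
          exact le_add_self

section Exponents

variable {p θ₁ θ₂ : ℝ≥0∞}

theorem one_lt_div_toReal (hp0 : p ≠ 0) (h : p < θ₁) (ht : θ₁ ≠ ∞) :
    1 < θ₁.toReal / p.toReal := by
  have hP := ENNReal.toReal_pos hp0 (h.trans_le le_top).ne
  rw [lt_div_iff₀ hP, one_mul]
  exact ENNReal.toReal_strict_mono ht h

theorem arrow_toReal_eq (hp0 : p ≠ 0) (h : p < θ₁) (ht : θ₁ ≠ ∞) :
    (arrow θ₁ p).toReal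
      = p.toReal * (θ₁.toReal / p.toReal / (θ₁.toReal / p.toReal - 1)) := by
  have hP := ENNReal.toReal_pos hp0 (h.trans_le le_top).ne
  have hlt := ENNReal.toReal_strict_mono ht h
  have hT : 0 < θ₁.toReal := hP.trans hlt
  have h1 : 0 < θ₁.toReal - p.toReal := by linarith
  rw [arrow_toReal hp0 h]
  have e1 : p.toReal⁻¹ - θ₁.toReal⁻¹ = (θ₁.toReal - p.toReal) / (p.toReal * θ₁.toReal) := by
    field_simp
  have e2 : θ₁.toReal / p.toReal - 1 = (θ₁.toReal - p.toReal) / p.toReal := by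
    field_simp
  rw [e1, e2]
  field_simp

end Exponents

section Equivalence

variable {n : ℕ} {p θ₁ θ₂ : ℝ≥0∞} {v₁ v₂ : E n → ℝ≥0∞} {ω₁ ω₂ : ℝ → ℝ≥0∞} {a : E n → ℝ≥0}

/-- The embedding norm is equivalent to the `p`-th root of every quantity `A` that is equivalent to
the best constant of the one-dimensional inequality. -/
theorem equivWith_of_operator (hn : 1 ≤ n) (hp0 : p ≠ 0) (hpt : p ≠ ∞) (h₁ : θ₁ ≠ 0)
    (h₁t : θ₁ ≠ ∞) (h₂ : θ₂ ≠ 0) (h₂t : θ₂ ≠ ∞) (hv₁ : IsWeight v₁)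
    (ha : Continuous a) (hav : ∀ᵐ x, (v₁ x)⁻¹ * v₂ x = (a x : ℝ≥0∞))
    (hω₁ : MemComplOmega θ₁ ω₁) (hω₂ : MemOmega θ₂ ω₂) {A R : ℝ≥0∞} {C C' k : ℝ≥0}
    (hup : A ≠ ∞ → ∀ h : Measure ℝ, NullSingletonClass h → SFinite h → h (Iic 0) = 0 →
      ∫⁻ t, (∫⁻ s in Iio t, powV p v₁ v₂ s ∂h) ^ (θ₂.toReal / p.toReal)
          ∂(powMeasure θ₂.toReal ω₂)
        ≤ C * A ^ (θ₂.toReal / p.toReal)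
          * (∫⁻ t, h (Ioi t) ^ (θ₁.toReal / p.toReal) ∂(powMeasure θ₁.toReal ω₁))
            ^ (θ₂.toReal / p.toReal / (θ₁.toReal / p.toReal)))
    (hlow : ∀ K, OperatorBound (powMeasure θ₁.toReal ω₁) (powMeasure θ₂.toReal ω₂) (powV p v₁ v₂)
      (θ₁.toReal / p.toReal) (θ₂.toReal / p.toReal) K → A ≤ C' * K)
    (hR : A ^ p.toReal⁻¹ ≤ k * R) (hR' : R ≤ k * A ^ p.toReal⁻¹) :
    EquivWith (k * (C' ^ p.toReal⁻¹ * 2) + 1)⁻¹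
      ((C ^ (θ₂.toReal / p.toReal)⁻¹) ^ p.toReal⁻¹ * k + 1)
      (morreyEmbeddingNorm p θ₁ p θ₂ v₁ v₂ ω₁ ω₂) R := by
  have hP := ENNReal.toReal_pos hp0 hpt
  have hT₂ := ENNReal.toReal_pos h₂ h₂t
  have hPi : 0 ≤ p.toReal⁻¹ := by positivity
  have hβ : 0 < θ₂.toReal / p.toReal := by positivity
  set N := morreyEmbeddingNorm p θ₁ p θ₂ v₁ v₂ ω₁ ω₂ with hN
  constructor
  · refine le_sInf fun c hc => ?_
    have h1 := hlow _ (operatorBound_of_embedding hn hp0 hpt h₁ h₁t h₂ h₂t hv₁ ha hav hω₁ hω₂ hc.2.2)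
    have h2 : A ^ p.toReal⁻¹ ≤ ((C' ^ p.toReal⁻¹ * 2 : ℝ≥0) : ℝ≥0∞) * c := by
      refine (ENNReal.rpow_le_rpow h1 hPi).trans_eq ?_
      rw [ENNReal.mul_rpow_of_nonneg _ _ hPi, ← ENNReal.rpow_mul, mul_inv_cancel₀ hP.ne',
        ENNReal.rpow_one, ENNReal.coe_mul, ENNReal.coe_rpow_of_nonneg _ hPi, ENNReal.coe_ofNat,
        mul_assoc]
    rw [ENNReal.coe_inv (by positivity), mul_comm, ← div_eq_mul_inv,
      ENNReal.div_le_iff_le_mul (Or.inl (by simp)) (Or.inl ENNReal.coe_ne_top), mul_comm]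
    calc R ≤ k * (((C' ^ p.toReal⁻¹ * 2 : ℝ≥0) : ℝ≥0∞) * c) := hR'.trans (mul_le_mul_right h2 _)
      _ = ((k * (C' ^ p.toReal⁻¹ * 2) : ℝ≥0) : ℝ≥0∞) * c := by
          rw [← mul_assoc, ← ENNReal.coe_mul]
      _ ≤ _ := mul_le_mul_left (ENNReal.coe_le_coe.2 le_self_add) _
  · rcases eq_or_ne R ∞ with hRt | hRt
    · rw [hRt, ENNReal.mul_top (by simp)]
      exact le_top
    have hA : A ≠ ∞ := by
      rintro rfl
      rw [ENNReal.top_rpow_of_pos (by positivity)] at hR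
      exact ENNReal.mul_ne_top ENNReal.coe_ne_top hRt (top_le_iff.1 hR)
    have h1 : N ≤ (((C ^ (θ₂.toReal / p.toReal)⁻¹ : ℝ≥0) : ℝ≥0∞) * A) ^ p.toReal⁻¹ := by
      refine morreyEmbeddingNorm_le hn hp0 hpt h₁ h₁t h₂ h₂t hv₁ ha hav hω₁ hω₂
        (ENNReal.mul_ne_top ENNReal.coe_ne_top hA) fun h hh hs hz => (hup hA h hh hs hz).trans_eq ?_
      rw [ENNReal.mul_rpow_of_nonneg _ _ hβ.le, ENNReal.coe_rpow_of_nonneg _ (by positivity),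
        ← ENNReal.rpow_mul, inv_mul_cancel₀ hβ.ne', ENNReal.rpow_one]
    calc N ≤ _ := h1
      _ = (((C ^ (θ₂.toReal / p.toReal)⁻¹) ^ p.toReal⁻¹ : ℝ≥0) : ℝ≥0∞) * A ^ p.toReal⁻¹ := by
          rw [ENNReal.mul_rpow_of_nonneg _ _ hPi, ENNReal.coe_rpow_of_nonneg _ hPi]
      _ ≤ (((C ^ (θ₂.toReal / p.toReal)⁻¹) ^ p.toReal⁻¹ : ℝ≥0) : ℝ≥0∞) * (k * R) :=
          mul_le_mul_right hR _
      _ = (((C ^ (θ₂.toReal / p.toReal)⁻¹) ^ p.toReal⁻¹ * k : ℝ≥0) : ℝ≥0∞) * R := by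
          rw [← mul_assoc, ENNReal.coe_mul]
      _ ≤ _ := mul_le_mul_left (ENNReal.coe_le_coe.2 le_self_add) _

theorem dNeg_eq (hp0 : p ≠ 0) (h : p < θ₁) (ht : θ₁ ≠ ∞) (hω₁ : MemComplOmega θ₁ ω₁) :
    dNeg θ₁ p ω₁ = dualMeasure (powMeasure θ₁.toReal ω₁) (θ₁.toReal / p.toReal).conjExponent := by
  have hP := ENNReal.toReal_pos hp0 (h.trans_le le_top).ne
  have ha1 := one_lt_div_toReal hp0 h ht
  have hT : 0 < θ₁.toReal := hP.trans (ENNReal.toReal_strict_mono ht h)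
  have hab := Real.HolderConjugate.conjExponent ha1
  refine dNeg_eq_dualMeasure (zero_le.trans_lt h).ne' ht hω₁ hab.symm.lt ?_
  rw [arrow_toReal_eq hp0 h ht, ← Real.conjExponent]
  have h1 := hab.symm.div_conj_eq_sub_one
  calc θ₁.toReal⁻¹ * -(p.toReal * (θ₁.toReal / p.toReal).conjExponent)
      = -((θ₁.toReal / p.toReal).conjExponent / (θ₁.toReal / p.toReal)) := by field_simp
    _ = _ := by
      rw [h1]
      ring

end Equivalence

end Morrey

end

open Morrey in
theorem theorem2p9 (p θ₁ θ₂ : ℝ≥0∞) (hp : 0 < p) (hpθ : p < min θ₁ θ₂)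
    (hθ₁ : θ₁ < ∞) (hθ₂ : θ₂ < ∞) :
    ∃ c C : ℝ≥0, 0 < c ∧ 0 < C ∧
      ∀ (n : ℕ) (_ : 1 ≤ n) (v₁ v₂ : E n → ℝ≥0∞) (ω₁ ω₂ : ℝ → ℝ≥0∞)
        (_ : IsWeight v₁) (_ : IsWeight v₂)
        (_ : ∃ a : E n → ℝ≥0, Continuous a ∧ ∀ᵐ x, (v₁ x)⁻¹ * v₂ x = (a x : ℝ≥0∞))
        (_ : MemComplOmega θ₁ ω₁) (_ : MemOmega θ₂ ω₂),
        (θ₁ ≤ θ₂ →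
          EquivWith c C (morreyEmbeddingNorm p θ₁ p θ₂ v₁ v₂ ω₁ ω₂)
            (supTerm p θ₁ θ₂ v₁ v₂ ω₁ ω₂ + endTerm p θ₁ θ₂ v₁ v₂ ω₁ ω₂)) ∧
        (θ₂ < θ₁ →
          EquivWith c C (morreyEmbeddingNorm p θ₁ p θ₂ v₁ v₂ ω₁ ω₂)
            (intTerm₁ p θ₁ θ₂ v₁ v₂ ω₁ ω₂ + intTerm₂ p θ₁ θ₂ v₁ v₂ ω₁ ω₂
              + endTerm p θ₁ θ₂ v₁ v₂ ω₁ ω₂)) := by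
  have hp₁ : p < θ₁ := hpθ.trans_le (min_le_left _ _)
  have hp₂ : p < θ₂ := hpθ.trans_le (min_le_right _ _)
  have hpt : p ≠ ∞ := (hp₁.trans hθ₁).ne
  have h₁ : θ₁ ≠ 0 := (hp.trans hp₁).ne'
  have h₂ : θ₂ ≠ 0 := (hp.trans hp₂).ne'
  have hP := ENNReal.toReal_pos hp.ne' hpt
  have hT₁ := ENNReal.toReal_pos h₁ hθ₁.ne
  have hT₂ := ENNReal.toReal_pos h₂ hθ₂.ne
  have ha1 := one_lt_div_toReal hp.ne' hp₁ hθ₁.ne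
  have hβ1 := one_lt_div_toReal hp.ne' hp₂ hθ₂.ne
  have hab := Real.HolderConjugate.conjExponent ha1
  have hr₁ := arrow_toReal_eq hp.ne' hp₁ hθ₁.ne
  have hr₂ := arrow_toReal_eq hp.ne' hp₂ hθ₂.ne
  obtain ⟨k, hk⟩ := exists_add_rpow_equiv (r := p.toReal⁻¹) (by positivity)
  rcases le_or_gt θ₁ θ₂ with hle | hlt
  · have haβ : θ₁.toReal / p.toReal ≤ θ₂.toReal / p.toReal :=
      div_le_div_of_nonneg_right (ENNReal.toReal_mono hθ₂.ne hle) hP.le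
    obtain ⟨C, hC⟩ := lintegral_le_supBound hab haβ
    obtain ⟨C', hC'⟩ := OperatorBound.supBound_add_endBound_le hab
    refine ⟨(k * (C' ^ p.toReal⁻¹ * 2) + 1)⁻¹,
      (C ^ (θ₂.toReal / p.toReal)⁻¹) ^ p.toReal⁻¹ * k + 1, by positivity, by positivity,
      fun n hn v₁ v₂ ω₁ ω₂ hv₁ _ hv hω₁ hω₂ =>
      ⟨fun _ => ?_, fun h => absurd h (not_lt.2 hle)⟩⟩
    obtain ⟨a, ha, hav⟩ := hv
    have hm := hω₁.isHalfLine h₁ hθ₁.ne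
    have hμ := dNeg_eq hp.ne' hp₁ hθ₁.ne hω₁
    rw [supTerm_eq hP h₂ hθ₂.ne rfl hab.symm.pos hr₁ hμ, endTerm_eq hP h₁ hθ₁.ne h₂ hθ₂.ne rfl rfl]
    have hk0 := hk 0 (supBound (powMeasure θ₁.toReal ω₁) (powMeasure θ₂.toReal ω₂)
      (powV p v₁ v₂) (θ₁.toReal / p.toReal).conjExponent (θ₂.toReal / p.toReal))
      (endBound (powMeasure θ₁.toReal ω₁) (powMeasure θ₂.toReal ω₂)
      (powV p v₁ v₂) (θ₁.toReal / p.toReal) (θ₂.toReal / p.toReal))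
    rw [zero_add, ENNReal.zero_rpow_of_pos (by positivity), zero_add] at hk0
    exact equivWith_of_operator hn hp.ne' hpt h₁ hθ₁.ne h₂ hθ₂.ne hv₁ ha hav hω₁ hω₂
      (fun hA h hh hs hz => hC _ _ h _ hm (sfinite_powMeasure _ _) (powMeasure_Iic_zero _ _)
        (fun x hx => hω₂.powMeasure_Ioi_ne_zero h₂ hθ₂.ne hx) hh hs hz powV_mono
        (powV_ne_top ha hav) hA)
      (fun K hK => hC' _ _ _ _ K hm (by positivity) hK powV_mono (powV_ne_top ha hav))
      hk0.1 hk0.2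
  · obtain ⟨ρ, hρ, hρβ⟩ : ∃ ρ : ℝ, 0 < ρ ∧
        ρ⁻¹ = (θ₂.toReal / p.toReal)⁻¹ - (θ₁.toReal / p.toReal)⁻¹ := by
      refine ⟨_, inv_pos.2 (sub_pos.2 ?_), inv_inv _⟩
      have hlt' := ENNReal.toReal_strict_mono hθ₁.ne hlt
      gcongr
    have hr : (arrow θ₁ θ₂).toReal = p.toReal * ρ := by
      rw [arrow_toReal h₂ hlt, ← inv_inv ρ, hρβ]
      have : θ₂.toReal⁻¹ - θ₁.toReal⁻¹
          = p.toReal⁻¹ * ((θ₂.toReal / p.toReal)⁻¹ - (θ₁.toReal / p.toReal)⁻¹) := by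
        field_simp
      rw [this, mul_inv, inv_inv]
    obtain ⟨C, hC⟩ := lintegral_le_intBound hab hβ1 hρ hρβ
    obtain ⟨C', hC'⟩ := OperatorBound.intBound_add_endBound_le hab hβ1 hρ hρβ
    refine ⟨(k * (C' ^ p.toReal⁻¹ * 2) + 1)⁻¹,
      (C ^ (θ₂.toReal / p.toReal)⁻¹) ^ p.toReal⁻¹ * k + 1, by positivity, by positivity,
      fun n hn v₁ v₂ ω₁ ω₂ hv₁ _ hv hω₁ hω₂ =>
      ⟨fun h => absurd hlt (not_lt.2 h), fun _ => ?_⟩⟩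
    obtain ⟨a, ha, hav⟩ := hv
    have hm := hω₁.isHalfLine h₁ hθ₁.ne
    have hμ := dNeg_eq hp.ne' hp₁ hθ₁.ne hω₁
    rw [intTerm₁_eq hP h₂ hθ₂.ne rfl hβ1 hρ hr hr₂ hm hμ,
      intTerm₂_eq hP h₂ hθ₂.ne rfl hβ1 hρ hr₁ hr hr₂ hm hμ,
      endTerm_eq hP h₁ hθ₁.ne h₂ hθ₂.ne rfl rfl]
    exact equivWith_of_operator hn hp.ne' hpt h₁ hθ₁.ne h₂ hθ₂.ne hv₁ ha hav hω₁ hω₂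
      (fun hA h hh hs hz => hC _ _ h _ hm (sfinite_powMeasure _ _) (powMeasure_Iic_zero _ _)
        (fun x hx => hω₂.powMeasure_Ioi_ne_zero h₂ hθ₂.ne hx) hh hs hz powV_mono
        (powV_ne_top ha hav) hA)
      (fun K hK => hC' _ _ _ K hm (nullSingletonClass_powMeasure _ _) (sfinite_powMeasure _ _)
        (fun x hx => hω₂.powMeasure_Ioi_ne_top h₂ hθ₂.ne hx) hK powV_mono
        (powV_ne_top ha hav) fun x hx c hc => exists_lt_powV hP ha hav hx hc)
      (hk _ _ _).1 (hk _ _ _).2
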